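/- **Setting.** Let $m,l\ge 1$ and let $X=\{X(t,\omega):t\in\mathbb R^m\}$ be an $\mathbb R^l$-valued random field over a probability space $(\Omega_X,\mathcal F_X,P_X)$ that is jointly measurable in $(t,\omega)$ and (strictly) homogeneous, i.e. its finite-dimensional distributions are invariant under shifts of $t$. Assume that for every $t$, $X(t)\in(0,1)^l$ a.s., and that the distribution function $F(x)=P_X\{X^1(0)\le x^1,\dots,X^l(0)\le x^l\}$ is continuous. $X$ is *ergodic* if every event $\{X\in\Lambda\}$ ($\Lambda$ in the product $\sigma$-algebra on the sample functions $\mathbb R^m\to\mathbb R^l$) that is invariant modulo $P_X$ under all shifts $x(\cdot)\mapsto x(\cdot+s)$ has probability $0$ or $1$. Let $T_1\subset T_2\subset\cdots$ be bounded convex Borel sets in $\mathbb R^m$ of positive Lebesgue measure $\lambda$, with $T_n$ containing a ball of radius $r_n$, $r_n\to\infty$. Let $k_n\in\mathbb N$, $k_n\to\infty$, and for each $n$ let $\tau_{n,1},\dots,\tau_{n,k_n}$ be independent random vectors over a probability space $(\Omega_\tau,\mathcal F_\tau,P_\tau)$, each uniformly distributed on $T_n$. Everything is considered on the product space $(\Omega_X\times\Omega_\tau,P_X\times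 P_\tau)$, so that the $\tau_{n,i}$ are independent of $X$. For $x\in[0,1]^l$ and $[0,x]=\prod_{i}[0,x^i]$ put $$F_n(x)=\frac1{k_n}\sum_{i=1}^{k_n}\mathbf 1_{[0,x]}(X(\tau_{n,i})),\qquad M_n(x)=\frac1{\lambda(T_n)}\int_{T_n}\mathbf 1_{[0,x]}(X(s))\,\lambda(ds),$$ $$L_n(x)=k_n^{1/2}(F_n(x)-M_n(x)),\qquad G_n(x)=k_n^{1/2}(F_n(x)-F(x)).$$ Let $\mathbb D$ be any set of bounded measurable real functions on $[0,1]^l$ that contains $C([0,1]^l)$, such that there is one countable subset of $[0,1]^l$ over which the supremum of $|f|$ equals its supremum norm for every $f\in\mathbb D$, with a metric $\rho$ making $\mathbb D$ complete and separable, whose topology is weaker than that of uniform convergence, and such that $\rho(f_n,f)\to0$ with $f$ continuous implies $f_n\to f$ uniformly. In each of the two assertions below the processes concerned ($L_n$, respectively $G_n$) are understood to be random elements of $\mathbb D$ with its Borel $\sigma$-algebra, and $\Rightarrow$ is weak convergence of their laws in $(\mathbb D,\rho)$. Let $\mathring W_F$ denote the continuous centered Gaussian process on $[0,1]^l$ with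 covariance $K(x,y)=F(x\wedge y)-F(x)F(y)$, where $x\wedge y$ is the coordinatewise minimum. **Theorem.** If $X$ is ergodic, then $\mathring W_F$ exists and $$L_n\Longrightarrow \mathring W_F .$$ If in addition $k_n^{1/2}\sup_{x\in[0,1]^l}|M_n(x)-F(x)|\to0$ in $P_X$-probability, then $$G_n\Longrightarrow \mathring W_F .$$ -/

import Mathlib

open MeasureTheory ProbabilityTheory Filter Topology

/-! ### Random fields -/

/-- `X = (X t)_{t ∈ T}` is (strictly) homogeneous, i.e. stationary: all its finite-dimensional
distributions are shift-invariant. -/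
def IsHomogeneousField {T Ω S : Type*} [Add T] [MeasurableSpace Ω] [MeasurableSpace S]
    (X : T → Ω → S) (P : Measure Ω) : Prop :=
  ∀ (k : ℕ) (t : Fin k → T) (s : T) (A : Fin k → Set S), (∀ i, MeasurableSet (A i)) →
    P {ω | ∀ i, X (t i + s) ω ∈ A i} = P {ω | ∀ i, X (t i) ω ∈ A i}

/-- The field `X` is ergodic (metrically transitive): every event `{X ∈ Λ}`, with `Λ` in the product
`σ`-algebra of the space of sample functions `T → S`, that is invariant modulo `P` under all the
shifts `x(·) ↦ x(· + s)` has probability zero or one. -/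
def IsErgodicField {T Ω S : Type*} [Add T] [MeasurableSpace Ω] [MeasurableSpace S]
    (X : T → Ω → S) (P : Measure Ω) : Prop :=
  ∀ Λ : Set (T → S), MeasurableSet Λ →
    (∀ s : T, P {ω | ¬ ((fun t => X (t + s) ω) ∈ Λ ↔ (fun t => X t ω) ∈ Λ)} = 0) →
    P {ω | (fun t => X t ω) ∈ Λ} = 0 ∨ P {ω | (fun t => X t ω) ∈ Λ} = 1

/-- The (multivariate) distribution function `x ↦ P(Y¹ ≤ x¹, …, Yˡ ≤ xˡ)` of a random vector. -/
noncomputable def distFun {Ω : Type*} [MeasurableSpace Ω] {l : ℕ} (P : Measure Ω)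
    (Y : Ω → Fin l → ℝ) (x : Fin l → ℝ) : ℝ :=
  P.real {ω | ∀ i, Y ω i ≤ x i}

/-! ### The empirical processes -/

/-- The cube `[0,1]^l`. -/
abbrev Cube (l : ℕ) : Type := Set.Icc (0 : Fin l → ℝ) 1

/-- The indicator of the box `[0, x] = [0, x¹] × ⋯ × [0, xˡ]`. -/
noncomputable def boxInd {l : ℕ} (x : Cube l) : (Fin l → ℝ) → ℝ :=
  (Set.Icc (0 : Fin l → ℝ) (x : Fin l → ℝ)).indicator 1

/-- The empirical distribution function `(1/k) ∑ᵢ 1_{[0,x]}(Yᵢ)` of a finite sample. -/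
noncomputable def empiricalDF {l k : ℕ} (Y : Fin k → Fin l → ℝ) (x : Cube l) : ℝ :=
  (k : ℝ)⁻¹ * ∑ i, boxInd x (Y i)

/-- The mean occupation `(1/λ(A)) ∫_A 1_{[0,x]}(y(s)) λ(ds)` of the box `[0,x]` by the function `y`
during the "time" set `A ⊆ ℝᵐ`. -/
noncomputable def meanDF {m l : ℕ} (A : Set (EuclideanSpace ℝ (Fin m)))
    (y : EuclideanSpace ℝ (Fin m) → Fin l → ℝ) (x : Cube l) : ℝ :=
  (volume.real A)⁻¹ * ∫ s in A, boxInd x (y s)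

/-! ### The path spaces `𝔻` -/

/-- `D`, with the metric it carries, is (via the injection `toFun`) a set of bounded measurable
functions on the cube `[0,1]^l` which contains all continuous functions, on which the supremum norm
is determined by a countable subset of the cube, and whose metric is complete and separable, has a
topology weaker than that of uniform convergence, and is such that convergence to a continuous
function implies uniform convergence. -/
structure PathSpace (l : ℕ) (D : Type*) [MetricSpace D] where
  /-- the function on the cube represented by an element of `D` -/
  toFun : D → Cube l → ℝ
  injective : Function.Injective toFun
  measurable : ∀ f, Measurable (toFun f)
  bounded : ∀ f, ∃ C, ∀ x, |toFun f x| ≤ C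
  /-- the inclusion of the continuous functions -/
  ofContinuous : C(Cube l, ℝ) → D
  toFun_ofContinuous : ∀ g x, toFun (ofContinuous g) x = g x
  countable_sup : ∃ S : Set (Cube l), S.Countable ∧
    ∀ f (c : ℝ), (∀ x ∈ S, |toFun f x| ≤ c) → ∀ x, |toFun f x| ≤ c
  complete : CompleteSpace D
  separable : TopologicalSpace.SeparableSpace D
  tendsto_of_uniform : ∀ (u : ℕ → D) (f : D),
    TendstoUniformly (fun n => toFun (u n)) (toFun f) atTop → Tendsto u atTop (𝓝 f)
  uniform_of_tendsto : ∀ (u : ℕ → D) (f : D), Continuous (toFun f) →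
    Tendsto u atTop (𝓝 f) → TendstoUniformly (fun n => toFun (u n)) (toFun f) atTop

/-- The random function `V` on the cube, defined on `(Ω, P)`, is represented by the random element
`Y` of `D` (equipped with its Borel `σ`-algebra). -/
structure PathSpace.Represents {l : ℕ} {D Ω : Type*} [MetricSpace D] [MeasurableSpace D]
    [MeasurableSpace Ω] (S : PathSpace l D) (P : Measure Ω) (Y : Ω → D)
    (V : Ω → Cube l → ℝ) : Prop where
  aemeasurable : AEMeasurable Y P
  toFun_eq : ∀ᵐ ω ∂P, S.toFun (Y ω) = V ω

/-! ### The Brownian bridge -/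

/-- The Borel `σ`-algebra on the space of continuous functions on the cube (sup norm). -/
noncomputable instance Cube.measurableSpaceC (l : ℕ) : MeasurableSpace C(Cube l, ℝ) := borel _

instance Cube.borelSpaceC (l : ℕ) : BorelSpace C(Cube l, ℝ) := ⟨rfl⟩

/-- `ν` is the law on `C([0,1]^l)` of the `F`-Brownian bridge: the continuous centered Gaussian
process with covariance `K(x, y) = F(x ∧ y) - F(x) F(y)`. -/
structure IsBrownianBridgeLaw {l : ℕ} (F : (Fin l → ℝ) → ℝ) (ν : Measure C(Cube l, ℝ)) : Prop where
  gaussian : IsGaussianProcess (fun (x : Cube l) (w : C(Cube l, ℝ)) => w x) ν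
  centered : ∀ x : Cube l, ∫ w, w x ∂ν = 0
  cov : ∀ x y : Cube l, covariance (fun w : C(Cube l, ℝ) => w x) (fun w => w y) ν =
    F ((x : Fin l → ℝ) ⊓ y) - F x * F y

/-! Freeze a realization of the field. The values $X(\tau_{n,i})$ then form an i.i.d. sample of size
$k_n$ from the occupation law of that realization over $T_n$, and $M_n$ is the distribution function
of this law on the cube. Conditionally on the field, $L_n$ is therefore a classical empirical
process, built on a triangular array whose row laws change with $n$. The theorem combines an ergodic
theorem for the row laws with a central limit theorem for such arrays.

Row laws. The mean ergodic theorem over convex sets containing large balls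
(`tendsto_lintegral_enorm_average_sub`) gives $M_n(x)\to F(x)$ in $L^1$ for each $x$. Along a
subsequence this holds almost surely at all truncated rational points, hence everywhere, by
monotonicity and continuity of $F$ (`exists_strictMono_ae_isSampleArray`).

Arrays. Finite-dimensional limits come from a characteristic function estimate whose error depends
only on the sample size and a bound for the summands (`norm_charFun_normalized_sum_sub_le`).
Equicontinuity comes from exponential bounds and chaining (`exists_modulus_normalizedDF`). There the
constants depend on $l$ and the precision only, because distances are measured by the marginals of
the sampled law itself; this matters since occupation laws may have atoms. Both properties are
recorded in `IsAsympGaussian`. It yields a continuous Gaussian limit, a cluster point of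
interpolated Gaussian vectors (`IsAsympGaussian.exists_limit`), and weak convergence in any path
space, by comparing closed sets with uniform neighbourhoods (`PathSpace.tendstoInDistribution`).

Removing the conditioning. Every subsequence has a further one along which the conditional laws
converge almost surely to the same limit, so dominated convergence gives convergence on the product
space (`PathSpace.tendstoInDistribution_prod`). Finally, $G_n$ is $L_n$ plus the drift
$k_n^{1/2}(M_n-F)$, which depends on the field only and is uniformly negligible along a subsequence.
-/

set_option linter.unusedSectionVars false

/-! ### Exponential inequalities for bounded sums -/

/-- A Bernstein-type bound for the centred and normalized sums of a bounded function of a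
sample. -/
theorem measureReal_le_normalized_sum_le {Ω E : Type*} [MeasurableSpace Ω] [MeasurableSpace E]
    {P : Measure Ω} [IsProbabilityMeasure P] {μ : Measure E} [IsProbabilityMeasure μ]
    {k : ℕ} (hk : 0 < k) {ξ : Fin k → Ω → E} (hξ : ∀ i, Measurable (ξ i))
    (hind : iIndepFun ξ P) (hlaw : ∀ i, P.map (ξ i) = μ)
    {Y : E → ℝ} (hY : Measurable Y) (hY1 : ∀ e, |Y e| ≤ 1) {v s : ℝ}
    (hv : ∫ e, Y e ^ 2 ∂μ ≤ v) (hs0 : 0 ≤ s) (hs : s ≤ √k) (a : ℝ) :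
    P.real {ω | a ≤ √k * ((k : ℝ)⁻¹ * ∑ i, Y (ξ i ω) - ∫ e, Y e ∂μ)} ≤
      Real.exp (-s * a + s ^ 2 * v) := by
  have hk' : (0 : ℝ) < k := by exact_mod_cast hk
  have hsk : 0 < √(k : ℝ) := Real.sqrt_pos.2 hk'
  have hss : √(k : ℝ) * √(k : ℝ) = k := Real.mul_self_sqrt hk'.le
  set m := ∫ e, Y e ∂μ
  set σ := s / √k
  have hσ0 : 0 ≤ σ := by positivity
  have hσ1 : σ ≤ 1 := (div_le_one hsk).2 hs
  have hYi : Integrable Y μ := Integrable.of_bound hY.aestronglyMeasurable 1 (ae_of_all _ hY1)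
  have hY2i : Integrable (fun e => Y e ^ 2) μ :=
    Integrable.of_bound (hY.pow_const 2).aestronglyMeasurable 1
      (ae_of_all _ fun e => by
        rw [Real.norm_eq_abs, abs_pow]; exact pow_le_one₀ (abs_nonneg _) (hY1 e))
  -- the moment generating function of one summand
  have hone : ∫ e, Real.exp (σ * (Y e - m)) ∂μ ≤ Real.exp (σ ^ 2 * v) := by
    -- Since $\sigma=s/\sqrt k\le1$, the exponent is at most 1 in modulus and $e^u\le 1+u+u^2$
    -- applies. This is the only use of $s\le\sqrt k$.
    have hpt : ∀ e, Real.exp (σ * Y e) ≤ 1 + σ * Y e + σ ^ 2 * Y e ^ 2 := by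
      intro e
      have h1 : |σ * Y e| ≤ 1 := by
        rw [abs_mul, abs_of_nonneg hσ0]; exact mul_le_one₀ hσ1 (abs_nonneg _) (hY1 e)
      have := Real.abs_exp_sub_one_sub_id_le h1
      have := (abs_le.1 this).2
      nlinarith
    have hint : ∫ e, Real.exp (σ * Y e) ∂μ ≤ 1 + σ * m + σ ^ 2 * v := by
      have h2 : Integrable (fun e => 1 + σ * Y e + σ ^ 2 * Y e ^ 2) μ :=
        ((integrable_const _).add (hYi.const_mul _)).add (hY2i.const_mul _)
      calc ∫ e, Real.exp (σ * Y e) ∂μ ≤ ∫ e, (1 + σ * Y e + σ ^ 2 * Y e ^ 2) ∂μ :=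
            integral_mono_of_nonneg (ae_of_all _ fun e => (Real.exp_pos _).le) h2
              (ae_of_all _ hpt)
        _ = 1 + σ * m + σ ^ 2 * ∫ e, Y e ^ 2 ∂μ := by
            have e1 := integral_add (μ := μ) (f := fun e => 1 + σ * Y e)
              (g := fun e => σ ^ 2 * Y e ^ 2)
              ((integrable_const _).add (hYi.const_mul _)) (hY2i.const_mul _)
            have e2 := integral_add (μ := μ) (f := fun _ => (1 : ℝ)) (g := fun e => σ * Y e)
              (integrable_const _) (hYi.const_mul _)
            rw [e1, e2, integral_const_mul, integral_const_mul]
            simp [m]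
        _ ≤ _ := by gcongr
    have h3 : ∀ e, Real.exp (σ * (Y e - m)) = Real.exp (-(σ * m)) * Real.exp (σ * Y e) := by
      intro e; rw [← Real.exp_add]; ring_nf
    simp_rw [h3]
    rw [integral_const_mul]
    calc Real.exp (-(σ * m)) * ∫ e, Real.exp (σ * Y e) ∂μ
        ≤ Real.exp (-(σ * m)) * Real.exp (σ * m + σ ^ 2 * v) := by
          gcongr
          refine hint.trans ?_
          have := Real.add_one_le_exp (σ * m + σ ^ 2 * v)
          linarith
      _ = _ := by rw [← Real.exp_add]; ring_nf
  have hmeas : ∀ i, Measurable (fun ω => Y (ξ i ω) - m) := fun i => (hY.comp (hξ i)).sub_const m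
  have hind' : iIndepFun (fun i ω => Y (ξ i ω) - m) P :=
    hind.comp (fun _ e => Y e - m) (fun _ => hY.sub_const m)
  have hmgf : mgf (∑ i, fun ω => Y (ξ i ω) - m) P σ ≤ Real.exp (s ^ 2 * v) := by
    rw [hind'.mgf_sum hmeas]
    calc ∏ i, mgf (fun ω => Y (ξ i ω) - m) P σ ≤ ∏ _i : Fin k, Real.exp (σ ^ 2 * v) := by
          refine Finset.prod_le_prod (fun i _ => mgf_nonneg) fun i _ => ?_
          refine le_trans (le_of_eq ?_) hone
          rw [← hlaw i, integral_map (hξ i).aemeasurable (by fun_prop)]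
          rfl
      _ = _ := by
          rw [Finset.prod_const, Finset.card_univ, Fintype.card_fin, ← Real.exp_nat_mul]
          congr 1
          have : σ ^ 2 * k = s ^ 2 := by
            simp only [σ]; rw [div_pow, Real.sq_sqrt hk'.le]; field_simp
          rw [← this]; ring
  have hbound : ∀ ω, (∑ i, fun ω => Y (ξ i ω) - m) ω = ∑ i, (Y (ξ i ω) - m) := fun ω => by
    simp
  have hset : {ω | a ≤ √k * ((k : ℝ)⁻¹ * ∑ i, Y (ξ i ω) - m)} =
      {ω | √k * a ≤ (∑ i, fun ω => Y (ξ i ω) - m) ω} := by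
    ext ω
    simp only [Set.mem_ofPred_eq, hbound, Finset.sum_sub_distrib, Finset.sum_const,
      Finset.card_univ, Fintype.card_fin, nsmul_eq_mul]
    have : √(k : ℝ) * (√k * ((k : ℝ)⁻¹ * ∑ i, Y (ξ i ω) - m)) = ∑ i, Y (ξ i ω) - k * m := by
      rw [← mul_assoc, hss]; field_simp
    rw [← this]
    exact (mul_le_mul_iff_right₀ hsk).symm
  rw [hset]
  refine (measure_ge_le_exp_mul_mgf (√k * a) hσ0 ?_).trans ?_
  · refine Integrable.of_bound (C := Real.exp (σ * ∑ _i : Fin k, (1 + |m|))) ?_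
      (ae_of_all _ fun ω => ?_)
    · have : Measurable (∑ i, fun ω => Y (ξ i ω) - m) := by
        rw [show (∑ i, fun ω => Y (ξ i ω) - m) = fun ω => ∑ i, (Y (ξ i ω) - m) from funext hbound]
        exact Finset.measurable_sum _ fun i _ => hmeas i
      exact (this.const_mul σ).exp.aestronglyMeasurable
    · rw [Real.norm_eq_abs, Real.abs_exp, hbound]
      gcongr with i
      have := (abs_le.1 (hY1 (ξ i ω))).2
      have := neg_abs_le m
      linarith
  · calc Real.exp (-σ * (√k * a)) * mgf (∑ i, fun ω => Y (ξ i ω) - m) P σ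
        ≤ Real.exp (-σ * (√k * a)) * Real.exp (s ^ 2 * v) := by gcongr
      _ = _ := by
        rw [← Real.exp_add]; congr 1
        have : σ * √k = s := div_mul_cancel₀ _ hsk.ne'
        linear_combination (-a) * this

theorem measureReal_le_abs_normalized_sum_le {Ω E : Type*} [MeasurableSpace Ω]
    [MeasurableSpace E]
    {P : Measure Ω} [IsProbabilityMeasure P] {μ : Measure E} [IsProbabilityMeasure μ]
    {k : ℕ} (hk : 0 < k) {ξ : Fin k → Ω → E} (hξ : ∀ i, Measurable (ξ i))
    (hind : iIndepFun ξ P) (hlaw : ∀ i, P.map (ξ i) = μ)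
    {Y : E → ℝ} (hY : Measurable Y) (hY1 : ∀ e, |Y e| ≤ 1) {v s : ℝ}
    (hv : ∫ e, Y e ^ 2 ∂μ ≤ v) (hs0 : 0 ≤ s) (hs : s ≤ √k) (a : ℝ) :
    P.real {ω | a ≤ |√k * ((k : ℝ)⁻¹ * ∑ i, Y (ξ i ω) - ∫ e, Y e ∂μ)|} ≤
      2 * Real.exp (-s * a + s ^ 2 * v) := by
  have h1 := measureReal_le_normalized_sum_le hk hξ hind hlaw hY hY1 hv hs0 hs a
  have h2 := measureReal_le_normalized_sum_le hk hξ hind hlaw (Y := fun e => -Y e) hY.neg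
    (fun e => by rw [abs_neg]; exact hY1 e) (v := v) (by simpa using hv) hs0 hs a
  rw [two_mul]
  refine le_trans ?_ (add_le_add h1 h2)
  refine le_trans (measureReal_mono ?_ (by finiteness)) (measureReal_union_le _ _)
  intro ω hω
  simp only [Set.mem_ofPred_eq, Set.mem_union, le_abs] at hω ⊢
  refine hω.imp id fun h => h.trans (le_of_eq ?_)
  rw [integral_neg, Finset.sum_neg_distrib]; ring

/-! ### Marginal distribution functions -/

/-- The distribution function of the `i`-th marginal of `μ`. -/
noncomputable def marginalDF {l : ℕ} (μ : Measure (Fin l → ℝ)) (i : Fin l) (t : ℝ) : ℝ :=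
  μ.real {y | y i ≤ t}

/-- The pseudometric on `ℝˡ` induced by the marginal distribution functions of `μ`. -/
noncomputable def marginalDist {l : ℕ} (μ : Measure (Fin l → ℝ)) (x y : Fin l → ℝ) : ℝ :=
  ∑ i, |marginalDF μ i (x i) - marginalDF μ i (y i)|

/-- The empirical process `x ↦ √k (F_k(x) - μ[0,x])` of a sample. -/
noncomputable def normalizedDF {l k : ℕ} (μ : Measure (Fin l → ℝ)) (Y : Fin k → Fin l → ℝ)
    (x : Cube l) : ℝ :=
  √(k : ℝ) * (empiricalDF Y x - μ.real (Set.Icc 0 (x : Fin l → ℝ)))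

section Marginal

variable {l : ℕ} {μ : Measure (Fin l → ℝ)} [IsProbabilityMeasure μ]

theorem marginalDF_mono (i : Fin l) : Monotone (marginalDF μ i) := fun _ _ h =>
  measureReal_mono (fun _ hy => le_trans hy h) (by finiteness)

theorem marginalDF_nonneg (i : Fin l) (t : ℝ) : 0 ≤ marginalDF μ i t := measureReal_nonneg

theorem marginalDF_le_one (i : Fin l) (t : ℝ) : marginalDF μ i t ≤ 1 := measureReal_le_one

theorem measurableSet_coord_le (i : Fin l) (t : ℝ) : MeasurableSet {y : Fin l → ℝ | y i ≤ t} :=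
  measurableSet_le (measurable_pi_apply i) measurable_const

theorem measureReal_coord_mem_Ioc (i : Fin l) {s t : ℝ} (h : s ≤ t) :
    μ.real {y | y i ∈ Set.Ioc s t} = marginalDF μ i t - marginalDF μ i s := by
  have : {y : Fin l → ℝ | y i ∈ Set.Ioc s t} = {y | y i ≤ t} \ {y | y i ≤ s} := by
    ext y; simp [Set.mem_Ioc, and_comm]
  rw [this, measureReal_sdiff (Set.ofPred_subset_ofPred.2 fun y hy => le_trans hy h)
    (measurableSet_coord_le i s)]
  rfl

theorem measureReal_coord_mem_uIoc (i : Fin l) (s t : ℝ) :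
    μ.real {y | y i ∈ Set.uIoc s t} = |marginalDF μ i s - marginalDF μ i t| := by
  rcases le_total s t with h | h
  · rw [Set.uIoc_of_le h, measureReal_coord_mem_Ioc i h, abs_sub_comm,
      abs_of_nonneg (sub_nonneg.2 (marginalDF_mono i h))]
  · rw [Set.uIoc_of_ge h, measureReal_coord_mem_Ioc i h,
      abs_of_nonneg (sub_nonneg.2 (marginalDF_mono i h))]

theorem marginalDist_comm (x y : Fin l → ℝ) : marginalDist μ x y = marginalDist μ y x := by
  simp only [marginalDist, abs_sub_comm]

theorem marginalDist_triangle (x y z : Fin l → ℝ) :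
    marginalDist μ x z ≤ marginalDist μ x y + marginalDist μ y z := by
  rw [marginalDist, marginalDist, marginalDist, ← Finset.sum_add_distrib]
  exact Finset.sum_le_sum fun i _ => abs_sub_le _ _ _

theorem boxInd_nonneg (x : Cube l) (e : Fin l → ℝ) : 0 ≤ boxInd x e :=
  Set.indicator_nonneg (fun _ _ => zero_le_one) _

theorem boxInd_le_one (x : Cube l) (e : Fin l → ℝ) : boxInd x e ≤ 1 :=
  Set.indicator_le' (fun _ _ => le_rfl) (fun _ _ => zero_le_one) _

theorem measurable_boxInd (x : Cube l) : Measurable (boxInd x) :=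
  measurable_one.indicator measurableSet_Icc

theorem integral_boxInd (x : Cube l) :
    ∫ e, boxInd x e ∂μ = μ.real (Set.Icc 0 (x : Fin l → ℝ)) :=
  integral_indicator_one measurableSet_Icc

theorem integrable_boxInd (x : Cube l) : Integrable (boxInd x) μ :=
  Integrable.of_bound (measurable_boxInd x).aestronglyMeasurable 1 (ae_of_all _ fun e => by
    rw [Real.norm_eq_abs, abs_of_nonneg (boxInd_nonneg x e)]; exact boxInd_le_one x e)

theorem abs_boxInd_sub_le_one (x y : Cube l) (e : Fin l → ℝ) :
    |boxInd x e - boxInd y e| ≤ 1 :=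
  abs_sub_le_iff.2 ⟨by linarith [boxInd_le_one x e, boxInd_nonneg y e],
    by linarith [boxInd_le_one y e, boxInd_nonneg x e]⟩

/-- A point lying in one box only must have a coordinate above one corner and not above the other.
Such an interval omits its smaller endpoint, which is why cells without their least point suffice
below. -/
theorem exists_mem_uIoc_of_boxInd_ne {x y : Cube l} {e : Fin l → ℝ}
    (h : boxInd x e ≠ boxInd y e) : ∃ i, e i ∈ Set.uIoc (x.1 i) (y.1 i) := by
  have key : ∀ x y : Cube l, e ∈ Set.Icc 0 (x : Fin l → ℝ) → e ∉ Set.Icc 0 (y : Fin l → ℝ) →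
      ∃ i, e i ∈ Set.uIoc (x.1 i) (y.1 i) := by
    intro x y hx hy
    have : ¬ e ≤ y := fun h => hy ⟨hx.1, h⟩
    rw [Pi.le_def] at this
    push Not at this
    obtain ⟨i, hi⟩ := this
    exact ⟨i, Set.mem_uIoc.2 (Or.inr ⟨hi, hx.2 i⟩)⟩
  by_cases hx : e ∈ Set.Icc 0 (x : Fin l → ℝ) <;> by_cases hy : e ∈ Set.Icc 0 (y : Fin l → ℝ)
  · exact absurd (by simp [boxInd, Set.indicator_of_mem, hx, hy]) h
  · exact key x y hx hy
  · obtain ⟨i, hi⟩ := key y x hy hx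
    exact ⟨i, by rwa [Set.uIoc_comm]⟩
  · exact absurd (by simp [boxInd, Set.indicator_of_notMem, hx, hy]) h

/-- With `A` equal to the intervals this bounds moments by `marginalDist`; with `A` equal to cells
it bounds all differences inside one cell at once. -/
theorem abs_boxInd_sub_le_sum {x y : Cube l} {A : Fin l → Set ℝ}
    (hA : ∀ i, Set.uIoc (x.1 i) (y.1 i) ⊆ A i) (e : Fin l → ℝ) :
    |boxInd x e - boxInd y e| ≤ ∑ i, {e : Fin l → ℝ | e i ∈ A i}.indicator (1 : (Fin l → ℝ) → ℝ) e := by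
  have hnn : ∀ i ∈ Finset.univ,
      (0 : ℝ) ≤ {e : Fin l → ℝ | e i ∈ A i}.indicator (1 : (Fin l → ℝ) → ℝ) e :=
    fun i _ => Set.indicator_nonneg (fun _ _ => zero_le_one) _
  by_cases h : boxInd x e = boxInd y e
  · rw [h, sub_self, abs_zero]; exact Finset.sum_nonneg hnn
  · obtain ⟨i, hi⟩ := exists_mem_uIoc_of_boxInd_ne h
    refine (abs_boxInd_sub_le_one x y e).trans ?_
    refine le_trans (le_of_eq ?_) (Finset.single_le_sum hnn (Finset.mem_univ i))
    rw [Set.indicator_of_mem (show e ∈ {e : Fin l → ℝ | e i ∈ A i} from hA i hi)]; rfl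

theorem integral_abs_boxInd_sub_le (x y : Cube l) :
    ∫ e, |boxInd x e - boxInd y e| ∂μ ≤ marginalDist μ x y := by
  have hm : ∀ i, MeasurableSet {e : Fin l → ℝ | e i ∈ Set.uIoc (x.1 i) (y.1 i)} := fun i =>
    measurable_pi_apply i measurableSet_uIoc
  have hint : ∀ i, Integrable ({e : Fin l → ℝ | e i ∈ Set.uIoc (x.1 i) (y.1 i)}.indicator
      (1 : (Fin l → ℝ) → ℝ)) μ := fun i => (integrable_const (1 : ℝ)).indicator (hm i)
  calc ∫ e, |boxInd x e - boxInd y e| ∂μ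
      ≤ ∫ e, ∑ i, {e : Fin l → ℝ | e i ∈ Set.uIoc (x.1 i) (y.1 i)}.indicator
          (1 : (Fin l → ℝ) → ℝ) e ∂μ :=
        integral_mono_of_nonneg (ae_of_all _ fun e => abs_nonneg _)
          (integrable_finsetSum _ fun i _ => hint i)
          (ae_of_all _ fun e => abs_boxInd_sub_le_sum (fun i => subset_rfl) e)
    _ = marginalDist μ x y := by
        rw [integral_finsetSum _ fun i _ => hint i]
        refine Finset.sum_congr rfl fun i _ => ?_
        rw [integral_indicator_one (hm i), measureReal_coord_mem_uIoc]

/-- The difference is at most 1 in modulus, so its square is below its absolute value. Thus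
`marginalDist` serves as the variance proxy in the exponential inequality. -/
theorem integral_boxInd_sub_sq_le (x y : Cube l) :
    ∫ e, (boxInd x e - boxInd y e) ^ 2 ∂μ ≤ marginalDist μ x y := by
  refine le_trans (integral_mono_of_nonneg (ae_of_all _ fun e => sq_nonneg _)
    ((integrable_boxInd x).sub (integrable_boxInd y)).abs (ae_of_all _ fun e => ?_))
    (integral_abs_boxInd_sub_le x y)
  change (boxInd x e - boxInd y e) ^ 2 ≤ |boxInd x e - boxInd y e|
  rw [← sq_abs]
  exact pow_le_of_le_one (abs_nonneg _) (abs_boxInd_sub_le_one x y e) two_ne_zero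

theorem abs_measureReal_Icc_sub_le (x y : Cube l) :
    |μ.real (Set.Icc 0 (x : Fin l → ℝ)) - μ.real (Set.Icc 0 (y : Fin l → ℝ))| ≤
      marginalDist μ x y := by
  rw [← integral_boxInd, ← integral_boxInd,
    ← integral_sub (integrable_boxInd x) (integrable_boxInd y)]
  exact (abs_integral_le_integral_abs).trans (integral_abs_boxInd_sub_le x y)

/-! ### Finite nets -/

/-- The vector of the integer parts of `2ʲ` times the marginal distribution functions. -/
noncomputable def netIndex (μ : Measure (Fin l → ℝ)) (j : ℕ) (x : Cube l) (i : Fin l) : ℕ :=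
  ⌊(2 : ℝ) ^ j * marginalDF μ i (x.1 i)⌋₊

instance Cube.instNonempty (l : ℕ) : Nonempty (Cube l) :=
  ⟨⟨0, Set.left_mem_Icc.2 zero_le_one⟩⟩

/-- A representative of the cell of level `j` that contains `x`. -/
noncomputable def netPoint (μ : Measure (Fin l → ℝ)) (j : ℕ) (x : Cube l) : Cube l :=
  Function.invFun (netIndex μ j) (netIndex μ j x)

open Classical in
/-- The representatives of the cells of level `j`. -/
noncomputable def net (μ : Measure (Fin l → ℝ)) (j : ℕ) : Finset (Cube l) :=
  (Fintype.piFinset fun _ : Fin l => Finset.range (2 ^ j + 1)).image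
    (Function.invFun (netIndex μ j))

theorem netIndex_netPoint (j : ℕ) (x : Cube l) :
    netIndex μ j (netPoint μ j x) = netIndex μ j x :=
  Function.invFun_eq ⟨x, rfl⟩

theorem floor_marginalDF_le (j : ℕ) (i : Fin l) (t : ℝ) :
    ⌊(2 : ℝ) ^ j * marginalDF μ i t⌋₊ < 2 ^ j + 1 := by
  rw [Nat.lt_succ_iff]
  refine Nat.floor_le_of_le ?_
  push_cast
  exact mul_le_of_le_one_right (by positivity) (marginalDF_le_one i t)

theorem netPoint_mem_net (j : ℕ) (x : Cube l) : netPoint μ j x ∈ net μ j := by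
  classical
  refine Finset.mem_image.2 ⟨netIndex μ j x, Fintype.mem_piFinset.2 fun i => ?_, rfl⟩
  exact Finset.mem_range.2 (floor_marginalDF_le j i _)

theorem card_net_le (j : ℕ) : (net μ j).card ≤ (2 ^ j + 1) ^ l := by
  classical
  refine Finset.card_image_le.trans ?_
  simp

theorem abs_marginalDF_sub_le_of_floor_eq {j : ℕ} {i : Fin l} {s t : ℝ}
    (h : ⌊(2 : ℝ) ^ j * marginalDF μ i s⌋₊ = ⌊(2 : ℝ) ^ j * marginalDF μ i t⌋₊) :
    |marginalDF μ i s - marginalDF μ i t| ≤ 1 / 2 ^ j := by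
  have hp : (0 : ℝ) < 2 ^ j := by positivity
  have hs := Nat.floor_le (mul_nonneg hp.le (marginalDF_nonneg (μ := μ) i s))
  have ht := Nat.floor_le (mul_nonneg hp.le (marginalDF_nonneg (μ := μ) i t))
  have hs' := Nat.lt_floor_add_one ((2 : ℝ) ^ j * marginalDF μ i s)
  have ht' := Nat.lt_floor_add_one ((2 : ℝ) ^ j * marginalDF μ i t)
  rw [h] at hs hs'
  rw [abs_le, ← neg_div, div_le_iff₀ hp, le_div_iff₀ hp]
  constructor <;> nlinarith

theorem marginalDist_netPoint_le (j : ℕ) (x : Cube l) :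
    marginalDist μ x (netPoint μ j x) ≤ l / 2 ^ j := by
  calc marginalDist μ x (netPoint μ j x) ≤ ∑ _i : Fin l, (1 / 2 ^ j : ℝ) := by
        refine Finset.sum_le_sum fun i _ => abs_marginalDF_sub_le_of_floor_eq ?_
        exact (congrFun (netIndex_netPoint (μ := μ) j x) i).symm
    _ = l / 2 ^ j := by simp [div_eq_mul_inv]

/-- The cell number `a` of level `j` of the `i`-th axis, without its least point. -/
def openCell (μ : Measure (Fin l → ℝ)) (j : ℕ) (i : Fin l) (a : ℕ) : Set ℝ :=
  {t | ⌊(2 : ℝ) ^ j * marginalDF μ i t⌋₊ = a ∧ ∃ s < t, ⌊(2 : ℝ) ^ j * marginalDF μ i s⌋₊ = a}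

theorem floor_marginalDF_mono (j : ℕ) (i : Fin l) :
    Monotone fun t => ⌊(2 : ℝ) ^ j * marginalDF μ i t⌋₊ := fun _ _ h =>
  Nat.floor_mono (mul_le_mul_of_nonneg_left (marginalDF_mono i h) (by positivity))

theorem ordConnected_openCell (j : ℕ) (i : Fin l) (a : ℕ) :
    (openCell μ j i a).OrdConnected := by
  refine ⟨fun s hs t ht u hu => ?_⟩
  obtain ⟨h1, r, hr, h2⟩ := hs
  refine ⟨le_antisymm ?_ ?_, r, hr.trans_le hu.1, h2⟩
  · rw [← ht.1]; exact floor_marginalDF_mono j i hu.2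
  · rw [← h1]; exact floor_marginalDF_mono j i hu.1

/-- The least point is omitted because it may carry a large atom. A compact subset of what remains
lies in some $(s,t_1]$ with both ends in the cell, where the marginal distribution function varies
by at most $2^{-j}$; inner regularity passes to the whole set. -/
theorem measure_openCell_le (j : ℕ) (i : Fin l) (a : ℕ) :
    μ.real {e | e i ∈ openCell μ j i a} ≤ 1 / 2 ^ j := by
  have hm : MeasurableSet (openCell μ j i a) := (ordConnected_openCell j i a).measurableSet
  have hmap : ∀ A : Set ℝ, MeasurableSet A → (μ.map fun e => e i) A = μ {e | e i ∈ A} :=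
    fun A hA => Measure.map_apply (measurable_pi_apply i) hA
  have : IsProbabilityMeasure (μ.map fun e => e i) :=
    Measure.isProbabilityMeasure_map (measurable_pi_apply i).aemeasurable
  refine ENNReal.toReal_le_of_le_ofReal (by positivity) ?_
  rw [← hmap _ hm, hm.measure_eq_iSup_isCompact]
  refine iSup₂_le fun K hK => iSup_le fun hKc => ?_
  rcases K.eq_empty_or_nonempty with rfl | hne
  · simp
  obtain ⟨t0, ht0, hmin⟩ := hKc.exists_isLeast hne
  obtain ⟨t1, ht1, hmax⟩ := hKc.exists_isGreatest hne
  obtain ⟨h1, s, hs, h2⟩ := hK ht0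
  have hst : s ≤ t1 := hs.le.trans (hmin ht1)
  calc (μ.map fun e => e i) K ≤ (μ.map fun e => e i) (Set.Ioc s t1) :=
        measure_mono fun t ht => ⟨hs.trans_le (hmin ht), hmax ht⟩
    _ = ENNReal.ofReal (marginalDF μ i t1 - marginalDF μ i s) := by
        rw [hmap _ measurableSet_Ioc, ← measureReal_coord_mem_Ioc i hst, ofReal_measureReal]
    _ ≤ ENNReal.ofReal (1 / 2 ^ j) := by
        refine ENNReal.ofReal_le_ofReal (le_trans (le_abs_self _) ?_)
        exact abs_marginalDF_sub_le_of_floor_eq ((hK ht1).1.trans h2.symm)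

/-- The smaller endpoint, itself excluded from the interval, witnesses that no point of the interval
is least in its cell. -/
theorem uIoc_subset_openCell {j : ℕ} {x y : Cube l} (h : netIndex μ j x = netIndex μ j y)
    (i : Fin l) : Set.uIoc (x.1 i) (y.1 i) ⊆ openCell μ j i (netIndex μ j x i) := by
  intro t ht
  have hi : ⌊(2 : ℝ) ^ j * marginalDF μ i (x.1 i)⌋₊ = ⌊(2 : ℝ) ^ j * marginalDF μ i (y.1 i)⌋₊ :=
    congrFun h i
  rcases Set.mem_uIoc.1 ht with ⟨h1, h2⟩ | ⟨h1, h2⟩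
  · exact ⟨le_antisymm ((floor_marginalDF_mono j i h2).trans hi.symm.le)
      (floor_marginalDF_mono j i h1.le), _, h1, rfl⟩
  · exact ⟨le_antisymm (floor_marginalDF_mono j i h2)
      (hi.le.trans (floor_marginalDF_mono j i h1.le)), _, h1, hi.symm⟩

end Marginal

/-! ### Chaining -/

/-- Join $r_J x$ to $r_{j_0}x$, then to $r_{j_0}y$, then to $r_J y$. Consecutive links have length
at most $3c/2^j$ by the triangle inequality. The two chains cost two copies of the sum, and the
middle link $a_{j_0}$ is absorbed in a third. -/
theorem abs_sub_le_of_chaining {α : Type*} {d : α → α → ℝ} (hsymm : ∀ x y, d x y = d y x)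
    (htri : ∀ x y z, d x z ≤ d x y + d y z) {c : ℝ} (hc : 0 ≤ c) {r : ℕ → α → α}
    (hr : ∀ j x, d x (r j x) ≤ c / 2 ^ j) {Z : α → ℝ} {a : ℕ → ℝ} {N : ℕ → Set α}
    (hN : ∀ j x, r j x ∈ N j) {j₀ J : ℕ} (hJ : j₀ < J)
    (hgood : ∀ j, j₀ ≤ j → j < J → ∀ y ∈ N j ∪ N (j + 1), ∀ y' ∈ N j ∪ N (j + 1),
      d y y' ≤ 3 * c / 2 ^ j → |Z y - Z y'| ≤ a j)
    {x y : α} (hxy : d x y ≤ c / 2 ^ j₀) :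
    |Z (r J x) - Z (r J y)| ≤ 3 * ∑ j ∈ Finset.Ico j₀ J, a j := by
  have hstep : ∀ x, ∀ n, j₀ + n ≤ J →
      |Z (r (j₀ + n) x) - Z (r j₀ x)| ≤ ∑ j ∈ Finset.Ico j₀ (j₀ + n), a j := by
    intro x n
    induction n with
    | zero => simp
    | succ n ih =>
      intro hn
      have h1 := ih (by omega)
      have h2 : |Z (r (j₀ + n + 1) x) - Z (r (j₀ + n) x)| ≤ a (j₀ + n) := by
        refine hgood (j₀ + n) (by omega) (by omega) _ (Or.inr (hN _ _)) _ (Or.inl (hN _ _)) ?_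
        have e1 := htri (r (j₀ + n + 1) x) x (r (j₀ + n) x)
        rw [hsymm _ x] at e1
        have e2 := hr (j₀ + n + 1) x
        have e3 := hr (j₀ + n) x
        have e4 : c / 2 ^ (j₀ + n + 1) ≤ c / 2 ^ (j₀ + n) := by
          exact div_le_div_of_nonneg_left hc (by positivity)
            (pow_le_pow_right₀ one_le_two (Nat.le_succ _))
        have e5 : 0 ≤ c / 2 ^ (j₀ + n) := by positivity
        have e6 : 3 * c / 2 ^ (j₀ + n) = 3 * (c / 2 ^ (j₀ + n)) := by ring
        linarith
      rw [← add_assoc, Finset.sum_Ico_succ_top (by omega)]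
      have := abs_sub_le (Z (r (j₀ + n + 1) x)) (Z (r (j₀ + n) x)) (Z (r j₀ x))
      linarith
  have hbase : |Z (r j₀ x) - Z (r j₀ y)| ≤ a j₀ := by
    refine hgood j₀ le_rfl hJ _ (Or.inl (hN _ _)) _ (Or.inl (hN _ _)) ?_
    have e1 := htri (r j₀ x) x (r j₀ y)
    have e2 := htri x y (r j₀ y)
    rw [hsymm _ x] at e1
    have e3 := hr j₀ x
    have e4 := hr j₀ y
    have e6 : 3 * c / 2 ^ j₀ = 3 * (c / 2 ^ j₀) := by ring
    linarith
  have ha : ∀ j ∈ Finset.Ico j₀ J, 0 ≤ a j := by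
    intro j hj
    rw [Finset.mem_Ico] at hj
    obtain ⟨z⟩ : Nonempty α := ⟨x⟩
    refine (abs_nonneg _).trans
      (hgood j hj.1 hj.2 (r j z) (Or.inl (hN _ _)) (r j z) (Or.inl (hN _ _)) ?_)
    have e1 := htri (r j z) z (r j z)
    rw [hsymm _ z] at e1
    have e2 := hr j z
    have e5 : 0 ≤ c / 2 ^ j := by positivity
    have e6 : 3 * c / 2 ^ j = 3 * (c / 2 ^ j) := by ring
    linarith
  have hle : a j₀ ≤ ∑ j ∈ Finset.Ico j₀ J, a j :=
    Finset.single_le_sum ha (Finset.mem_Ico.2 ⟨le_rfl, hJ⟩)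
  have hx := hstep x (J - j₀) (by omega)
  have hy := hstep y (J - j₀) (by omega)
  rw [Nat.add_sub_cancel' hJ.le] at hx hy
  have e1 := abs_sub_le (Z (r J x)) (Z (r j₀ x)) (Z (r J y))
  have e2 := abs_sub_le (Z (r j₀ x)) (Z (r j₀ y)) (Z (r J y))
  rw [abs_sub_comm (Z (r j₀ y))] at e2
  linarith

/-! ### The modulus of continuity of the empirical process -/

/-- The increments allowed at the levels of the chaining argument. -/
noncomputable def chainStep (l : ℕ) (j : ℕ) : ℝ :=
  Real.log (2 * 16 ^ l) * ((j + 1) * (√2)⁻¹ ^ j)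

theorem chainStep_nonneg (l j : ℕ) : 0 ≤ chainStep l j := by
  have : 0 ≤ Real.log (2 * 16 ^ l) := Real.log_nonneg (by
    have : (1 : ℝ) ≤ 16 ^ l := one_le_pow₀ (by norm_num)
    linarith)
  unfold chainStep; positivity

theorem summable_chainStep (l : ℕ) : Summable (chainStep l) := by
  have hr : ‖(√2)⁻¹‖ < 1 := by
    rw [norm_inv, Real.norm_eq_abs, abs_of_nonneg (Real.sqrt_nonneg _)]
    exact inv_lt_one_of_one_lt₀ (Real.lt_sqrt_of_sq_lt (by norm_num))
  refine Summable.mul_left _ ?_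
  have h1 := summable_pow_mul_geometric_of_norm_lt_one 1 hr
  have h0 := summable_geometric_of_norm_lt_one hr
  refine (h1.add h0).congr fun j => ?_
  simp only [pow_one]; ring

section Empirical

variable {Ω : Type*} [MeasurableSpace Ω] {P : Measure Ω} [IsProbabilityMeasure P] {l k : ℕ}
  {μ : Measure (Fin l → ℝ)} [IsProbabilityMeasure μ] {ξ : Fin k → Ω → Fin l → ℝ}

theorem normalizedDF_sub (Y : Fin k → Fin l → ℝ) (x y : Cube l) :
    normalizedDF μ Y x - normalizedDF μ Y y =
      √k * ((k : ℝ)⁻¹ * ∑ i, (boxInd x (Y i) - boxInd y (Y i)) -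
        ∫ e, (boxInd x e - boxInd y e) ∂μ) := by
  rw [integral_sub (integrable_boxInd x) (integrable_boxInd y), integral_boxInd, integral_boxInd,
    Finset.sum_sub_distrib, normalizedDF, normalizedDF, empiricalDF, empiricalDF]
  ring

theorem measureReal_normalizedDF_sub_le (hk : 0 < k) (hξ : ∀ i, Measurable (ξ i))
    (hind : iIndepFun ξ P) (hlaw : ∀ i, P.map (ξ i) = μ) {x y : Cube l} {v s : ℝ}
    (hv : marginalDist μ x y ≤ v) (hs0 : 0 ≤ s) (hs : s ≤ √k) (a : ℝ) :
    P.real {ω | a ≤ |normalizedDF μ (fun i => ξ i ω) x -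
      normalizedDF μ (fun i => ξ i ω) y|} ≤ 2 * Real.exp (-s * a + s ^ 2 * v) := by
  simp_rw [normalizedDF_sub]
  exact measureReal_le_abs_normalized_sum_le hk hξ hind hlaw
    ((measurable_boxInd x).sub (measurable_boxInd y)) (fun e => abs_boxInd_sub_le_one x y e)
    ((integral_boxInd_sub_sq_le x y).trans hv) hs0 hs a

/-- The event that a chaining increment of level `j` is too large. -/
def chainBad (μ : Measure (Fin l → ℝ)) (ξ : Fin k → Ω → Fin l → ℝ) (j : ℕ) : Set Ω :=
  {ω | ∃ y ∈ (net μ j ∪ net μ (j + 1) : Set (Cube l)),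
    ∃ y' ∈ (net μ j ∪ net μ (j + 1) : Set (Cube l)), marginalDist μ y y' ≤ 3 * l / 2 ^ j ∧
      chainStep l j ≤ |normalizedDF μ (fun i => ξ i ω) y -
        normalizedDF μ (fun i => ξ i ω) y'|}

/-- At level $j$ there are at most $4\cdot16^{l(j+1)}$ pairs of net points. With $s=2^{j/2}$ the
variance term is the constant $3l$, and `chainStep` is chosen so that the linear term contributes
$(2\cdot16^l)^{-(j+1)}$: it beats the number of pairs and leaves a summable $2^{-(j+1)}$. -/
theorem chain_tail_bound (l j : ℕ) :
    ((2 * (2 ^ (j + 1) + 1) ^ l : ℕ) : ℝ) ^ 2 *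
      (2 * Real.exp (-(√2 ^ j) * chainStep l j + (√2 ^ j) ^ 2 * (3 * l / 2 ^ j))) ≤
      8 * Real.exp (3 * l) / 2 ^ (j + 1) := by
  have h2 : (√2 : ℝ) ≠ 0 := by positivity
  have e1 : (√2 ^ j) * chainStep l j = ((j + 1 : ℕ) : ℝ) * Real.log (2 * 16 ^ l) := by
    rw [chainStep, inv_pow]
    field_simp
    push_cast; ring
  have e2 : ((√2 : ℝ) ^ j) ^ 2 * (3 * l / 2 ^ j) = 3 * l := by
    rw [← pow_mul, mul_comm j 2, pow_mul, Real.sq_sqrt (by norm_num)]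
    field_simp
  have hC : (0 : ℝ) < 2 * 16 ^ l := by positivity
  rw [neg_mul, e1, e2, Real.exp_add, Real.exp_neg, Real.exp_nat_mul, Real.exp_log hC]
  have h4 : ((2 * (2 ^ (j + 1) + 1) ^ l : ℕ) : ℝ) ^ 2 ≤ 4 * (16 ^ l) ^ (j + 1) := by
    have : ((2 : ℝ) ^ (j + 1) + 1) ≤ 4 ^ (j + 1) := by
      have h1 : (2 : ℝ) ≤ 2 ^ (j + 1) := by
        calc (2 : ℝ) = 2 ^ 1 := (pow_one _).symm
          _ ≤ 2 ^ (j + 1) := pow_le_pow_right₀ one_le_two (by omega)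
      have h3 : (4 : ℝ) ^ (j + 1) = 2 ^ (j + 1) * 2 ^ (j + 1) := by
        rw [← mul_pow]; norm_num
      rw [h3]; nlinarith
    push_cast
    calc (2 * ((2 : ℝ) ^ (j + 1) + 1) ^ l) ^ 2 ≤ (2 * ((4 : ℝ) ^ (j + 1)) ^ l) ^ 2 := by gcongr
      _ = 4 * (16 ^ l) ^ (j + 1) := by
        rw [show (16 : ℝ) = 4 ^ 2 by norm_num, ← pow_mul, ← pow_mul, ← pow_mul, mul_pow, ← pow_mul]
        ring_nf
  calc _ ≤ 4 * ((16 : ℝ) ^ l) ^ (j + 1) * (2 * (((2 * 16 ^ l) ^ (j + 1))⁻¹ * Real.exp (3 * l))) := by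
        gcongr
    _ = _ := by
        rw [mul_pow]; field_simp; norm_num

theorem measureReal_chainBad_le (hξ : ∀ i, Measurable (ξ i))
    (hind : iIndepFun ξ P) (hlaw : ∀ i, P.map (ξ i) = μ) {j : ℕ} (hj : 2 ^ j ≤ k) :
    P.real (chainBad μ ξ j) ≤ 8 * Real.exp (3 * l) / 2 ^ (j + 1) := by
  classical
  have hk : 0 < k := lt_of_lt_of_le (by positivity) hj
  set N : Finset (Cube l) := net μ j ∪ net μ (j + 1) with hNdef
  have hNc : N.card ≤ 2 * (2 ^ (j + 1) + 1) ^ l := by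
    refine (Finset.card_union_le _ _).trans ?_
    have h1 := card_net_le (μ := μ) j
    have h2 := card_net_le (μ := μ) (j + 1)
    have h3 : (2 ^ j + 1) ^ l ≤ (2 ^ (j + 1) + 1) ^ l := by gcongr <;> omega
    omega
  set E : Cube l × Cube l → Set Ω := fun p => {ω | marginalDist μ p.1 p.2 ≤ 3 * l / 2 ^ j ∧
    chainStep l j ≤ |normalizedDF μ (fun i => ξ i ω) p.1 -
        normalizedDF μ (fun i => ξ i ω) p.2|}
  have hsub : chainBad μ ξ j ⊆ ⋃ p ∈ N ×ˢ N, E p := by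
    rintro ω ⟨y, hy, y', hy', h⟩
    refine Set.mem_biUnion (x := (y, y')) (Finset.mem_coe.2 (Finset.mem_product.2 ⟨?_, ?_⟩)) h
    · simpa [hNdef] using hy
    · simpa [hNdef] using hy'
  -- The constraint $s\le\sqrt k$ of the exponential inequality reads $2^j\le k$ here, so chaining
  -- cannot go beyond level $\log_2 k$.
  have hs : (√2 : ℝ) ^ j ≤ √k := by
    refine Real.le_sqrt_of_sq_le ?_
    rw [← pow_mul, mul_comm j 2, pow_mul, Real.sq_sqrt (by norm_num)]
    exact_mod_cast hj
  have hE : ∀ p, P.real (E p) ≤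
      2 * Real.exp (-(√2 ^ j) * chainStep l j + (√2 ^ j) ^ 2 * (3 * l / 2 ^ j)) := by
    intro p
    by_cases hp : marginalDist μ p.1 p.2 ≤ 3 * l / 2 ^ j
    · refine (measureReal_mono (fun ω hω => hω.2) (by finiteness)).trans
        (measureReal_normalizedDF_sub_le hk hξ hind hlaw hp (by positivity) hs _)
    · have : E p = ∅ := Set.eq_empty_of_forall_notMem fun ω hω => hp hω.1
      rw [this, measureReal_empty]; positivity
  calc P.real (chainBad μ ξ j) ≤ P.real (⋃ p ∈ N ×ˢ N, E p) :=
        measureReal_mono hsub (measure_ne_top _ _)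
    _ ≤ ∑ p ∈ N ×ˢ N, P.real (E p) := measureReal_biUnion_finset_le _ _
    _ ≤ ∑ _p ∈ N ×ˢ N,
          2 * Real.exp (-(√2 ^ j) * chainStep l j + (√2 ^ j) ^ 2 * (3 * l / 2 ^ j)) :=
        Finset.sum_le_sum fun p _ => hE p
    _ = (N.card : ℝ) ^ 2 *
          (2 * Real.exp (-(√2 ^ j) * chainStep l j + (√2 ^ j) ^ 2 * (3 * l / 2 ^ j))) := by
        rw [Finset.sum_const, Finset.card_product, nsmul_eq_mul]; push_cast; ring
    _ ≤ _ := by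
        refine le_trans ?_ (chain_tail_bound l j)
        gcongr

/-- The event that some open cell of level `J` contains too many points of the sample. -/
def cellBad (μ : Measure (Fin l → ℝ)) (ξ : Fin k → Ω → Fin l → ℝ) (J : ℕ) (ε : ℝ) : Set Ω :=
  {ω | ∃ i : Fin l, ∃ a ∈ Finset.range (2 ^ J + 1),
    ε ≤ √k * ((k : ℝ)⁻¹ * ∑ n, {e : Fin l → ℝ | e i ∈ openCell μ J i a}.indicator
      (1 : (Fin l → ℝ) → ℝ) (ξ n ω) - ∫ e, {e : Fin l → ℝ | e i ∈ openCell μ J i a}.indicator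
      (1 : (Fin l → ℝ) → ℝ) e ∂μ)}

theorem measurableSet_coord_mem_openCell (J : ℕ) (i : Fin l) (a : ℕ) :
    MeasurableSet {e : Fin l → ℝ | e i ∈ openCell μ J i a} :=
  measurable_pi_apply i (ordConnected_openCell J i a).measurableSet

/-- At the last level $2^J$ is comparable to $k$. The choice $s=\sqrt k$ then has variance term
$k/2^J\le2$, and the union bound over about $l\,2^J$ cells is beaten by $e^{-\sqrt k\varepsilon}$.
-/
theorem measureReal_cellBad_le (hk : 0 < k) (hξ : ∀ i, Measurable (ξ i))
    (hind : iIndepFun ξ P) (hlaw : ∀ i, P.map (ξ i) = μ) {J : ℕ} (hJ : k ≤ 2 * 2 ^ J) (ε : ℝ) :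
    P.real (cellBad μ ξ J ε) ≤ l * ((2 ^ J + 1) * Real.exp (-√k * ε + 2)) := by
  have hk' : (0 : ℝ) ≤ k := Nat.cast_nonneg k
  set E : Fin l → ℕ → Set Ω := fun i a => {ω | ε ≤ √k * ((k : ℝ)⁻¹ *
      ∑ n, {e : Fin l → ℝ | e i ∈ openCell μ J i a}.indicator
      (1 : (Fin l → ℝ) → ℝ) (ξ n ω) - ∫ e, {e : Fin l → ℝ | e i ∈ openCell μ J i a}.indicator
      (1 : (Fin l → ℝ) → ℝ) e ∂μ)}
  have hE : ∀ i a, P.real (E i a) ≤ Real.exp (-√k * ε + 2) := by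
    intro i a
    have hm := measurableSet_coord_mem_openCell (μ := μ) J i a
    refine (measureReal_le_normalized_sum_le hk hξ hind hlaw (measurable_one.indicator hm)
      (fun e => ?_) (v := 1 / 2 ^ J) ?_ (Real.sqrt_nonneg _) le_rfl ε).trans ?_
    · rw [abs_of_nonneg (Set.indicator_nonneg (f := (1 : (Fin l → ℝ) → ℝ))
        (fun _ _ => zero_le_one) _)]
      exact Set.indicator_le' (fun _ _ => le_rfl) (fun _ _ => zero_le_one) _
    · refine le_trans (le_of_eq ?_) (measure_openCell_le (μ := μ) J i a)
      rw [← integral_indicator_one hm]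
      refine integral_congr_ae (ae_of_all _ fun e => ?_)
      by_cases he : e ∈ {e : Fin l → ℝ | e i ∈ openCell μ J i a}
      · simp only [Set.indicator_of_mem he]; simp
      · simp only [Set.indicator_of_notMem he]; simp
    · refine Real.exp_le_exp.2 ?_
      rw [Real.sq_sqrt hk']
      have : (k : ℝ) * (1 / 2 ^ J) ≤ 2 := by
        rw [mul_one_div, div_le_iff₀ (by positivity)]
        exact_mod_cast hJ
      linarith
  have hsub : cellBad μ ξ J ε ⊆ ⋃ i ∈ (Finset.univ : Finset (Fin l)),
      ⋃ a ∈ Finset.range (2 ^ J + 1), E i a := by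
    rintro ω ⟨i, a, ha, h⟩
    simp only [Set.mem_iUnion]
    exact ⟨i, Finset.mem_univ _, a, ha, h⟩
  calc P.real (cellBad μ ξ J ε) ≤ _ := measureReal_mono hsub (measure_ne_top _ _)
    _ ≤ ∑ i : Fin l, P.real (⋃ a ∈ Finset.range (2 ^ J + 1), E i a) :=
        measureReal_biUnion_finset_le _ _
    _ ≤ ∑ i : Fin l, ∑ a ∈ Finset.range (2 ^ J + 1), P.real (E i a) :=
        Finset.sum_le_sum fun i _ => measureReal_biUnion_finset_le _ _
    _ ≤ ∑ _i : Fin l, ∑ _a ∈ Finset.range (2 ^ J + 1), Real.exp (-√k * ε + 2) :=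
        Finset.sum_le_sum fun i _ => Finset.sum_le_sum fun a _ => hE i a
    _ = _ := by simp

/-- Below the last level the chain is replaced by monotonicity: the difference of empirical
distribution functions is at most the empirical mass of the $l$ cells around `x`. Each cell has true
mass at most $2^{-J}$, so $\sqrt k\,2^{-J}\le2/\sqrt k$ controls both centrings, whence the
$4l/\sqrt k$. -/
theorem abs_normalizedDF_sub_netPoint_le (hk : 0 < k) {J : ℕ} (hJ : k ≤ 2 * 2 ^ J) {ε : ℝ}
    {ω : Ω} (hω : ω ∉ cellBad μ ξ J ε) (x : Cube l) :
    |normalizedDF μ (fun i => ξ i ω) x - normalizedDF μ (fun i => ξ i ω) (netPoint μ J x)| ≤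
      l * ε + 4 * l / √k := by
  have hk' : (0 : ℝ) < k := by exact_mod_cast hk
  have hsk : 0 < √(k : ℝ) := Real.sqrt_pos.2 hk'
  have hss : √(k : ℝ) * √(k : ℝ) = k := Real.mul_self_sqrt hk'.le
  set y := netPoint μ J x
  have hidx : netIndex μ J x = netIndex μ J y := (netIndex_netPoint J x).symm
  have h2J : √(k : ℝ) * (1 / 2 ^ J) ≤ 2 / √k := by
    rw [le_div_iff₀ hsk, mul_assoc, mul_comm (1 / 2 ^ J : ℝ), ← mul_assoc, hss, mul_one_div,
      div_le_iff₀ (by positivity)]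
    exact_mod_cast hJ
  have hcell : ∀ i : Fin l, √k * ((k : ℝ)⁻¹ * ∑ n,
      {e : Fin l → ℝ | e i ∈ openCell μ J i (netIndex μ J x i)}.indicator
        (1 : (Fin l → ℝ) → ℝ) (ξ n ω)) ≤ ε + 2 / √k := by
    intro i
    have hm := measurableSet_coord_mem_openCell (μ := μ) J i (netIndex μ J x i)
    by_contra hcon
    push Not at hcon
    refine hω ⟨i, netIndex μ J x i, Finset.mem_range.2 (floor_marginalDF_le J i _), ?_⟩
    rw [integral_indicator_one hm, mul_sub]
    have h1 : √(k : ℝ) * μ.real {e : Fin l → ℝ | e i ∈ openCell μ J i (netIndex μ J x i)} ≤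
        2 / √k :=
      (mul_le_mul_of_nonneg_left (measure_openCell_le J i _) hsk.le).trans h2J
    linarith
  have hemp : √k * |empiricalDF (fun i => ξ i ω) x - empiricalDF (fun i => ξ i ω) y| ≤
      l * (ε + 2 / √k) := by
    have h1 : |empiricalDF (fun i => ξ i ω) x - empiricalDF (fun i => ξ i ω) y| ≤
        (k : ℝ)⁻¹ * ∑ n, ∑ i : Fin l,
          {e : Fin l → ℝ | e i ∈ openCell μ J i (netIndex μ J x i)}.indicator
            (1 : (Fin l → ℝ) → ℝ) (ξ n ω) := by
      rw [empiricalDF, empiricalDF, ← mul_sub, ← Finset.sum_sub_distrib, abs_mul,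
        abs_of_nonneg (inv_nonneg.2 hk'.le)]
      gcongr
      refine (Finset.abs_sum_le_sum_abs _ _).trans (Finset.sum_le_sum fun n _ => ?_)
      exact abs_boxInd_sub_le_sum (A := fun i => openCell μ J i (netIndex μ J x i))
        (fun i => uIoc_subset_openCell hidx i) _
    calc √k * |empiricalDF (fun i => ξ i ω) x - empiricalDF (fun i => ξ i ω) y|
        ≤ √k * ((k : ℝ)⁻¹ * ∑ n, ∑ i : Fin l,
          {e : Fin l → ℝ | e i ∈ openCell μ J i (netIndex μ J x i)}.indicator
            (1 : (Fin l → ℝ) → ℝ) (ξ n ω)) := by gcongr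
      _ = ∑ i : Fin l, √k * ((k : ℝ)⁻¹ * ∑ n,
          {e : Fin l → ℝ | e i ∈ openCell μ J i (netIndex μ J x i)}.indicator
            (1 : (Fin l → ℝ) → ℝ) (ξ n ω)) := by
          rw [Finset.sum_comm, Finset.mul_sum, Finset.mul_sum]
      _ ≤ ∑ _i : Fin l, (ε + 2 / √k) := Finset.sum_le_sum fun i _ => hcell i
      _ = _ := by simp only [Finset.sum_const, Finset.card_univ, Fintype.card_fin, nsmul_eq_mul]
  have hmean : √k * |μ.real (Set.Icc 0 (x : Fin l → ℝ)) - μ.real (Set.Icc 0 (y : Fin l → ℝ))| ≤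
      l * (2 / √k) := by
    calc _ ≤ √k * (l / 2 ^ J) := by
          gcongr
          exact (abs_measureReal_Icc_sub_le x y).trans (marginalDist_netPoint_le J x)
      _ = l * (√k * (1 / 2 ^ J)) := by ring
      _ ≤ _ := by gcongr
  have : normalizedDF μ (fun i => ξ i ω) x - normalizedDF μ (fun i => ξ i ω) y =
      √k * (empiricalDF (fun i => ξ i ω) x - empiricalDF (fun i => ξ i ω) y) -
      √k * (μ.real (Set.Icc 0 (x : Fin l → ℝ)) - μ.real (Set.Icc 0 (y : Fin l → ℝ))) := by
    rw [normalizedDF, normalizedDF]; ring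
  rw [this]
  refine (abs_sub _ _).trans ?_
  rw [abs_mul, abs_mul, abs_of_pos hsk]
  have e : (4 : ℝ) * l / √k = l * (2 / √k) + l * (2 / √k) := by ring
  rw [e]
  linarith

theorem sum_Ico_one_div_two_pow_le (j₀ J : ℕ) :
    ∑ j ∈ Finset.Ico j₀ J, (1 : ℝ) / 2 ^ (j + 1) ≤ 1 / 2 ^ j₀ := by
  rcases le_total J j₀ with h | h
  · rw [Finset.Ico_eq_empty_of_le h]; simp
  · have : ∑ j ∈ Finset.Ico j₀ J, (1 : ℝ) / 2 ^ (j + 1) = 1 / 2 ^ j₀ - 1 / 2 ^ J := by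
      induction J, h using Nat.le_induction with
      | base => simp
      | succ n hn ih => rw [Finset.sum_Ico_succ_top hn, ih, pow_succ]; field_simp; ring
    rw [this]
    have : (0 : ℝ) < 1 / 2 ^ J := by positivity
    linarith

theorem tendsto_mul_exp_neg_sqrt {ε : ℝ} (hε : 0 < ε) :
    Tendsto (fun k : ℕ => (k : ℝ) * Real.exp (-√k * ε)) atTop (𝓝 0) := by
  have h2 : Tendsto (fun k : ℕ => ε * √(k : ℝ)) atTop atTop :=
    (Real.tendsto_sqrt_atTop.comp tendsto_natCast_atTop_atTop).const_mul_atTop hε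
  have h3 := ((Real.tendsto_pow_mul_exp_neg_atTop_nhds_zero 2).comp h2).const_mul (ε ^ 2)⁻¹
  rw [mul_zero] at h3
  refine h3.congr fun k => ?_
  simp only [Function.comp_apply]
  rw [mul_pow, Real.sq_sqrt (Nat.cast_nonneg k), mul_comm ε √(k : ℝ), neg_mul]
  field_simp

end Empirical

/-- The modulus of continuity of the empirical process with respect to the pseudometric of the
marginals is small with high probability, uniformly over all laws and all large samples. -/
theorem exists_modulus_normalizedDF (l : ℕ) {η : ℝ} (hη : 0 < η) :
    ∃ δ > 0, ∃ k₀ : ℕ, ∀ k ≥ k₀, ∀ {Ω : Type*} [MeasurableSpace Ω] (P : Measure Ω)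
      [IsProbabilityMeasure P] (μ : Measure (Fin l → ℝ)) [IsProbabilityMeasure μ]
      (ξ : Fin k → Ω → Fin l → ℝ), (∀ i, Measurable (ξ i)) → iIndepFun ξ P →
      (∀ i, P.map (ξ i) = μ) →
      P {ω | ∃ x y : Cube l, marginalDist μ x y ≤ δ ∧
        η < |normalizedDF μ (fun i => ξ i ω) x - normalizedDF μ (fun i => ξ i ω) y|} ≤
        ENNReal.ofReal η := by
  -- The starting level `j₀` makes both the tail of the increments and the tail of the failure
  -- probabilities small. It depends on `l` and `η` only.
  have htail : Tendsto (fun n => ∑' j, chainStep l (j + n)) atTop (𝓝 0) :=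
    tendsto_sum_nat_add _
  have hgeo : Tendsto (fun n : ℕ => 8 * Real.exp (3 * l) * (1 / 2) ^ n) atTop (𝓝 0) := by
    simpa using (tendsto_pow_atTop_nhds_zero_of_lt_one (r := (1 / 2 : ℝ)) (by norm_num)
      (by norm_num)).const_mul (8 * Real.exp (3 * l))
  obtain ⟨j₀, hj1, hj2⟩ := ((htail.eventually (gt_mem_nhds (show 0 < η / 6 by positivity))).and
    (hgeo.eventually (gt_mem_nhds (show 0 < η / 2 by positivity)))).exists
  set ε : ℝ := η / (8 * (l + 1)) with hεdef
  have hε : 0 < ε := by positivity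
  have hlε : l * ε ≤ η / 8 := by
    rw [hεdef, mul_div_assoc', div_le_div_iff₀ (by positivity) (by norm_num)]
    nlinarith
  have hcell : Tendsto (fun k : ℕ => l * (3 * Real.exp 2) * ((k : ℝ) * Real.exp (-√k * ε)))
      atTop (𝓝 0) := by
    simpa using (tendsto_mul_exp_neg_sqrt hε).const_mul (l * (3 * Real.exp 2))
  have hsq : Tendsto (fun k : ℕ => 4 * (l : ℝ) / √k) atTop (𝓝 0) :=
    (Real.tendsto_sqrt_atTop.comp tendsto_natCast_atTop_atTop).const_div_atTop _
  obtain ⟨k₀, hk₀⟩ := eventually_atTop.1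
    ((hcell.eventually (gt_mem_nhds (show 0 < η / 2 by positivity))).and
    ((hsq.eventually (gt_mem_nhds (show 0 < η / 8 by positivity))).and
    (eventually_ge_atTop (2 ^ (j₀ + 1)))))
  -- For `l = 0` the radius $l/2^{j_0}$ would not be positive; the cube is then a single point.
  rcases Nat.eq_zero_or_pos l with rfl | hl
  · refine ⟨1, one_pos, 0, fun k _ Ω _ P _ μ _ ξ _ _ _ => ?_⟩
    refine le_trans (le_of_eq ?_) zero_le
    convert measure_empty (μ := P)
    refine Set.eq_empty_of_forall_notMem fun ω ⟨x, y, _, h⟩ => ?_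
    have : x = y := Subsingleton.elim _ _
    rw [this, sub_self, abs_zero] at h
    exact lt_asymm h hη
  refine ⟨l / 2 ^ j₀, by positivity, k₀, ?_⟩
  intro k hk Ω _ P _ μ _ ξ hξ hind hlaw
  obtain ⟨hb1, hb2, hb3⟩ := hk₀ k hk
  have hkpos : 0 < k := lt_of_lt_of_le (by positivity) hb3
  -- This is the level where $2^J\le k\le 2\cdot2^J$: low enough for the chaining bounds, high
  -- enough for the cell bound.
  set J := Nat.log 2 k
  have hJ1 : 2 ^ J ≤ k := Nat.pow_log_le_self 2 hkpos.ne'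
  have hJ2 : k ≤ 2 * 2 ^ J := by
    have := Nat.lt_pow_succ_log_self (b := 2) (by norm_num) k
    rw [pow_succ] at this
    simp only [J]; omega
  have hJ0 : j₀ < J := Nat.le_log_of_pow_le (by norm_num) hb3
  have hsum : ∑ j ∈ Finset.Ico j₀ J, chainStep l j ≤ η / 6 := by
    rw [Finset.sum_Ico_eq_sum_range]
    refine le_trans ?_ hj1.le
    simp_rw [add_comm j₀]
    exact ((summable_nat_add_iff j₀).2 (summable_chainStep l)).sum_le_tsum _
      fun j _ => chainStep_nonneg l _
  have hsub : {ω | ∃ x y : Cube l, marginalDist μ x y ≤ l / 2 ^ j₀ ∧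
        η < |normalizedDF μ (fun i => ξ i ω) x - normalizedDF μ (fun i => ξ i ω) y|} ⊆
      (⋃ j ∈ Finset.Ico j₀ J, chainBad μ ξ j) ∪ cellBad μ ξ J ε := by
    rintro ω ⟨x, y, hxy, h⟩
    by_contra hcon
    rw [Set.mem_union, not_or] at hcon
    obtain ⟨hc1, hc2⟩ := hcon
    simp only [Set.mem_iUnion, not_exists] at hc1
    have hch := abs_sub_le_of_chaining (α := Cube l) (d := fun x y => marginalDist μ x y)
      (fun x y => marginalDist_comm _ _) (fun x y z => marginalDist_triangle _ _ _)
      (c := l) (Nat.cast_nonneg l) (r := netPoint μ) (fun j x => marginalDist_netPoint_le j x)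
      (Z := normalizedDF μ (fun i => ξ i ω)) (a := chainStep l) (N := fun j => (net μ j : Set _))
      (fun j x => netPoint_mem_net j x) hJ0 (fun j h1 h2 y hy y' hy' hd => by
        by_contra hlt
        push Not at hlt
        exact hc1 j (Finset.mem_Ico.2 ⟨h1, h2⟩) ⟨y, hy, y', hy', hd, hlt.le⟩) hxy
    have hx := abs_normalizedDF_sub_netPoint_le hkpos hJ2 hc2 x
    have hy := abs_normalizedDF_sub_netPoint_le hkpos hJ2 hc2 y
    -- The chain contributes $3\cdot\eta/6$ and each of the two ends $\eta/8+\eta/8$, in total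
    -- $\eta$.
    set Z := normalizedDF μ (fun i => ξ i ω)
    have t1 := abs_sub_le (Z x) (Z (netPoint μ J x)) (Z y)
    have t2 := abs_sub_le (Z (netPoint μ J x)) (Z (netPoint μ J y)) (Z y)
    rw [abs_sub_comm (Z (netPoint μ J y))] at t2
    linarith
  have hreal : P.real ((⋃ j ∈ Finset.Ico j₀ J, chainBad μ ξ j) ∪ cellBad μ ξ J ε) ≤ η := by
    refine (measureReal_union_le _ _).trans ?_
    have h1 : P.real (⋃ j ∈ Finset.Ico j₀ J, chainBad μ ξ j) ≤ η / 2 := by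
      calc _ ≤ ∑ j ∈ Finset.Ico j₀ J, P.real (chainBad μ ξ j) :=
            measureReal_biUnion_finset_le _ _
        _ ≤ ∑ j ∈ Finset.Ico j₀ J, 8 * Real.exp (3 * l) / 2 ^ (j + 1) :=
            Finset.sum_le_sum fun j hj => measureReal_chainBad_le hξ hind hlaw
              ((Nat.pow_le_pow_right (by norm_num) (Finset.mem_Ico.1 hj).2.le).trans hJ1)
        _ = 8 * Real.exp (3 * l) * ∑ j ∈ Finset.Ico j₀ J, (1 : ℝ) / 2 ^ (j + 1) := by
            rw [Finset.mul_sum]; simp only [mul_one_div]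
        _ ≤ 8 * Real.exp (3 * l) * (1 / 2 ^ j₀) := by
            gcongr; exact sum_Ico_one_div_two_pow_le _ _
        _ ≤ η / 2 := by rw [← one_div_pow]; exact hj2.le
    have h2 : P.real (cellBad μ ξ J ε) ≤ η / 2 := by
      refine (measureReal_cellBad_le hkpos hξ hind hlaw hJ2 ε).trans (le_trans ?_ hb1.le)
      rw [Real.exp_add]
      have h3 : ((2 : ℝ) ^ J + 1) ≤ 3 * k := by
        have : (2 : ℝ) ^ J ≤ k := by exact_mod_cast hJ1
        have : (1 : ℝ) ≤ k := by exact_mod_cast hkpos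
        linarith
      calc (l : ℝ) * ((2 ^ J + 1) * (Real.exp (-√k * ε) * Real.exp 2))
          ≤ l * (3 * k * (Real.exp (-√k * ε) * Real.exp 2)) := by gcongr
        _ = _ := by ring
    linarith
  calc _ ≤ P ((⋃ j ∈ Finset.Ico j₀ J, chainBad μ ξ j) ∪ cellBad μ ξ J ε) := measure_mono hsub
    _ = ENNReal.ofReal (P.real _) := (ofReal_measureReal (by finiteness)).symm
    _ ≤ ENNReal.ofReal η := ENNReal.ofReal_le_ofReal hreal

/-! ### A quantitative central limit theorem for characteristic functions -/

/-- Telescoping: replacing `k` factors of modulus at most 1 one by one costs `k` single errors. -/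
theorem norm_pow_sub_pow_le_of_norm_le_one {a b : ℂ} (ha : ‖a‖ ≤ 1) (hb : ‖b‖ ≤ 1) (k : ℕ) :
    ‖a ^ k - b ^ k‖ ≤ k * ‖a - b‖ := by
  induction k with
  | zero => simp
  | succ k ih =>
    have : a ^ (k + 1) - b ^ (k + 1) = a ^ k * (a - b) + (a ^ k - b ^ k) * b := by ring
    rw [this]
    refine (norm_add_le _ _).trans ?_
    rw [norm_mul, norm_mul, norm_pow]
    have h1 : ‖a‖ ^ k * ‖a - b‖ ≤ ‖a - b‖ :=
      mul_le_of_le_one_left (norm_nonneg _) (pow_le_one₀ (norm_nonneg _) ha)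
    have h2 : ‖a ^ k - b ^ k‖ * ‖b‖ ≤ ‖a ^ k - b ^ k‖ :=
      mul_le_of_le_one_right (norm_nonneg _) hb
    push_cast
    linarith

theorem norm_cexp_mul_I_sub_le {y : ℝ} (hy : |y| ≤ 1) :
    ‖Complex.exp (y * Complex.I) - (1 + y * Complex.I - y ^ 2 / 2)‖ ≤ |y| ^ 3 := by
  have hn : ‖(y : ℂ) * Complex.I‖ = |y| := by simp
  have h := Complex.exp_bound (x := y * Complex.I) (by rw [hn]; exact hy) (n := 3) (by norm_num)
  rw [hn] at h
  have e : ∑ m ∈ Finset.range 3, ((y : ℂ) * Complex.I) ^ m / m.factorial =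
      1 + y * Complex.I - y ^ 2 / 2 := by
    simp only [Finset.sum_range_succ, Finset.sum_range_zero, Nat.factorial]
    push_cast
    linear_combination ((y : ℂ) ^ 2 / 2) * Complex.I_sq
  rw [e] at h
  refine h.trans (mul_le_of_le_one_right (by positivity) ?_)
  norm_num [Nat.factorial]

/-- A quantitative central limit theorem for bounded summands, in terms of the characteristic
function. -/
theorem norm_charFun_normalized_sum_sub_le {Ω E : Type*} [MeasurableSpace Ω] [MeasurableSpace E]
    {P : Measure Ω} [IsProbabilityMeasure P] {μ : Measure E} [IsProbabilityMeasure μ]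
    {k : ℕ} (hk : 0 < k) {ξ : Fin k → Ω → E} (hξ : ∀ i, Measurable (ξ i))
    (hind : iIndepFun ξ P) (hlaw : ∀ i, P.map (ξ i) = μ)
    {g : E → ℝ} (hg : Measurable g) {B : ℝ} (hB : ∀ e, |g e| ≤ B) (h0 : ∫ e, g e ∂μ = 0)
    (hBk : B ≤ √k) :
    ‖∫ ω, Complex.exp (((√k)⁻¹ * ∑ i, g (ξ i ω) : ℝ) * Complex.I) ∂P -
      Complex.exp (-((∫ e, g e ^ 2 ∂μ : ℝ) : ℂ) / 2)‖ ≤ (B ^ 3 + B ^ 4) / √k := by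
  have hk' : (0 : ℝ) < k := by exact_mod_cast hk
  have hsk : 0 < √(k : ℝ) := Real.sqrt_pos.2 hk'
  have hss : √(k : ℝ) ^ 2 = k := Real.sq_sqrt hk'.le
  obtain ⟨ω₀⟩ : Nonempty Ω := P.nonempty_of_neZero
  have hB0 : 0 ≤ B := (abs_nonneg _).trans (hB (ξ ⟨0, hk⟩ ω₀))
  set c : ℝ := (√k)⁻¹
  have hc : 0 < c := inv_pos.2 hsk
  have hc2 : c ^ 2 * k = 1 := by simp only [c]; rw [inv_pow, hss]; field_simp
  have hcB : c * B ≤ 1 := by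
    simp only [c]; rw [inv_mul_le_iff₀ hsk, mul_one]; exact hBk
  have hgi : Integrable g μ := Integrable.of_bound hg.aestronglyMeasurable B (ae_of_all _ hB)
  have hg2b : ∀ e, g e ^ 2 ≤ B ^ 2 := fun e => by
    rw [← sq_abs]; exact pow_le_pow_left₀ (abs_nonneg _) (hB e) 2
  have hg2i : Integrable (fun e => g e ^ 2) μ :=
    Integrable.of_bound (hg.pow_const 2).aestronglyMeasurable (B ^ 2) (ae_of_all _ fun e => by
      rw [Real.norm_eq_abs, abs_of_nonneg (sq_nonneg _)]; exact hg2b e)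
  set V := ∫ e, g e ^ 2 ∂μ
  have hV0 : 0 ≤ V := integral_nonneg fun e => sq_nonneg _
  have hVB : V ≤ B ^ 2 := by
    have := integral_mono hg2i (integrable_const (B ^ 2)) hg2b
    simpa using this
  set φ : ℂ := ∫ e, Complex.exp ((c * g e : ℝ) * Complex.I) ∂μ
  have hexp_meas : Measurable fun e => Complex.exp ((c * g e : ℝ) * Complex.I) := by fun_prop
  have hexp_int : Integrable (fun e => Complex.exp ((c * g e : ℝ) * Complex.I)) μ :=
    Integrable.of_bound hexp_meas.aestronglyMeasurable 1 (ae_of_all _ fun e => by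
      rw [Complex.norm_exp_ofReal_mul_I])
  have hφ1 : ‖φ‖ ≤ 1 := by
    refine (norm_integral_le_of_norm_le_const (C := 1) (ae_of_all _ fun e => ?_)).trans ?_
    · rw [Complex.norm_exp_ofReal_mul_I]
    · simp
  have hprod : ∫ ω, Complex.exp ((c * ∑ i, g (ξ i ω) : ℝ) * Complex.I) ∂P = φ ^ k := by
    have h1 : ∀ ω, Complex.exp ((c * ∑ i, g (ξ i ω) : ℝ) * Complex.I) =
        ∏ i, Complex.exp ((c * g (ξ i ω) : ℝ) * Complex.I) := by
      intro ω
      rw [← Complex.exp_sum, ← Finset.sum_mul, Finset.mul_sum]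
      push_cast; rfl
    simp_rw [h1]
    rw [hind.integral_fun_prod_comp (f := fun _ e => Complex.exp ((c * g e : ℝ) * Complex.I))
      (fun i => (hξ i).aemeasurable) (fun i => hexp_meas.aestronglyMeasurable)]
    have : ∀ i, ∫ ω, Complex.exp ((c * g (ξ i ω) : ℝ) * Complex.I) ∂P = φ := by
      intro i
      simp only [φ]
      rw [← hlaw i, integral_map (hξ i).aemeasurable hexp_meas.aestronglyMeasurable]
    simp only [this, Finset.prod_const, Finset.card_univ, Fintype.card_fin]
  have hφ : ‖φ - (1 - (c : ℂ) ^ 2 * V / 2)‖ ≤ (c * B) ^ 3 := by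
    have h1 : ∫ e, (1 + ((c * g e : ℝ) : ℂ) * Complex.I - ((c * g e : ℝ) : ℂ) ^ 2 / 2) ∂μ =
        1 - (c : ℂ) ^ 2 * V / 2 := by
      have i1 : Integrable (fun e => ((c * g e : ℝ) : ℂ) * Complex.I) μ :=
        ((hgi.const_mul c).ofReal).mul_const _
      have i2 : Integrable (fun e => ((c * g e : ℝ) : ℂ) ^ 2 / 2) μ := by
        have := ((hg2i.const_mul (c ^ 2)).ofReal (𝕜 := ℂ)).div_const 2
        refine this.congr (ae_of_all _ fun e => ?_)
        simp only [RCLike.ofReal_eq_complex_ofReal]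
        push_cast; ring
      have e1 := integral_sub (μ := μ)
        (f := fun e => 1 + ((c * g e : ℝ) : ℂ) * Complex.I)
        (g := fun e => ((c * g e : ℝ) : ℂ) ^ 2 / 2) ((integrable_const _).add i1) i2
      have e2 := integral_add (μ := μ) (f := fun _ => (1 : ℂ))
        (g := fun e => ((c * g e : ℝ) : ℂ) * Complex.I) (integrable_const _) i1
      have e3 : ∫ e, ((c * g e : ℝ) : ℂ) * Complex.I ∂μ = 0 := by
        rw [integral_mul_const, integral_complex_ofReal, integral_const_mul, h0]; simp
      have e4 : ∫ e, ((c * g e : ℝ) : ℂ) ^ 2 / 2 ∂μ = (c : ℂ) ^ 2 * V / 2 := by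
        have : ∀ e, ((c * g e : ℝ) : ℂ) ^ 2 / 2 = ((c ^ 2 * g e ^ 2 / 2 : ℝ) : ℂ) := by
          intro e; push_cast; ring
        simp_rw [this]
        rw [integral_complex_ofReal, integral_div, integral_const_mul]
        push_cast; rfl
      rw [e1, e2, e3, e4]; simp
    rw [← h1, ← integral_sub hexp_int]
    · refine (norm_integral_le_of_norm_le_const (C := (c * B) ^ 3) (ae_of_all _ fun e => ?_)).trans ?_
      · have hce : |c * g e| ≤ c * B := by
          rw [abs_mul, abs_of_pos hc]; gcongr; exact hB e
        refine (norm_cexp_mul_I_sub_le (hce.trans hcB)).trans ?_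
        gcongr
      · simp
    · refine Integrable.of_bound (C := 1 + 1 + 1) ?_ (ae_of_all _ fun e => ?_)
      · have : Measurable fun e => (1 + ((c * g e : ℝ) : ℂ) * Complex.I - ((c * g e : ℝ) : ℂ) ^ 2 / 2) := by
          fun_prop
        exact this.aestronglyMeasurable
      · have hce : |c * g e| ≤ 1 := by
          rw [abs_mul, abs_of_pos hc]
          exact (mul_le_mul_of_nonneg_left (hB e) hc.le).trans hcB
        refine (norm_sub_le _ _).trans (add_le_add ((norm_add_le _ _).trans (add_le_add ?_ ?_)) ?_)
        · simp
        · simpa using hce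
        · rw [norm_div, norm_pow, Complex.norm_real, Real.norm_eq_abs]
          have := pow_le_one₀ (n := 2) (abs_nonneg _) hce
          rw [Complex.norm_ofNat]
          linarith
  -- The Gaussian factor whose `k`-th power is the limit; it is compared with the characteristic
  -- function of one summand through their common expansion $1-c^2V/2$.
  set b : ℂ := Complex.exp ((-(c ^ 2 * V / 2) : ℝ) : ℂ)
  have hb1 : ‖b‖ ≤ 1 := by
    simp only [b]
    rw [Complex.norm_exp_ofReal, Real.exp_le_one_iff]
    have : 0 ≤ c ^ 2 * V / 2 := by positivity
    linarith
  have hu : c ^ 2 * V / 2 ≤ (c * B) ^ 2 / 2 := by rw [mul_pow]; gcongr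
  have hcB2 : (c * B) ^ 2 ≤ 1 := pow_le_one₀ (by positivity) hcB
  have hb : ‖(1 - c ^ 2 * V / 2 : ℂ) - b‖ ≤ (c * B) ^ 4 := by
    have hu0 : 0 ≤ c ^ 2 * V / 2 := by positivity
    have h1 := Real.abs_exp_sub_one_sub_id_le (x := -(c ^ 2 * V / 2)) (by
      rw [abs_neg, abs_of_nonneg hu0]; linarith)
    have h2 : (1 - c ^ 2 * V / 2 : ℂ) - b =
        ((-(Real.exp (-(c ^ 2 * V / 2)) - 1 - -(c ^ 2 * V / 2)) : ℝ) : ℂ) := by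
      simp only [b]; push_cast; ring
    rw [h2, Complex.norm_real, norm_neg, Real.norm_eq_abs]
    refine h1.trans ?_
    rw [neg_sq]
    calc (c ^ 2 * V / 2) ^ 2 ≤ ((c * B) ^ 2) ^ 2 := by
          gcongr; linarith [sq_nonneg (c * B)]
      _ = _ := by ring
  have hbk : b ^ k = Complex.exp (-(V : ℂ) / 2) := by
    simp only [b]
    rw [← Complex.exp_nat_mul]
    congr 1
    have : ((c ^ 2 * k : ℝ) : ℂ) = 1 := by rw [hc2]; simp
    push_cast at this ⊢
    linear_combination (-(V : ℂ) / 2) * this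
  rw [hprod, ← hbk]
  refine (norm_pow_sub_pow_le_of_norm_le_one hφ1 hb1 k).trans ?_
  have h3 : ‖φ - b‖ ≤ (c * B) ^ 3 + (c * B) ^ 4 := by
    have := norm_sub_le_norm_sub_add_norm_sub φ (1 - c ^ 2 * V / 2 : ℂ) b
    linarith
  -- The `k` single errors are of order $c^3$ with $c=k^{-1/2}$, so one factor $c$ survives
  -- $c^2k=1$.
  calc (k : ℝ) * ‖φ - b‖ ≤ k * ((c * B) ^ 3 + (c * B) ^ 4) := by gcongr
    _ = (c ^ 2 * k) * c * (B ^ 3 + c * B ^ 4) := by ring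
    _ = (B ^ 3 + c * B ^ 4) * c := by rw [hc2]; ring
    _ ≤ (B ^ 3 + 1 * B ^ 4) * c := by
        gcongr
        simp only [c]
        refine inv_le_one_of_one_le₀ (Real.one_le_sqrt.2 ?_)
        exact_mod_cast hk
    _ = _ := by simp only [c]; rw [one_mul, div_eq_mul_inv]

/-! ### Triangular arrays of samples -/

/-- The covariance of the Brownian bridge associated with the law `μ` on the cube. -/
noncomputable def bridgeCov {l : ℕ} (μ : Measure (Fin l → ℝ)) (x y : Cube l) : ℝ :=
  μ.real (Set.Icc 0 ((x : Fin l → ℝ) ⊓ y)) -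
    μ.real (Set.Icc 0 (x : Fin l → ℝ)) * μ.real (Set.Icc 0 (y : Fin l → ℝ))

/-- A triangular array of samples, the `n`-th of which has size `k n` and law `μ n` on the cube,
where the distribution functions of `μ n` converge pointwise to the continuous distribution
function of `μ₀`. -/
structure IsSampleArray {Ω : Type*} [MeasurableSpace Ω] {l : ℕ} (P : Measure Ω) (k : ℕ → ℕ)
    (ξ : (n : ℕ) → Fin (k n) → Ω → Fin l → ℝ) (μ : ℕ → Measure (Fin l → ℝ))
    (μ₀ : Measure (Fin l → ℝ)) : Prop where
  tendsto_card : Tendsto k atTop atTop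
  prob : ∀ n, IsProbabilityMeasure (μ n)
  prob_limit : IsProbabilityMeasure μ₀
  measurable : ∀ n i, Measurable (ξ n i)
  indep : ∀ n, iIndepFun (ξ n) P
  law : ∀ n i, P.map (ξ n i) = μ n
  cube : ∀ n, μ n (Set.Icc 0 1)ᶜ = 0
  cube_limit : μ₀ (Set.Icc 0 1)ᶜ = 0
  tendsto : ∀ x : Cube l, Tendsto (fun n => (μ n).real (Set.Icc 0 (x : Fin l → ℝ))) atTop
    (𝓝 (μ₀.real (Set.Icc 0 (x : Fin l → ℝ))))
  continuous : Continuous fun x : Cube l => μ₀.real (Set.Icc 0 (x : Fin l → ℝ))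

/-! ### Linear combinations of centred box indicators -/

section FiniteDimensional

variable {l : ℕ} {μ : Measure (Fin l → ℝ)} [IsProbabilityMeasure μ]

theorem integral_boxInd_mul_boxInd (x y : Cube l) :
    ∫ e, boxInd x e * boxInd y e ∂μ = μ.real (Set.Icc 0 ((x : Fin l → ℝ) ⊓ y)) := by
  have : ∀ e, boxInd x e * boxInd y e =
      (Set.Icc (0 : Fin l → ℝ) ((x : Fin l → ℝ) ⊓ y)).indicator 1 e := by
    intro e
    have hset : Set.Icc (0 : Fin l → ℝ) ((x : Fin l → ℝ) ⊓ y) =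
        Set.Icc 0 (x : Fin l → ℝ) ∩ Set.Icc 0 (y : Fin l → ℝ) := by
      ext z; simp only [Set.mem_inter_iff, Set.mem_Icc, le_inf_iff]; tauto
    rw [hset, Set.inter_indicator_one]
    rfl
  simp_rw [this]
  exact integral_indicator_one measurableSet_Icc

theorem integral_boxInd_sub_mul_boxInd_sub (x y : Cube l) :
    ∫ e, (boxInd x e - μ.real (Set.Icc 0 (x : Fin l → ℝ))) *
      (boxInd y e - μ.real (Set.Icc 0 (y : Fin l → ℝ))) ∂μ = bridgeCov μ x y := by
  set a := μ.real (Set.Icc 0 (x : Fin l → ℝ))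
  set b := μ.real (Set.Icc 0 (y : Fin l → ℝ))
  have hxy : Integrable (fun e => boxInd x e * boxInd y e) μ :=
    Integrable.of_bound ((measurable_boxInd x).mul (measurable_boxInd y)).aestronglyMeasurable 1
      (ae_of_all _ fun e => by
        rw [Real.norm_eq_abs, abs_of_nonneg (mul_nonneg (boxInd_nonneg x e) (boxInd_nonneg y e))]
        exact mul_le_one₀ (boxInd_le_one x e) (boxInd_nonneg y e) (boxInd_le_one y e))
  have h1 : ∀ e, (boxInd x e - a) * (boxInd y e - b) =
      boxInd x e * boxInd y e - (b * boxInd x e + (a * boxInd y e - a * b)) := fun e => by ring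
  simp_rw [h1]
  have i3 : Integrable (fun e => a * boxInd y e - a * b) μ :=
    ((integrable_boxInd y).const_mul a).sub (integrable_const _)
  have i2 : Integrable (fun e => b * boxInd x e + (a * boxInd y e - a * b)) μ :=
    ((integrable_boxInd x).const_mul b).add i3
  rw [integral_sub hxy i2, integral_add ((integrable_boxInd x).const_mul b) i3,
    integral_sub ((integrable_boxInd y).const_mul a) (integrable_const _), integral_const_mul,
    integral_const_mul, integral_boxInd, integral_boxInd, integral_boxInd_mul_boxInd, bridgeCov]
  simp only [integral_const, probReal_univ, smul_eq_mul]
  ring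

/-- A linear combination of centred indicators of boxes. -/
noncomputable def boxComb {ι : Type*} [Fintype ι] (μ : Measure (Fin l → ℝ)) (p : ι → Cube l)
    (t : ι → ℝ) (e : Fin l → ℝ) : ℝ :=
  ∑ i, t i * (boxInd (p i) e - μ.real (Set.Icc 0 (p i : Fin l → ℝ)))

theorem measurable_boxComb {ι : Type*} [Fintype ι] (p : ι → Cube l) (t : ι → ℝ) :
    Measurable (boxComb μ p t) :=
  Finset.measurable_sum _ fun i _ => ((measurable_boxInd (p i)).sub_const _).const_mul _

theorem abs_boxComb_le {ι : Type*} [Fintype ι] (p : ι → Cube l) (t : ι → ℝ) (e : Fin l → ℝ) :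
    |boxComb μ p t e| ≤ ∑ i, |t i| := by
  refine (Finset.abs_sum_le_sum_abs _ _).trans (Finset.sum_le_sum fun i _ => ?_)
  rw [abs_mul]
  refine mul_le_of_le_one_right (abs_nonneg _) (abs_sub_le_iff.2 ⟨?_, ?_⟩)
  · linarith [boxInd_le_one (p i) e,
      measureReal_nonneg (μ := μ) (s := Set.Icc 0 (p i : Fin l → ℝ))]
  · linarith [boxInd_nonneg (p i) e,
      measureReal_le_one (μ := μ) (s := Set.Icc 0 (p i : Fin l → ℝ))]

theorem integral_boxComb {ι : Type*} [Fintype ι] (p : ι → Cube l) (t : ι → ℝ) :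
    ∫ e, boxComb μ p t e ∂μ = 0 := by
  simp only [boxComb]
  rw [integral_finsetSum]
  · refine Finset.sum_eq_zero fun i _ => ?_
    rw [integral_const_mul, integral_sub (integrable_boxInd _) (integrable_const _),
      integral_boxInd]
    simp
  · exact fun i _ => ((integrable_boxInd _).sub (integrable_const _)).const_mul _

/-- The quadratic form of the bridge covariance is a variance. This gives both the limiting exponent
in the central limit theorem and its nonnegativity. -/
theorem integral_boxComb_sq {ι : Type*} [Fintype ι] (p : ι → Cube l) (t : ι → ℝ) :
    ∫ e, boxComb μ p t e ^ 2 ∂μ = ∑ i, ∑ j, t i * t j * bridgeCov μ (p i) (p j) := by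
  have h1 : ∀ e, boxComb μ p t e ^ 2 = ∑ i, ∑ j, t i * t j *
      ((boxInd (p i) e - μ.real (Set.Icc 0 (p i : Fin l → ℝ))) *
      (boxInd (p j) e - μ.real (Set.Icc 0 (p j : Fin l → ℝ)))) := by
    intro e
    rw [boxComb, sq, Finset.sum_mul_sum]
    exact Finset.sum_congr rfl fun i _ => Finset.sum_congr rfl fun j _ => by ring
  have hi : ∀ i j, Integrable (fun e => t i * t j *
      ((boxInd (p i) e - μ.real (Set.Icc 0 (p i : Fin l → ℝ))) *
      (boxInd (p j) e - μ.real (Set.Icc 0 (p j : Fin l → ℝ))))) μ := by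
    intro i j
    refine Integrable.const_mul ?_ _
    refine ((integrable_boxInd (p i)).sub (integrable_const _)).mul_bdd (c := 1) ?_ ?_
    · exact ((measurable_boxInd (p j)).sub_const _).aestronglyMeasurable
    · refine ae_of_all _ fun e => abs_sub_le_iff.2 ⟨?_, ?_⟩
      · linarith [boxInd_le_one (p j) e,
          measureReal_nonneg (μ := μ) (s := Set.Icc 0 (p j : Fin l → ℝ))]
      · linarith [boxInd_nonneg (p j) e,
          measureReal_le_one (μ := μ) (s := Set.Icc 0 (p j : Fin l → ℝ))]
  simp_rw [h1]
  rw [integral_finsetSum _ fun i _ => integrable_finsetSum _ fun j _ => hi i j]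
  refine Finset.sum_congr rfl fun i _ => ?_
  rw [integral_finsetSum _ fun j _ => hi i j]
  refine Finset.sum_congr rfl fun j _ => ?_
  rw [integral_const_mul, integral_boxInd_sub_mul_boxInd_sub]

/-- Cramér–Wold form of the empirical process: a linear combination of its values is one normalized
i.i.d. scalar sum. -/
theorem sum_mul_normalizedDF {ι : Type*} [Fintype ι] {k : ℕ} (hk : 0 < k) (p : ι → Cube l)
    (t : ι → ℝ) (Y : Fin k → Fin l → ℝ) :
    ∑ i, t i * normalizedDF μ Y (p i) = (√(k : ℝ))⁻¹ * ∑ n, boxComb μ p t (Y n) := by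
  have hk' : (0 : ℝ) < k := by exact_mod_cast hk
  have hsk : √(k : ℝ) ≠ 0 := (Real.sqrt_pos.2 hk').ne'
  have hss : √(k : ℝ) * √(k : ℝ) = k := Real.mul_self_sqrt hk'.le
  simp only [boxComb]
  rw [Finset.sum_comm, Finset.mul_sum]
  refine Finset.sum_congr rfl fun i _ => ?_
  rw [← Finset.mul_sum, Finset.sum_sub_distrib, normalizedDF, empiricalDF]
  simp only [Finset.sum_const, Finset.card_univ, Fintype.card_fin, nsmul_eq_mul]
  rw [eq_inv_mul_iff_mul_eq₀ hsk]
  have : √(k : ℝ) * (t i * (√(k : ℝ) * ((k : ℝ)⁻¹ * ∑ n, boxInd (p i) (Y n) -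
      μ.real (Set.Icc 0 (p i : Fin l → ℝ))))) = (√(k : ℝ) * √(k : ℝ)) * (t i *
      ((k : ℝ)⁻¹ * ∑ n, boxInd (p i) (Y n) - μ.real (Set.Icc 0 (p i : Fin l → ℝ)))) := by ring
  rw [this, hss]
  field_simp

end FiniteDimensional

/-! ### Finite-dimensional limits and equicontinuity for arrays of samples -/

section Array

variable {Ω : Type*} [MeasurableSpace Ω] {l : ℕ} {P : Measure Ω} [IsProbabilityMeasure P]
  {k : ℕ → ℕ} {ξ : (n : ℕ) → Fin (k n) → Ω → Fin l → ℝ} {μ : ℕ → Measure (Fin l → ℝ)}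
  {μ₀ : Measure (Fin l → ℝ)}

/-- The normalized distribution functions of an array of samples have Gaussian finite-dimensional
limits. -/
theorem IsSampleArray.tendsto_charFun (h : IsSampleArray P k ξ μ μ₀) {ι : Type*} [Fintype ι]
    (p : ι → Cube l) (t : ι → ℝ) :
    Tendsto (fun n => ∫ ω, Complex.exp
        ((∑ i, t i * normalizedDF (μ n) (fun j => ξ n j ω) (p i) : ℝ) * Complex.I) ∂P)
      atTop (𝓝 (Complex.exp
        (-((∑ i, ∑ j, t i * t j * bridgeCov μ₀ (p i) (p j) : ℝ) : ℂ) / 2))) := by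
  have := h.prob
  have := h.prob_limit
  set B := ∑ i, |t i|
  have hB0 : 0 ≤ B := Finset.sum_nonneg fun i _ => abs_nonneg _
  have hcov : ∀ x y : Cube l, Tendsto (fun n => bridgeCov (μ n) x y) atTop
      (𝓝 (bridgeCov μ₀ x y)) := by
    intro x y
    refine Tendsto.sub ?_ ((h.tendsto x).mul (h.tendsto y))
    exact h.tendsto ⟨(x : Fin l → ℝ) ⊓ y, le_inf x.2.1 y.2.1, inf_le_left.trans x.2.2⟩
  have hlim : Tendsto (fun n => Complex.exp
      (-((∑ i, ∑ j, t i * t j * bridgeCov (μ n) (p i) (p j) : ℝ) : ℂ) / 2)) atTop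
      (𝓝 (Complex.exp (-((∑ i, ∑ j, t i * t j * bridgeCov μ₀ (p i) (p j) : ℝ) : ℂ) / 2))) := by
    refine (Complex.continuous_exp.tendsto _).comp (Tendsto.div_const (Tendsto.neg ?_) 2)
    refine (Complex.continuous_ofReal.tendsto _).comp ?_
    exact tendsto_finsetSum _ fun i _ => tendsto_finsetSum _ fun j _ =>
      (hcov (p i) (p j)).const_mul _
  have hsq : Tendsto (fun n => √(k n : ℝ)) atTop atTop :=
    Real.tendsto_sqrt_atTop.comp (tendsto_natCast_atTop_atTop.comp h.tendsto_card)
  have herr : Tendsto (fun n => (B ^ 3 + B ^ 4) / √(k n : ℝ)) atTop (𝓝 0) :=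
    hsq.const_div_atTop _
  refine tendsto_of_tendsto_of_dist hlim ?_
  refine squeeze_zero' (Eventually.of_forall fun n => dist_nonneg) ?_ herr
  filter_upwards [hsq.eventually_ge_atTop B, h.tendsto_card.eventually_gt_atTop 0] with n hn hkn
  rw [dist_comm, dist_eq_norm, ← integral_boxComb_sq]
  simp_rw [sum_mul_normalizedDF hkn]
  exact norm_charFun_normalized_sum_sub_le hkn (h.measurable n) (h.indep n) (h.law n)
    (measurable_boxComb p t) (abs_boxComb_le p t) (integral_boxComb p t) hn

/-- Pólya's argument: monotone functions are sandwiched between their values on a finite grid, where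
convergence is uniform, and the limit is uniformly continuous. The functions `f n` themselves may
jump. -/
theorem exists_modulus_of_monotone_tendsto {f : ℕ → ℝ → ℝ} {f₀ : ℝ → ℝ} (hf : ∀ n, Monotone (f n))
    (hcont : ContinuousOn f₀ (Set.Icc 0 1))
    (hlim : ∀ t ∈ Set.Icc (0 : ℝ) 1, Tendsto (fun n => f n t) atTop (𝓝 (f₀ t))) {η : ℝ}
    (hη : 0 < η) : ∃ δ > 0, ∀ᶠ n in atTop, ∀ s ∈ Set.Icc (0 : ℝ) 1, ∀ t ∈ Set.Icc (0 : ℝ) 1,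
      |s - t| ≤ δ → |f n s - f n t| ≤ η := by
  have huc := isCompact_Icc.uniformContinuousOn_of_continuous hcont
  obtain ⟨δ, hδ, hδ'⟩ := Metric.uniformContinuousOn_iff.1 huc (η / 2) (by positivity)
  obtain ⟨N, hN⟩ := exists_nat_gt (2 / δ)
  have hN0 : (0 : ℝ) < N := lt_trans (by positivity) hN
  have hNδ : 2 / (N : ℝ) < δ := by
    rw [div_lt_iff₀ hN0]; rw [div_lt_iff₀ hδ] at hN; linarith
  -- Two points within $1/N$ lie between grid points `a` and `a + 2`. Since `a` can reach `N`, the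
  -- grid is truncated at 1 and indexed up to `N + 2`.
  set g : ℕ → ℝ := fun a => min (a / N) 1
  have hg : ∀ a, g a ∈ Set.Icc (0 : ℝ) 1 := fun a =>
    ⟨le_min (by positivity) zero_le_one, min_le_right _ _⟩
  have hgrid : ∀ᶠ n in atTop, ∀ a ∈ Finset.range (N + 3), |f n (g a) - f₀ (g a)| < η / 4 := by
    rw [Filter.eventually_all_finset]
    intro a _
    have := (Metric.tendsto_nhds.1 (hlim (g a) (hg a))) (η / 4) (by positivity)
    simpa [Real.dist_eq] using this
  refine ⟨1 / N, by positivity, hgrid.mono fun n hn => ?_⟩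
  have key : ∀ s ∈ Set.Icc (0 : ℝ) 1, ∀ t ∈ Set.Icc (0 : ℝ) 1, s ≤ t → t - s ≤ 1 / N →
      f n t - f n s ≤ η := by
    intro s hs t ht hst hd
    set a := ⌊s * N⌋₊
    have ha1 : (a : ℝ) ≤ s * N := Nat.floor_le (mul_nonneg hs.1 hN0.le)
    have ha2 : s * N < a + 1 := Nat.lt_floor_add_one _
    have haN : a ≤ N := by
      have : (a : ℝ) ≤ N := ha1.trans (mul_le_of_le_one_left hN0.le hs.2)
      exact_mod_cast this
    have h1 : g a ≤ s := (min_le_left _ _).trans ((div_le_iff₀ hN0).2 ha1)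
    have h2 : t ≤ g (a + 2) := by
      refine le_min ?_ ht.2
      rw [le_div_iff₀ hN0]
      have : (t - s) * N ≤ 1 := by
        rw [le_div_iff₀ hN0] at hd; exact hd
      push_cast
      nlinarith
    have h3 : dist (g (a + 2)) (g a) < δ := by
      refine lt_of_le_of_lt ?_ hNδ
      have hle : g a ≤ g (a + 2) := min_le_min (by push_cast; gcongr; linarith) le_rfl
      rw [Real.dist_eq, abs_of_nonneg (sub_nonneg.2 hle)]
      simp only [g]
      have e : ((a + 2 : ℕ) : ℝ) / N = a / N + 2 / N := by push_cast; ring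
      rw [e]
      have : (0 : ℝ) ≤ 2 / N := by positivity
      rcases le_total ((a : ℝ) / N) 1 with hh | hh
      · rw [min_eq_left hh]
        linarith [min_le_left ((a : ℝ) / N + 2 / N) 1]
      · rw [min_eq_right hh]
        linarith [min_le_right ((a : ℝ) / N + 2 / N) 1]
    have h4 := hδ' _ (hg (a + 2)) _ (hg a) h3
    rw [Real.dist_eq] at h4
    have h5 := hn a (Finset.mem_range.2 (by omega))
    have h6 := hn (a + 2) (Finset.mem_range.2 (by omega))
    have h7 := hf n h1
    have h8 := hf n h2
    rw [abs_lt] at h4 h5 h6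
    linarith
  intro s hs t ht hd
  rcases le_total s t with h | h
  · rw [abs_sub_comm, abs_of_nonneg (sub_nonneg.2 (hf n h))]
    exact key s hs t ht h (by rwa [abs_sub_comm, abs_of_nonneg (sub_nonneg.2 h)] at hd)
  · rw [abs_of_nonneg (sub_nonneg.2 (hf n h))]
    exact key t ht s hs h (by rwa [abs_of_nonneg (sub_nonneg.2 h)] at hd)

/-- The point of the cube whose `i`-th coordinate is `t` and whose other coordinates are `1`. -/
noncomputable def Cube.onAxis (i : Fin l) (t : Set.Icc (0 : ℝ) 1) : Cube l :=
  ⟨Function.update 1 i t, by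
    constructor <;> intro j <;> by_cases hj : j = i
    · subst hj; simpa using t.2.1
    · simp [hj]
    · subst hj; simpa using t.2.2
    · simp [hj]⟩

theorem Cube.continuous_onAxis (i : Fin l) : Continuous (Cube.onAxis i) := by
  refine continuous_induced_rng.2 ?_
  exact (continuous_const (y := (1 : Fin l → ℝ))).update i
    (continuous_subtype_val (p := fun t => t ∈ Set.Icc (0 : ℝ) 1))

/-- On the cube the constraints at the coordinates equal to 1 are void, so convergence of joint
distribution functions controls the marginals. -/
theorem marginalDF_eq_measureReal_Icc {ν : Measure (Fin l → ℝ)} (hν : ν (Set.Icc 0 1)ᶜ = 0)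
    (i : Fin l) (t : Set.Icc (0 : ℝ) 1) :
    marginalDF ν i t = ν.real (Set.Icc 0 (Cube.onAxis i t : Fin l → ℝ)) := by
  refine measureReal_congr ?_
  have : ∀ᵐ e ∂ν, e ∈ Set.Icc (0 : Fin l → ℝ) 1 := hν
  filter_upwards [this] with e he
  refine propext ⟨fun h => ⟨he.1, fun j => ?_⟩, fun h => ?_⟩
  · by_cases hj : j = i
    · subst hj
      have h' : e j ≤ t := h
      simpa [Cube.onAxis] using h'
    · simpa [Cube.onAxis, hj] using he.2 j
  · have := h.2 i
    have h' : e i ≤ t := by simpa [Cube.onAxis] using this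
    exact h'

/-- Asymptotic equicontinuity of the empirical processes of an array of samples. -/
theorem IsSampleArray.exists_modulus (h : IsSampleArray P k ξ μ μ₀) {ε : ℝ} (hε : 0 < ε) :
    ∃ δ > 0, ∀ᶠ n in atTop, P {ω | ∃ x y : Cube l, dist x y ≤ δ ∧
      ε < |normalizedDF (μ n) (fun j => ξ n j ω) x -
        normalizedDF (μ n) (fun j => ξ n j ω) y|} ≤ ENNReal.ofReal ε := by
  have := h.prob
  have := h.prob_limit
  obtain ⟨δ₀, hδ₀, k₀, hk₀⟩ := exists_modulus_normalizedDF l hε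
  have hcoord : ∀ i : Fin l, ∃ δ > 0, ∀ᶠ n in atTop, ∀ s ∈ Set.Icc (0 : ℝ) 1,
      ∀ t ∈ Set.Icc (0 : ℝ) 1, |s - t| ≤ δ →
        |marginalDF (μ n) i s - marginalDF (μ n) i t| ≤ δ₀ / (l + 1) := by
    intro i
    refine exists_modulus_of_monotone_tendsto (f₀ := marginalDF μ₀ i)
      (fun n => marginalDF_mono i) ?_ ?_ (by positivity)
    · rw [continuousOn_iff_continuous_domRestrict]
      refine (h.continuous.comp (Cube.continuous_onAxis i)).congr fun t => ?_
      exact (marginalDF_eq_measureReal_Icc h.cube_limit i t).symm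
    · intro t ht
      have := h.tendsto (Cube.onAxis i ⟨t, ht⟩)
      rw [← marginalDF_eq_measureReal_Icc h.cube_limit] at this
      simp_rw [← marginalDF_eq_measureReal_Icc (h.cube _)] at this
      exact this
  choose δ hδ hδ' using hcoord
  obtain ⟨d, hd0, hd⟩ : ∃ d > 0, ∀ i, d ≤ δ i := by
    rcases isEmpty_or_nonempty (Fin l) with he | he
    · exact ⟨1, one_pos, fun i => (IsEmpty.false i).elim⟩
    · obtain ⟨i, hi⟩ := Finite.exists_min δ
      exact ⟨δ i, hδ i, hi⟩
  refine ⟨d, hd0, ?_⟩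
  filter_upwards [eventually_all.2 hδ', h.tendsto_card.eventually_ge_atTop k₀] with n hn hkn
  refine le_trans (measure_mono ?_) (hk₀ (k n) hkn P (μ n) (ξ n) (h.measurable n) (h.indep n)
    (h.law n))
  rintro ω ⟨x, y, hxy, hlt⟩
  refine ⟨x, y, ?_, hlt⟩
  calc marginalDist (μ n) x y ≤ ∑ _i : Fin l, δ₀ / (l + 1) := by
        refine Finset.sum_le_sum fun i _ => hn i _ ⟨x.2.1 i, x.2.2 i⟩ _ ⟨y.2.1 i, y.2.2 i⟩ ?_
        refine le_trans ?_ (hxy.trans (hd i))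
        exact dist_le_pi_dist x.1 y.1 i
    _ = l * (δ₀ / (l + 1)) := by simp
    _ ≤ δ₀ := by
        rw [mul_div_assoc', div_le_iff₀ (by positivity)]
        nlinarith

end Array

/-! ### Tightness -/

/-- In a complete space, the intersection of closed thickenings of compact sets with radii tending
to 0 is closed and totally bounded, hence compact. -/
theorem isTightMeasureSet_of_forall_exists_cthickening {E : Type*} [MetricSpace E]
    [CompleteSpace E] [MeasurableSpace E] [BorelSpace E] {S : Set (Measure E)}
    (h : ∀ ε : ℝ, 0 < ε → ∃ C : Set E, IsCompact C ∧
      ∀ μ ∈ S, μ (Metric.cthickening ε C)ᶜ ≤ ENNReal.ofReal ε) :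
    IsTightMeasureSet S := by
  rw [isTightMeasureSet_iff_exists_isCompact_measure_compl_le]
  intro ε hε
  obtain ⟨ε', hε', hsum⟩ := ENNReal.exists_pos_sum_of_countable hε.ne' ℕ
  -- The first bound makes the exceptional masses sum to less than `ε`, the second makes the radii
  -- tend to 0.
  set δ : ℕ → ℝ := fun j => min (ε' j : ℝ) (1 / ((j : ℝ) + 1))
  have hδ : ∀ j, 0 < δ j := fun j => lt_min (by exact_mod_cast hε' j) (by positivity)
  choose C hC hCμ using fun j => h (δ j) (hδ j)
  refine ⟨⋂ j, Metric.cthickening (δ j) (C j), ?_, fun μ hμ => ?_⟩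
  · refine isCompact_iff_totallyBounded_isComplete.2 ⟨?_,
      (isClosed_iInter fun j => Metric.isClosed_cthickening).isComplete⟩
    rw [Metric.totallyBounded_iff]
    intro η hη
    obtain ⟨j, hj⟩ := exists_nat_one_div_lt (show 0 < η / 2 by positivity)
    obtain ⟨t, ht, hcov⟩ := Metric.totallyBounded_iff.1 (hC j).totallyBounded (η / 2)
      (by positivity)
    refine ⟨t, ht, fun w hw => ?_⟩
    have hw' := Set.mem_iInter.1 hw j
    rw [(hC j).cthickening_eq_biUnion_closedBall (hδ j).le] at hw'
    obtain ⟨c, hc, hwc⟩ := Set.mem_iUnion₂.1 hw'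
    obtain ⟨y, hy, hcy⟩ := Set.mem_iUnion₂.1 (hcov hc)
    refine Set.mem_iUnion₂.2 ⟨y, hy, ?_⟩
    rw [Metric.mem_closedBall] at hwc
    rw [Metric.mem_ball] at hcy ⊢
    have := dist_triangle w c y
    have : δ j ≤ 1 / ((j : ℝ) + 1) := min_le_right _ _
    linarith
  · rw [Set.compl_iInter]
    refine (measure_iUnion_le _).trans (le_trans (ENNReal.tsum_le_tsum fun j => ?_) hsum.le)
    refine (hCμ j μ hμ).trans ?_
    rw [← ENNReal.ofReal_coe_nnreal]
    exact ENNReal.ofReal_le_ofReal (min_le_left _ _)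

/-! ### Interpolation operators -/

/-- A finite continuous partition of unity of mesh `δ`, with nodes. -/
structure Interpolation (K : Type) [MetricSpace K] (δ : ℝ) where
  /-- the number of nodes -/
  size : ℕ
  /-- the nodes -/
  node : Fin size → K
  /-- the weight functions -/
  weight : Fin size → C(K, ℝ)
  weight_nonneg : ∀ i x, 0 ≤ weight i x
  sum_weight : ∀ x, ∑ i, weight i x = 1
  dist_lt : ∀ i x, weight i x ≠ 0 → dist x (node i) < δ

/-- The vector of the values of a continuous function at the points `p i`. -/
noncomputable def evalVec {K ι : Type} [TopologicalSpace K] [Fintype ι] (p : ι → K) (w : C(K, ℝ)) :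
    EuclideanSpace ℝ ι :=
  WithLp.toLp 2 fun i => w (p i)

theorem continuous_evalVec {K ι : Type} [TopologicalSpace K] [CompactSpace K] [Fintype ι]
    (p : ι → K) : Continuous (evalVec p) :=
  (PiLp.continuous_toLp 2 _).comp (continuous_pi fun i => continuous_eval_const (p i))

namespace Interpolation

variable {K : Type} [MetricSpace K] [CompactSpace K] {δ : ℝ}

theorem nonempty_of_pos (hδ : 0 < δ) : Nonempty (Interpolation K δ) := by
  obtain ⟨t, ht⟩ : ∃ t : Finset K, (⋃ x ∈ t, Metric.ball x δ) = Set.univ := by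
    obtain ⟨t, ht⟩ := CompactSpace.elim_nhds_subcover (fun x : K => Metric.ball x δ)
      fun x => Metric.ball_mem_nhds x hδ
    exact ⟨t, ht⟩
  let e := t.equivFin.symm
  -- Tent functions on a finite cover by balls; normalizing them gives the weights.
  set ψ : Fin t.card → C(K, ℝ) := fun i => ⟨fun x => max 0 (δ - dist x (e i)), by fun_prop⟩
  have hψ : ∀ i x, 0 ≤ ψ i x := fun i x => le_max_left _ _
  have hpos : ∀ x, 0 < ∑ i, ψ i x := by
    intro x
    obtain ⟨y, hy, hxy⟩ := Set.mem_iUnion₂.1 (ht ▸ Set.mem_univ x : x ∈ ⋃ x ∈ t, Metric.ball x δ)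
    refine Finset.sum_pos' (fun i _ => hψ i x) ⟨e.symm ⟨y, hy⟩, Finset.mem_univ _, ?_⟩
    refine lt_max_of_lt_right ?_
    rw [Equiv.apply_symm_apply]
    exact sub_pos.2 hxy
  refine ⟨⟨t.card, fun i => e i, fun i => ⟨fun x => ψ i x / ∑ j, ψ j x, ?_⟩, ?_, ?_, ?_⟩⟩
  · exact (ψ i).continuous.div (continuous_finsetSum _ fun j _ => (ψ j).continuous)
      fun x => (hpos x).ne'
  · exact fun i x => div_nonneg (hψ i x) (hpos x).le
  · intro x
    change ∑ i, ψ i x / ∑ j, ψ j x = 1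
    rw [← Finset.sum_div, div_self (hpos x).ne']
  · intro i x hx
    change ψ i x / ∑ j, ψ j x ≠ 0 at hx
    by_contra hcon
    push Not at hcon
    refine hx ?_
    have : ψ i x = 0 := max_eq_left (by linarith)
    rw [this, zero_div]

variable (I : Interpolation K δ)

/-- The continuous function interpolating prescribed values at the nodes. -/
noncomputable def op (v : EuclideanSpace ℝ (Fin I.size)) : C(K, ℝ) := ∑ i, v i • I.weight i

theorem op_apply (v : EuclideanSpace ℝ (Fin I.size)) (x : K) :
    I.op v x = ∑ i, v i * I.weight i x := by
  simp [op, ContinuousMap.sum_apply]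

theorem continuous_op : Continuous I.op :=
  continuous_finsetSum _ fun i _ =>
    ((EuclideanSpace.proj (𝕜 := ℝ) i).continuous).smul continuous_const

/-- The interpolation of a function. -/
noncomputable def approx (v : K → ℝ) : C(K, ℝ) := I.op (WithLp.toLp 2 fun i => v (I.node i))

theorem approx_apply (v : K → ℝ) (x : K) :
    I.approx v x = ∑ i, v (I.node i) * I.weight i x := by
  rw [approx, op_apply]

/-- The weights at `x` are a probability vector carried by nodes within `δ` of `x`, so an average of
values close to `b` is close to `b`. -/
theorem abs_sum_mul_weight_sub_le {a : Fin I.size → ℝ} {b ε : ℝ} {x : K}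
    (h : ∀ i, dist x (I.node i) < δ → |a i - b| ≤ ε) :
    |∑ i, a i * I.weight i x - b| ≤ ε := by
  have h1 : ∑ i, a i * I.weight i x - b = ∑ i, (a i - b) * I.weight i x := by
    simp_rw [sub_mul]
    rw [Finset.sum_sub_distrib, ← Finset.mul_sum, I.sum_weight, mul_one]
  rw [h1]
  calc |∑ i, (a i - b) * I.weight i x| ≤ ∑ i, ε * I.weight i x := by
        refine (Finset.abs_sum_le_sum_abs _ _).trans (Finset.sum_le_sum fun i _ => ?_)
        rw [abs_mul, abs_of_nonneg (I.weight_nonneg i x)]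
        by_cases hw : I.weight i x = 0
        · rw [hw, mul_zero, mul_zero]
        · exact mul_le_mul_of_nonneg_right (h i (I.dist_lt i x hw)) (I.weight_nonneg i x)
    _ = ε := by rw [← Finset.mul_sum, I.sum_weight, mul_one]

theorem abs_approx_sub_le {v : K → ℝ} {ε : ℝ} (h : ∀ x y, dist x y ≤ δ → |v x - v y| ≤ ε) (x : K) :
    |I.approx v x - v x| ≤ ε := by
  rw [approx_apply]
  refine I.abs_sum_mul_weight_sub_le fun i hi => h _ _ ?_
  rw [dist_comm]; exact hi.le

theorem abs_approx_sub_approx_le {v w : K → ℝ} {ε : ℝ} (h : ∀ x, |v x - w x| ≤ ε) (x : K) :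
    |I.approx v x - I.approx w x| ≤ ε := by
  rw [approx_apply, approx_apply, ← Finset.sum_sub_distrib]
  simp_rw [← sub_mul]
  have := I.abs_sum_mul_weight_sub_le (a := fun i => v (I.node i) - w (I.node i)) (b := 0)
    (ε := ε) (x := x) (fun i _ => by rw [sub_zero]; exact h _)
  rwa [sub_zero] at this

theorem continuous_approx : Continuous fun w : C(K, ℝ) => I.approx w :=
  I.continuous_op.comp (continuous_evalVec I.node)

theorem tendsto_approx {δ : ℕ → ℝ} (hδ : Tendsto δ atTop (𝓝 0))
    (I : (n : ℕ) → Interpolation K (δ n)) (w : C(K, ℝ)) :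
    Tendsto (fun n => (I n).approx w) atTop (𝓝 w) := by
  rw [Metric.tendsto_atTop']
  intro ε hε
  obtain ⟨η, hη, h⟩ := Metric.uniformContinuous_iff.1
    (CompactSpace.uniformContinuous_of_continuous w.continuous) (ε / 2) (by positivity)
  obtain ⟨N, hN⟩ := eventually_atTop.1 (hδ.eventually (gt_mem_nhds hη))
  refine ⟨N, fun n hn => ?_⟩
  refine lt_of_le_of_lt ((ContinuousMap.dist_le (half_pos hε).le).2 fun x => ?_) (half_lt_self hε)
  refine (I n).abs_approx_sub_le (fun x y hxy => ?_) x
  exact (h (hxy.trans_lt (hN n hn.le))).le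

end Interpolation

/-! ### Asymptotically Gaussian random functions -/

/-- The random functions `V n` are asymptotically centred Gaussian with covariance `κ`, and
asymptotically equicontinuous in probability. -/
structure IsAsympGaussian {K Ω : Type*} [MetricSpace K] [MeasurableSpace Ω] (P : Measure Ω)
    (V : ℕ → Ω → K → ℝ) (κ : K → K → ℝ) : Prop where
  aemeasurable : ∀ n x, AEMeasurable (fun ω => V n ω x) P
  symm : ∀ x y, κ x y = κ y x
  nonneg : ∀ (ι : Type) [Fintype ι] (p : ι → K) (t : ι → ℝ),
    0 ≤ ∑ i, ∑ j, t i * t j * κ (p i) (p j)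
  continuous : Continuous fun z : K × K => κ z.1 z.2
  charFun : ∀ (ι : Type) [Fintype ι] (p : ι → K) (t : ι → ℝ),
    Tendsto (fun n => ∫ ω, Complex.exp ((∑ i, t i * V n ω (p i) : ℝ) * Complex.I) ∂P) atTop
      (𝓝 (Complex.exp (-((∑ i, ∑ j, t i * t j * κ (p i) (p j) : ℝ) : ℂ) / 2)))
  modulus : ∀ ε : ℝ, 0 < ε → ∃ δ > 0, ∀ᶠ n in atTop,
    P {ω | ∃ x y : K, dist x y ≤ δ ∧ ε < |V n ω x - V n ω y|} ≤ ENNReal.ofReal ε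

/-- The centred Gaussian law of the values at the points `p i` of a process with covariance `κ`. -/
noncomputable def gaussVec {K ι : Type} [Fintype ι] [DecidableEq ι] (κ : K → K → ℝ) (p : ι → K) :
    ProbabilityMeasure (EuclideanSpace ℝ ι) :=
  ⟨multivariateGaussian 0 (Matrix.of fun i j => κ (p i) (p j)), inferInstance⟩

namespace IsAsympGaussian

variable {K : Type} {Ω : Type*} [MetricSpace K] [CompactSpace K] [MeasurableSpace Ω] {P : Measure Ω}
  [IsProbabilityMeasure P] {V : ℕ → Ω → K → ℝ} {κ : K → K → ℝ}

theorem posSemidef (h : IsAsympGaussian P V κ) {ι : Type} [Fintype ι] (p : ι → K) :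
    (Matrix.of fun i j => κ (p i) (p j)).PosSemidef := by
  refine .of_dotProduct_mulVec_nonneg (Matrix.IsHermitian.ext fun i j => ?_) fun x => ?_
  · simp [h.symm]
  · refine (h.nonneg ι p x).trans (le_of_eq ?_)
    simp only [dotProduct, Matrix.mulVec, Matrix.of_apply, Finset.mul_sum, star_trivial]
    exact Finset.sum_congr rfl fun i _ => Finset.sum_congr rfl fun j _ => by ring

theorem charFun_gaussVec (h : IsAsympGaussian P V κ) {ι : Type} [Fintype ι] [DecidableEq ι]
    (p : ι → K) (t : EuclideanSpace ℝ ι) :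
    MeasureTheory.charFun (gaussVec κ p : Measure (EuclideanSpace ℝ ι)) t =
      Complex.exp (-((∑ i, ∑ j, t i * t j * κ (p i) (p j) : ℝ) : ℂ) / 2) := by
  rw [gaussVec, ProbabilityMeasure.coe_mk, charFun_multivariateGaussian (h.posSemidef p)]
  congr 1
  have : t.ofLp ⬝ᵥ (Matrix.of fun i j => κ (p i) (p j)).mulVec t.ofLp =
      ∑ i, ∑ j, t i * t j * κ (p i) (p j) := by
    simp only [dotProduct, Matrix.mulVec, Matrix.of_apply, Finset.mul_sum]
    exact Finset.sum_congr rfl fun i _ => Finset.sum_congr rfl fun j _ => by ring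
  rw [this]
  simp [neg_div]

theorem aemeasurable_toLp (h : IsAsympGaussian P V κ) {ι : Type} [Fintype ι] (p : ι → K) (n : ℕ) :
    AEMeasurable (fun ω => (WithLp.toLp 2 fun i => V n ω (p i) : EuclideanSpace ℝ ι)) P :=
  (PiLp.continuous_toLp 2 _).measurable.comp_aemeasurable
    (aemeasurable_pi_lambda _ fun i => h.aemeasurable n (p i))

/-- The law of the values of `V n` at the points `p i`. -/
noncomputable def valueLaw (h : IsAsympGaussian P V κ) {ι : Type} [Fintype ι] (p : ι → K) (n : ℕ) :
    ProbabilityMeasure (EuclideanSpace ℝ ι) :=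
  ⟨P.map fun ω => (WithLp.toLp 2 fun i => V n ω (p i) : EuclideanSpace ℝ ι),
    Measure.isProbabilityMeasure_map (h.aemeasurable_toLp p n)⟩

theorem tendsto_valueLaw (h : IsAsympGaussian P V κ) {ι : Type} [Fintype ι] [DecidableEq ι]
    (p : ι → K) : Tendsto (h.valueLaw p) atTop (𝓝 (gaussVec κ p)) := by
  refine ProbabilityMeasure.tendsto_of_tendsto_charFun fun t => ?_
  rw [h.charFun_gaussVec]
  refine (h.charFun ι p t).congr fun n => ?_
  rw [valueLaw, ProbabilityMeasure.coe_mk, charFun_apply,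
    integral_map (h.aemeasurable_toLp p n) (by fun_prop)]
  simp [PiLp.inner_apply]

variable [MeasurableSpace C(K, ℝ)] [BorelSpace C(K, ℝ)]

/-- The law of the interpolated Gaussian process. -/
noncomputable def interpLaw {δ : ℝ} (κ : K → K → ℝ) (I : Interpolation K δ) :
    ProbabilityMeasure C(K, ℝ) :=
  (gaussVec κ I.node).map I.continuous_op.aemeasurable

/-- Portmanteau for open sets: the interpolated Gaussian law is the limit of the laws of the
interpolated `V n`, so it inherits their probability bounds. No limit process is needed yet. -/
theorem measure_interpLaw_le (h : IsAsympGaussian P V κ) {δ : ℝ} (I : Interpolation K δ)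
    {G : Set C(K, ℝ)} (hG : IsOpen G) {c : ENNReal}
    (hc : ∀ᶠ n in atTop, P {ω | I.approx (V n ω) ∈ G} ≤ c) :
    (interpLaw κ I : Measure C(K, ℝ)) G ≤ c := by
  have hlim := ProbabilityMeasure.tendsto_map_of_tendsto_of_continuous _ _
    (h.tendsto_valueLaw I.node) I.continuous_op
  refine (ProbabilityMeasure.le_liminf_measure_open_of_tendsto hlim hG).trans ?_
  refine liminf_le_of_le (by isBoundedDefault) fun b hb => ?_
  obtain ⟨n, hn1, hn2⟩ := (hb.and hc).exists
  refine hn1.trans (le_trans (le_of_eq ?_) hn2)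
  rw [ProbabilityMeasure.toMeasure_map, valueLaw, ProbabilityMeasure.coe_mk,
    AEMeasurable.map_map_of_aemeasurable I.continuous_op.aemeasurable (h.aemeasurable_toLp I.node n),
    Measure.map_apply_of_aemeasurable
      (I.continuous_op.measurable.comp_aemeasurable (h.aemeasurable_toLp I.node n))
      hG.measurableSet]
  rfl

/-- If `V n` oscillates by at most `ε` at scale `δ₀`, then both interpolations are `ε`-close to it
and interpolating is a contraction, which gives $3\varepsilon$. The bound is uniform in the mesh of
`I'`. -/
theorem exists_measure_interpLaw_dist_le (h : IsAsympGaussian P V κ) {ε : ℝ} (hε : 0 < ε) :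
    ∃ δ₀ > 0, ∀ δ ≤ δ₀, ∀ δ' ≤ δ₀, ∀ (I : Interpolation K δ) (I' : Interpolation K δ'),
      (interpLaw κ I' : Measure C(K, ℝ)) {w | 3 * ε < dist (I.approx w) w} ≤
        ENNReal.ofReal ε := by
  obtain ⟨δ₀, hδ₀, hmod⟩ := h.modulus ε hε
  refine ⟨δ₀, hδ₀, fun δ hδ δ' hδ' I I' => ?_⟩
  refine h.measure_interpLaw_le I'
    (isOpen_lt continuous_const (I.continuous_approx.dist continuous_id)) ?_
  refine hmod.mono fun n hn => (measure_mono fun ω hω => ?_).trans hn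
  by_contra hcon
  have hosc : ∀ x y, dist x y ≤ δ₀ → |V n ω x - V n ω y| ≤ ε := by
    intro x y hxy
    by_contra hlt
    exact hcon ⟨x, y, hxy, not_le.1 hlt⟩
  have h1 := I.abs_approx_sub_le fun x y hxy => hosc x y (hxy.trans hδ)
  have h2 := I'.abs_approx_sub_le fun x y hxy => hosc x y (hxy.trans hδ')
  have h3 := I.abs_approx_sub_approx_le h2
  have : 3 * ε < dist (I.approx (I'.approx (V n ω))) (I'.approx (V n ω)) := hω
  refine absurd this (not_lt.2 ((ContinuousMap.dist_le (by positivity)).2 fun x => ?_))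
  rw [Real.dist_eq]
  have e1 := h1 x
  have e2 := h2 x
  have e3 := h3 x
  rw [abs_le] at *
  constructor <;> linarith

/-- The covariance of the interpolated vector is $\kappa$ averaged by the weights around each pair
of points; it tends to $\kappa$ by uniform continuity. -/
theorem tendsto_evalVec_interpLaw (h : IsAsympGaussian P V κ) {δ : ℕ → ℝ}
    (hδ : Tendsto δ atTop (𝓝 0)) (I : (n : ℕ) → Interpolation K (δ n)) {ι : Type} [Fintype ι]
    [DecidableEq ι] (p : ι → K) :
    Tendsto (fun n => (interpLaw κ (I n)).map (continuous_evalVec p).aemeasurable) atTop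
      (𝓝 (gaussVec κ p)) := by
  refine ProbabilityMeasure.tendsto_of_tendsto_charFun fun t => ?_
  rw [h.charFun_gaussVec]
  set s : (n : ℕ) → EuclideanSpace ℝ (Fin (I n).size) := fun n =>
    WithLp.toLp 2 fun a => ∑ i, t i * (I n).weight a (p i)
  have hchar : ∀ n, MeasureTheory.charFun ((interpLaw κ (I n)).map
      (continuous_evalVec p).aemeasurable : Measure (EuclideanSpace ℝ ι)) t =
      Complex.exp (-((∑ i, ∑ j, t i * t j * ∑ a, (∑ b, κ ((I n).node a) ((I n).node b) *
        (I n).weight b (p j)) * (I n).weight a (p i) : ℝ) : ℂ) / 2) := by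
    intro n
    have h1 : MeasureTheory.charFun ((interpLaw κ (I n)).map
        (continuous_evalVec p).aemeasurable : Measure (EuclideanSpace ℝ ι)) t =
        MeasureTheory.charFun (gaussVec κ (I n).node : Measure _) (s n) := by
      rw [interpLaw, ProbabilityMeasure.toMeasure_map, ProbabilityMeasure.toMeasure_map,
        Measure.map_map (continuous_evalVec p).measurable (I n).continuous_op.measurable,
        charFun_apply, charFun_apply, integral_map
        ((continuous_evalVec p).comp (I n).continuous_op).aemeasurable (by fun_prop)]
      refine integral_congr_ae (ae_of_all _ fun v => ?_)
      simp only [Function.comp_apply]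
      congr 3
      simp only [PiLp.inner_apply, evalVec, s, Interpolation.op_apply]
      simp only [RCLike.inner_apply, conj_trivial, Finset.mul_sum, Finset.sum_mul]
      rw [Finset.sum_comm]
      exact Finset.sum_congr rfl fun a _ => Finset.sum_congr rfl fun i _ => by ring
    rw [h1, h.charFun_gaussVec]
    congr 4
    simp only [s, Finset.sum_mul, Finset.mul_sum]
    calc _ = ∑ a, ∑ b, ∑ i, ∑ j, t i * t j * (κ ((I n).node a) ((I n).node b) *
          (I n).weight b (p j) * (I n).weight a (p i)) := by
          refine Finset.sum_congr rfl fun a _ => Finset.sum_congr rfl fun b _ => ?_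
          rw [Finset.sum_comm]
          exact Finset.sum_congr rfl fun i _ => Finset.sum_congr rfl fun j _ => by ring
      _ = ∑ a, ∑ i, ∑ j, ∑ b, t i * t j * (κ ((I n).node a) ((I n).node b) *
          (I n).weight b (p j) * (I n).weight a (p i)) := by
          refine Finset.sum_congr rfl fun a _ => ?_
          rw [Finset.sum_comm]
          exact Finset.sum_congr rfl fun i _ => Finset.sum_comm
      _ = _ := by
          rw [Finset.sum_comm]
          exact Finset.sum_congr rfl fun i _ => Finset.sum_comm
  simp_rw [hchar]
  refine (Complex.continuous_exp.tendsto _).comp (Tendsto.div_const (Tendsto.neg ?_) 2)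
  refine (Complex.continuous_ofReal.tendsto _).comp ?_
  refine tendsto_finsetSum _ fun i _ => tendsto_finsetSum _ fun j _ => Tendsto.const_mul _ ?_
  rw [Metric.tendsto_atTop']
  intro ε hε
  obtain ⟨η, hη, hκ⟩ := Metric.uniformContinuous_iff.1
    (CompactSpace.uniformContinuous_of_continuous h.continuous) (ε / 2) (by positivity)
  obtain ⟨N, hN⟩ := eventually_atTop.1 (hδ.eventually (gt_mem_nhds hη))
  refine ⟨N, fun n hn => ?_⟩
  rw [Real.dist_eq]
  refine lt_of_le_of_lt ((I n).abs_sum_mul_weight_sub_le fun a ha => ?_) (half_lt_self hε)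
  refine (I n).abs_sum_mul_weight_sub_le fun b hb => ?_
  have := hκ (a := ((I n).node a, (I n).node b)) (b := (p i, p j)) (by
    rw [Prod.dist_eq, max_lt_iff, dist_comm, dist_comm ((I n).node b)]
    exact ⟨ha.trans (hN n hn.le), hb.trans (hN n hn.le)⟩)
  exact this.le

/-- Fix a fine mesh `I N`. For later `n`, a path is with high probability close to its own `I
N`-interpolation, which is the image under `op` of a tight vector of node values. The finitely many
earlier laws are individually tight. -/
theorem isTightMeasureSet_interpLaw (h : IsAsympGaussian P V κ) {δ : ℕ → ℝ}
    (hδ : Tendsto δ atTop (𝓝 0)) (I : (n : ℕ) → Interpolation K (δ n)) :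
    IsTightMeasureSet (Set.range fun n => (interpLaw κ (I n) : Measure C(K, ℝ))) := by
  refine isTightMeasureSet_of_forall_exists_cthickening fun ε hε => ?_
  obtain ⟨δ₀, hδ₀, hI⟩ := h.exists_measure_interpLaw_dist_le (ε := ε / 6) (by positivity)
  obtain ⟨N, hN⟩ := eventually_atTop.1 (hδ.eventually (gt_mem_nhds hδ₀))
  -- the values at the nodes are tight
  have hval : IsTightMeasureSet (Set.range fun n => ((interpLaw κ (I n)).map
      (continuous_evalVec (I N).node).aemeasurable : Measure (EuclideanSpace ℝ (Fin (I N).size)))) := by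
    refine isTightMeasureSet_of_tendsto_charFun
      (f := MeasureTheory.charFun (gaussVec κ (I N).node : Measure _)) (by fun_prop)
      (ProbabilityMeasure.tendsto_iff_tendsto_charFun.1
        (h.tendsto_evalVec_interpLaw hδ I (I N).node))
  obtain ⟨C₀, hC₀, hC₀'⟩ := isTightMeasureSet_iff_exists_isCompact_measure_compl_le.1 hval
    (ENNReal.ofReal (ε / 6)) (by simpa using hε)
  have hsing : ∀ n, ∃ C : Set C(K, ℝ), IsCompact C ∧
      (interpLaw κ (I n) : Measure C(K, ℝ)) Cᶜ ≤ ENNReal.ofReal ε := by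
    intro n
    obtain ⟨C, hC, hC'⟩ := isTightMeasureSet_iff_exists_isCompact_measure_compl_le.1
      (isTightMeasureSet_singleton (μ := (interpLaw κ (I n) : Measure C(K, ℝ))))
      (ENNReal.ofReal ε) (by simpa using hε)
    exact ⟨C, hC, hC' _ rfl⟩
  choose C hC hC' using hsing
  refine ⟨(⋃ n ∈ Finset.range N, C n) ∪ (I N).op '' C₀,
    ((Finset.range N).isCompact_biUnion fun n _ => hC n).union (hC₀.image (I N).continuous_op), ?_⟩
  rintro _ ⟨n, rfl⟩
  rcases lt_or_ge n N with hn | hn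
  · refine (measure_mono (Set.compl_subset_compl.2 ?_)).trans (hC' n)
    refine Set.Subset.trans ?_ (Metric.self_subset_cthickening _)
    exact (Set.subset_biUnion_of_mem (u := C) (Finset.mem_coe.2 (Finset.mem_range.2 hn))).trans
      Set.subset_union_left
  · have hsub : (Metric.cthickening ε ((⋃ n ∈ Finset.range N, C n) ∪ (I N).op '' C₀))ᶜ ⊆
        {w | 3 * (ε / 6) < dist ((I N).approx w) w} ∪ (evalVec (I N).node) ⁻¹' C₀ᶜ := by
      intro w hw
      by_contra hcon
      rw [Set.mem_union, not_or] at hcon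
      obtain ⟨h1, h2⟩ := hcon
      have h1 : dist ((I N).approx w) w ≤ 3 * (ε / 6) := not_lt.1 h1
      have h2 : evalVec (I N).node w ∈ C₀ := not_not.1 h2
      refine hw (Metric.mem_cthickening_of_dist_le w ((I N).approx w) ε _
        (Or.inr ⟨_, h2, rfl⟩) ?_)
      rw [dist_comm]; linarith
    refine (measure_mono hsub).trans ((measure_union_le _ _).trans ?_)
    have e1 := hI (δ N) (hN N le_rfl).le (δ n) (hN n hn).le (I N) (I n)
    have e2 : ((interpLaw κ (I n)).map (continuous_evalVec (I N).node).aemeasurable :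
        Measure _) C₀ᶜ ≤ ENNReal.ofReal (ε / 6) := hC₀' _ ⟨n, rfl⟩
    rw [ProbabilityMeasure.toMeasure_map, Measure.map_apply (continuous_evalVec _).measurable
      hC₀.isClosed.measurableSet.compl] at e2
    refine (add_le_add e1 e2).trans ?_
    rw [← ENNReal.ofReal_add (by positivity) (by positivity)]
    exact ENNReal.ofReal_le_ofReal (by linarith)

/-- Asymptotically Gaussian, asymptotically equicontinuous random functions have a continuous
Gaussian limit process. -/
theorem exists_limit (h : IsAsympGaussian P V κ) : ∃ ν : ProbabilityMeasure C(K, ℝ),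
    ∀ (ι : Type) [Fintype ι] [DecidableEq ι] (p : ι → K),
      ν.map (continuous_evalVec p).aemeasurable = gaussVec κ p := by
  have hδ : Tendsto (fun n : ℕ => 1 / ((n : ℝ) + 1)) atTop (𝓝 0) :=
    tendsto_one_div_add_atTop_nhds_zero_nat
  have I : (n : ℕ) → Interpolation K (1 / ((n : ℝ) + 1)) := fun n =>
    (Interpolation.nonempty_of_pos (K := K) (show (0 : ℝ) < 1 / ((n : ℝ) + 1) by positivity)).some
  have htight := h.isTightMeasureSet_interpLaw hδ I
  -- Prokhorov's theorem; any cluster point will do, since its finite-dimensional laws are forced by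
  -- the convergence of the node laws.
  have hcomp : IsCompact (closure (Set.range fun n => interpLaw κ (I n))) := by
    refine isCompact_closure_of_isTightMeasureSet ?_
    convert htight using 1
    ext ρ
    constructor
    · rintro ⟨_, ⟨n, rfl⟩, rfl⟩; exact ⟨n, rfl⟩
    · rintro ⟨n, rfl⟩; exact ⟨_, ⟨n, rfl⟩, rfl⟩
  obtain ⟨ν, -, hν⟩ := hcomp.exists_mapClusterPt (f := atTop) (u := fun n => interpLaw κ (I n))
    (le_principal_iff.2 (mem_map.2 (univ_mem' fun n => subset_closure ⟨n, rfl⟩)))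
  refine ⟨ν, fun ι _ _ p => ?_⟩
  obtain ⟨U, hU, hUν⟩ := mapClusterPt_iff_ultrafilter.1 hν
  exact tendsto_nhds_unique
    (ProbabilityMeasure.tendsto_map_of_tendsto_of_continuous _ _ hUν (continuous_evalVec p))
    ((h.tendsto_evalVec_interpLaw hδ I p).mono_left hU)

end IsAsympGaussian

/-! ### The Brownian bridge -/

/-- The centred continuous Gaussian process on the cube with the covariance of the Brownian
bridge. -/
theorem isBrownianBridgeLaw_of_map_eq_gaussVec {l : ℕ} {F : (Fin l → ℝ) → ℝ}
    {κ : Cube l → Cube l → ℝ} (hκ : ∀ x y : Cube l, κ x y = F ((x : Fin l → ℝ) ⊓ y) - F x * F y)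
    (hpos : ∀ (ι : Type) [Fintype ι] (p : ι → Cube l),
      (Matrix.of fun i j => κ (p i) (p j)).PosSemidef)
    {ν : ProbabilityMeasure C(Cube l, ℝ)} (hν : ∀ (ι : Type) [Fintype ι] [DecidableEq ι]
      (p : ι → Cube l), ν.map (continuous_evalVec p).aemeasurable = gaussVec κ p) :
    IsBrownianBridgeLaw F (ν : Measure C(Cube l, ℝ)) := by
  classical
  have hmap : ∀ (ι : Type) [Fintype ι] [DecidableEq ι] (p : ι → Cube l),
      (ν : Measure C(Cube l, ℝ)).map (evalVec p) =
        multivariateGaussian 0 (Matrix.of fun i j => κ (p i) (p j)) := by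
    intro ι _ _ p
    have := congrArg (fun ρ : ProbabilityMeasure (EuclideanSpace ℝ ι) =>
      (ρ : Measure (EuclideanSpace ℝ ι))) (hν ι p)
    simpa only [ProbabilityMeasure.toMeasure_map, gaussVec, ProbabilityMeasure.coe_mk] using this
  refine ⟨⟨fun I => ⟨?_⟩⟩, fun x => ?_, fun x y => ?_⟩
  · let Φ : EuclideanSpace ℝ I →L[ℝ] (I → ℝ) :=
      (PiLp.continuousLinearEquiv 2 ℝ (fun _ : I => ℝ)).toContinuousLinearMap
    have h1 : (fun w : C(Cube l, ℝ) => I.restrict fun x => w x) =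
        Φ ∘ evalVec (fun i : I => (i : Cube l)) := by
      funext w; ext i; rfl
    rw [h1, ← Measure.map_map Φ.continuous.measurable (continuous_evalVec _).measurable, hmap]
    exact isGaussian_map Φ
  · have h1 : ∫ w, w x ∂(ν : Measure C(Cube l, ℝ)) =
        ∫ v, v (0 : Fin 1) ∂((ν : Measure C(Cube l, ℝ)).map (evalVec fun _ : Fin 1 => x)) := by
      rw [integral_map (continuous_evalVec _).aemeasurable (by fun_prop)]
      rfl
    rw [h1, hmap]
    have h2 := (EuclideanSpace.proj (𝕜 := ℝ) (0 : Fin 1)).integral_comp_comm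
      (μ := multivariateGaussian 0 (Matrix.of fun _ _ : Fin 1 => κ x x))
      (φ := fun v => v) IsGaussian.integrable_id
    rw [integral_id_multivariateGaussian] at h2
    simpa using h2
  · have h1 : covariance (fun w : C(Cube l, ℝ) => w x) (fun w => w y) ν =
        covariance (fun v : EuclideanSpace ℝ (Fin 2) => v 0) (fun v => v 1)
          ((ν : Measure C(Cube l, ℝ)).map (evalVec ![x, y])) := by
      rw [covariance_map_fun (by fun_prop) (by fun_prop) (continuous_evalVec _).aemeasurable]
      rfl
    rw [h1, hmap, covariance_eval_multivariateGaussian (hpos _ _)]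
    exact hκ x y

/-! ### Weak convergence in path spaces -/

namespace PathSpace

variable {l : ℕ} {D : Type*} [MetricSpace D] (S : PathSpace l D)

theorem continuous_ofContinuous : Continuous S.ofContinuous := by
  refine continuous_iff_seqContinuous.2 fun u w hu => S.tendsto_of_uniform _ _ ?_
  have h := ContinuousMap.tendsto_iff_tendstoUniformly.1 hu
  have e : ∀ g : C(Cube l, ℝ), S.toFun (S.ofContinuous g) = g :=
    fun g => funext (S.toFun_ofContinuous g)
  simp only [e, Function.comp_apply]
  exact h

variable [MeasurableSpace D] [BorelSpace D] {Ω : Type*} [MeasurableSpace Ω] {P : Measure Ω}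
  [IsProbabilityMeasure P] {V : ℕ → Ω → Cube l → ℝ} {κ : Cube l → Cube l → ℝ}

/-- The continuous functions within uniform distance `ε` of the set `A`. -/
def uniformThickening (A : Set D) (ε : ℝ) : Set C(Cube l, ℝ) :=
  {w | ∃ d ∈ A, ∀ x, |S.toFun d x - w x| ≤ ε}

/-- Along a subsequence, elements of `A` converge uniformly to `w`, hence in `D`, and `A` is closed
there. -/
theorem mem_of_frequently_mem_closure_uniformThickening {A : Set D} (hA : IsClosed A)
    {ε : ℕ → ℝ} (hε0 : ∀ j, 0 < ε j) (hε : Tendsto ε atTop (𝓝 0)) {u : ℕ → C(Cube l, ℝ)}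
    {w : C(Cube l, ℝ)} (hu : Tendsto u atTop (𝓝 w))
    (h : ∃ᶠ j in atTop, u j ∈ closure (S.uniformThickening A (ε j))) :
    S.ofContinuous w ∈ A := by
  obtain ⟨φ, hφ, hmem⟩ := extraction_of_frequently_atTop h
  have hd : ∀ j, ∃ d ∈ A, ∀ x, |S.toFun d x - u (φ j) x| ≤ 2 * ε (φ j) := by
    intro j
    obtain ⟨v, ⟨d, hdA, hd⟩, hv⟩ := Metric.mem_closure_iff.1 (hmem j) (ε (φ j)) (hε0 _)
    refine ⟨d, hdA, fun x => ?_⟩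
    have h1 := hd x
    have h2 : |v x - u (φ j) x| ≤ ε (φ j) := by
      have := (ContinuousMap.dist_apply_le_dist (f := u (φ j)) (g := v) x).trans hv.le
      rwa [dist_comm, Real.dist_eq] at this
    calc |S.toFun d x - u (φ j) x| ≤ |S.toFun d x - v x| + |v x - u (φ j) x| := abs_sub_le _ _ _
      _ ≤ 2 * ε (φ j) := by linarith
  choose d hdA hd using hd
  refine hA.mem_of_tendsto (S.tendsto_of_uniform d (S.ofContinuous w) ?_)
    (Eventually.of_forall hdA)
  have hu' := ContinuousMap.tendsto_iff_tendstoUniformly.1 (hu.comp hφ.tendsto_atTop)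
  rw [Metric.tendstoUniformly_iff] at hu' ⊢
  intro η hη
  have hεφ := ((hε.comp hφ.tendsto_atTop).const_mul 2)
  rw [mul_zero] at hεφ
  filter_upwards [hu' (η / 2) (by positivity), hεφ.eventually (gt_mem_nhds (half_pos hη))]
    with j h1 h2 x
  rw [S.toFun_ofContinuous]
  have h3 := h1 x
  have h4 := hd j x
  simp only [Function.comp_apply] at h2 h3
  rw [dist_comm] at h3 ⊢
  rw [Real.dist_eq] at h3 ⊢
  calc |S.toFun (d j) x - w x| ≤ |S.toFun (d j) x - u (φ j) x| + |u (φ j) x - w x| :=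
        abs_sub_le _ _ _
    _ < η := by linarith

/-- Outside the oscillation event, a path in `A` is within `ε` of its interpolation, so membership
in `A` forces a closed condition on finitely many values, to which the portmanteau theorem applies.
The closure is taken for that purpose. -/
theorem limsup_measure_le (h : IsAsympGaussian P V κ) {ν : ProbabilityMeasure C(Cube l, ℝ)}
    (hν : ∀ (ι : Type) [Fintype ι] [DecidableEq ι]
      (p : ι → Cube l), ν.map (continuous_evalVec p).aemeasurable = gaussVec κ p)
    {Y : ℕ → Ω → D} (hY : ∀ n, S.Represents P (Y n) (V n)) {A : Set D} {ε : ℝ}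
    {δ : ℝ} (hmod : ∀ᶠ n in atTop,
      P {ω | ∃ x y : Cube l, dist x y ≤ δ ∧ ε < |V n ω x - V n ω y|} ≤ ENNReal.ofReal ε)
    (I : Interpolation (Cube l) δ) :
    limsup (fun n => P (Y n ⁻¹' A)) atTop ≤ ENNReal.ofReal ε +
      (ν : Measure C(Cube l, ℝ)) {w | I.approx w ∈ closure (S.uniformThickening A ε)} := by
  set C := closure (S.uniformThickening A ε)
  have hC : IsClosed (I.op ⁻¹' C) := isClosed_closure.preimage I.continuous_op
  have h1 : ∀ᶠ n in atTop, P (Y n ⁻¹' A) ≤ ENNReal.ofReal ε +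
      (h.valueLaw I.node n : Measure _) (I.op ⁻¹' C) := by
    filter_upwards [hmod] with n hn
    have hval : (h.valueLaw I.node n : Measure _) (I.op ⁻¹' C) =
        P {ω | I.approx (V n ω) ∈ C} := by
      rw [IsAsympGaussian.valueLaw, ProbabilityMeasure.coe_mk,
        Measure.map_apply_of_aemeasurable (h.aemeasurable_toLp I.node n) hC.measurableSet]
      rfl
    rw [hval]
    refine le_trans ?_ ((measure_union_le _ _).trans (add_le_add_left hn _))
    refine measure_mono_ae ?_
    filter_upwards [(hY n).toFun_eq] with ω hω hA
    by_contra hcon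
    have hcon : ¬(ω ∈ _ ∨ ω ∈ _) := hcon
    rw [not_or] at hcon
    refine hcon.2 (subset_closure ⟨Y n ω, hA, fun x => ?_⟩)
    rw [hω, abs_sub_comm]
    refine I.abs_approx_sub_le (fun y z hyz => ?_) x
    by_contra hlt
    exact hcon.1 ⟨y, z, hyz, not_le.1 hlt⟩
  refine (limsup_le_limsup h1).trans ?_
  have h2 : limsup (fun n => (h.valueLaw I.node n : Measure _) (I.op ⁻¹' C)) atTop ≤
      (ν : Measure C(Cube l, ℝ)) {w | I.approx w ∈ C} := by
    refine (ProbabilityMeasure.limsup_measure_closed_le_of_tendsto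
      (h.tendsto_valueLaw I.node) hC).trans (le_of_eq ?_)
    rw [← hν, ProbabilityMeasure.toMeasure_map,
      Measure.map_apply (continuous_evalVec _).measurable hC.measurableSet]
    rfl
  rw [limsup_const_add atTop _ _ (by isBoundedDefault) (by isBoundedDefault)]
  exact add_le_add le_rfl h2

/-- Random elements of the path space representing asymptotically Gaussian, asymptotically
equicontinuous random functions converge in distribution. -/
theorem tendstoInDistribution (h : IsAsympGaussian P V κ) {ν : ProbabilityMeasure C(Cube l, ℝ)}
    (hν : ∀ (ι : Type) [Fintype ι] [DecidableEq ι]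
      (p : ι → Cube l), ν.map (continuous_evalVec p).aemeasurable = gaussVec κ p)
    {Y : ℕ → Ω → D} (hY : ∀ n, S.Represents P (Y n) (V n)) :
    TendstoInDistribution Y atTop S.ofContinuous (fun _ => P) (ν : Measure C(Cube l, ℝ)) := by
  refine ⟨fun n => (hY n).aemeasurable, S.continuous_ofContinuous.aemeasurable, ?_⟩
  refine tendsto_of_forall_isClosed_limsup_le' fun A hA => ?_
  simp only [ProbabilityMeasure.coe_mk]
  rw [Measure.map_apply S.continuous_ofContinuous.measurable hA.measurableSet]
  have e : ∀ n, P.map (Y n) A = P (Y n ⁻¹' A) := fun n =>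
    Measure.map_apply_of_aemeasurable (hY n).aemeasurable hA.measurableSet
  simp only [e]
  set ε : ℕ → ℝ := fun j => 1 / ((j : ℝ) + 1)
  have hε0 : ∀ j, 0 < ε j := fun j => by positivity
  have hε : Tendsto ε atTop (𝓝 0) := tendsto_one_div_add_atTop_nhds_zero_nat
  choose δ hδ0 hδ using fun j => h.modulus (ε j) (hε0 j)
  set δ' : ℕ → ℝ := fun j => min (δ j) (ε j)
  have hδ'0 : ∀ j, 0 < δ' j := fun j => lt_min (hδ0 j) (hε0 j)
  have hδ' : Tendsto δ' atTop (𝓝 0) :=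
    squeeze_zero (fun j => (hδ'0 j).le) (fun j => min_le_right _ _) hε
  have I : (j : ℕ) → Interpolation (Cube l) (δ' j) := fun j =>
    (Interpolation.nonempty_of_pos (hδ'0 j)).some
  -- A path lying in infinitely many of these events is a limit of its own interpolations, each
  -- close to `A`, so it belongs to `A`. The upper bound is therefore the limit-measure of the
  -- limsup of the `E j`.
  set E : ℕ → Set C(Cube l, ℝ) :=
    fun j => {w | (I j).approx w ∈ closure (S.uniformThickening A (ε j))}
  have hE : ∀ j, MeasurableSet (E j) := fun j =>
    (isClosed_closure.preimage (I j).continuous_approx).measurableSet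
  have hB : Tendsto (fun N => (ν : Measure C(Cube l, ℝ)) (⋃ j, ⋃ _ : N ≤ j, E j)) atTop
      (𝓝 ((ν : Measure C(Cube l, ℝ)) (⋂ N, ⋃ j, ⋃ _ : N ≤ j, E j))) := by
    refine tendsto_measure_iInter_atTop (fun N => (MeasurableSet.iUnion fun j =>
      MeasurableSet.iUnion fun _ => hE j).nullMeasurableSet) ?_ ⟨0, measure_ne_top _ _⟩
    exact fun a b hab => Set.iUnion_mono fun j => Set.iUnion_mono' fun hb => ⟨hab.trans hb, le_rfl⟩
  have hsum : Tendsto (fun N => ENNReal.ofReal (ε N) +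
      (ν : Measure C(Cube l, ℝ)) (⋃ j, ⋃ _ : N ≤ j, E j)) atTop
      (𝓝 (0 + (ν : Measure C(Cube l, ℝ)) (⋂ N, ⋃ j, ⋃ _ : N ≤ j, E j))) := by
    refine Tendsto.add ?_ hB
    have := (ENNReal.continuous_ofReal.tendsto 0).comp hε
    rwa [ENNReal.ofReal_zero] at this
  rw [zero_add] at hsum
  refine (ge_of_tendsto' hsum fun N => ?_).trans (measure_mono ?_)
  · refine (S.limsup_measure_le h hν hY (ε := ε N) ?_ (I N)).trans ?_
    · refine (hδ N).mono fun n hn => (measure_mono ?_).trans hn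
      rintro ω ⟨x, y, hxy, hlt⟩
      exact ⟨x, y, hxy.trans (min_le_left _ _), hlt⟩
    · exact add_le_add le_rfl (measure_mono fun w hw => Set.mem_iUnion₂.2 ⟨N, le_rfl, hw⟩)
  · intro w hw
    refine S.mem_of_frequently_mem_closure_uniformThickening hA hε0 hε
      (Interpolation.tendsto_approx hδ' I w) (frequently_atTop.2 fun N => ?_)
    obtain ⟨j, hj, hjw⟩ := Set.mem_iUnion₂.1 (Set.mem_iInter.1 hw N)
    exact ⟨j, hj, hjw⟩

end PathSpace

/-! ### Empirical processes of arrays with a small deterministic drift -/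

section Array

variable {Ω : Type*} [MeasurableSpace Ω] {l : ℕ} {P : Measure Ω} [IsProbabilityMeasure P]
  {k : ℕ → ℕ} {ξ : (n : ℕ) → Fin (k n) → Ω → Fin l → ℝ} {μ : ℕ → Measure (Fin l → ℝ)}
  {μ₀ : Measure (Fin l → ℝ)}

theorem measurable_normalizedDF {k : ℕ} (ν : Measure (Fin l → ℝ)) {ζ : Fin k → Ω → Fin l → ℝ}
    (hζ : ∀ j, Measurable (ζ j)) (x : Cube l) :
    Measurable fun ω => normalizedDF ν (fun j => ζ j ω) x := by
  unfold normalizedDF empiricalDF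
  exact (((Finset.measurable_sum _ fun j _ => (measurable_boxInd x).comp (hζ j)).const_mul
    _).sub_const _).const_mul _

theorem IsSampleArray.continuous_bridgeCov (h : IsSampleArray P k ξ μ μ₀) :
    Continuous fun z : Cube l × Cube l => bridgeCov μ₀ z.1 z.2 := by
  have h1 : Continuous fun z : Cube l × Cube l => (⟨(z.1 : Fin l → ℝ) ⊓ z.2,
      le_inf z.1.2.1 z.2.2.1, inf_le_left.trans z.1.2.2⟩ : Cube l) :=
    Continuous.subtype_mk (continuous_pi fun i => by
      have h2 : Continuous fun x : Cube l => (x : Fin l → ℝ) i :=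
        (continuous_apply i).comp continuous_subtype_val
      exact (h2.comp continuous_fst).min (h2.comp continuous_snd)) _
  exact (h.continuous.comp h1).sub
    ((h.continuous.comp continuous_fst).mul (h.continuous.comp continuous_snd))

/-- The normalized distribution functions of an array of samples, with a uniformly negligible
drift, are asymptotically Gaussian. -/
theorem IsSampleArray.isAsympGaussian (h : IsSampleArray P k ξ μ μ₀) {b : ℕ → Cube l → ℝ}
    (hb : ∀ ε : ℝ, 0 < ε → ∀ᶠ n in atTop, ∀ x, |b n x| ≤ ε) :
    IsAsympGaussian P (fun n ω x => normalizedDF (μ n) (fun j => ξ n j ω) x + b n x)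
      (bridgeCov μ₀) where
  aemeasurable n x := ((measurable_normalizedDF _ (h.measurable n) x).add_const _).aemeasurable
  symm x y := by rw [bridgeCov, bridgeCov, inf_comm, mul_comm]
  nonneg ι _ p t := by
    have := h.prob_limit
    rw [← integral_boxComb_sq]
    exact integral_nonneg fun e => sq_nonneg _
  continuous := h.continuous_bridgeCov
  charFun ι _ p t := by
    have hb' : ∀ x, Tendsto (fun n => b n x) atTop (𝓝 0) := fun x => by
      rw [Metric.tendsto_nhds]
      intro ε hε
      filter_upwards [hb (ε / 2) (by positivity)] with n hn
      rw [Real.dist_eq, sub_zero]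
      exact (hn x).trans_lt (half_lt_self hε)
    -- The drift is deterministic, so it enters the characteristic function only as a factor tending
    -- to 1.
    have hdrift : Tendsto (fun n => Complex.exp ((∑ i, t i * b n (p i) : ℝ) * Complex.I)) atTop
        (𝓝 1) := by
      have h0 : Tendsto (fun n => ∑ i, t i * b n (p i)) atTop (𝓝 0) := by
        have := tendsto_finsetSum (Finset.univ : Finset ι)
          fun i _ => (hb' (p i)).const_mul (t i)
        simpa using this
      have hc : Continuous fun r : ℝ => Complex.exp ((r : ℂ) * Complex.I) := by fun_prop
      have := (hc.tendsto 0).comp h0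
      rwa [Complex.ofReal_zero, zero_mul, Complex.exp_zero] at this
    have := (h.tendsto_charFun p t).mul hdrift
    rw [mul_one] at this
    refine this.congr fun n => ?_
    rw [← integral_mul_const]
    refine integral_congr_ae (ae_of_all _ fun ω => ?_)
    simp only
    rw [← Complex.exp_add, ← add_mul, ← Complex.ofReal_add, ← Finset.sum_add_distrib]
    simp_rw [mul_add]
  modulus ε hε := by
    obtain ⟨δ, hδ, hmod⟩ := h.exists_modulus (ε := ε / 3) (by positivity)
    refine ⟨δ, hδ, ?_⟩
    filter_upwards [hmod, hb (ε / 3) (by positivity)] with n hn hbn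
    refine ((measure_mono ?_).trans hn).trans (ENNReal.ofReal_le_ofReal (by linarith))
    rintro ω ⟨x, y, hxy, hlt⟩
    refine ⟨x, y, hxy, ?_⟩
    have h1 := hbn x
    have h2 := hbn y
    by_contra hcon
    rw [not_lt] at hcon
    refine absurd hlt (not_lt.2 ?_)
    rw [abs_le] at *
    constructor <;> linarith

end Array

/-! ### Homogeneous and ergodic fields -/

/-- The shift of functions on an additive monoid. -/
def shiftPath {E S : Type*} [Add E] (s : E) (x : E → S) : E → S := fun t => x (t + s)

theorem measurable_shiftPath {E S : Type*} [Add E] [MeasurableSpace S] (s : E) :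
    Measurable (shiftPath s : (E → S) → E → S) :=
  measurable_pi_lambda _ fun t => measurable_pi_apply (t + s)

/-- The law of the sample functions of a random field. -/
noncomputable def pathLaw {E Ω S : Type*} [MeasurableSpace Ω] [MeasurableSpace S]
    (X : E → Ω → S) (P : Measure Ω) : Measure (E → S) :=
  P.map fun ω t => X t ω

section Field

variable {E Ω S : Type*} [AddCommGroup E] [MeasurableSpace Ω] [MeasurableSpace S]
  {X : E → Ω → S} {P : Measure Ω} [IsProbabilityMeasure P]

theorem isProbabilityMeasure_pathLaw (hX : ∀ t, Measurable (X t)) :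
    IsProbabilityMeasure (pathLaw X P) :=
  Measure.isProbabilityMeasure_map (measurable_pi_lambda _ hX).aemeasurable

theorem IsHomogeneousField.measurePreserving_shiftPath (h : IsHomogeneousField X P)
    (hX : ∀ t, Measurable (X t)) (s : E) :
    MeasurePreserving (shiftPath s) (pathLaw X P) (pathLaw X P) := by
  have hX' : Measurable fun ω t => X t ω := measurable_pi_lambda _ hX
  have := isProbabilityMeasure_pathLaw (P := P) hX
  refine ⟨measurable_shiftPath s, ?_⟩
  have : IsProbabilityMeasure ((pathLaw X P).map (shiftPath s)) :=
    Measure.isProbabilityMeasure_map (measurable_shiftPath s).aemeasurable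
  refine ext_of_generate_finite _ generateFrom_squareCylinders.symm
    (isPiSystem_squareCylinders (fun _ => MeasurableSpace.isPiSystem_measurableSet)
      fun _ => MeasurableSet.univ) ?_ (by simp)
  rintro _ ⟨I, A, hA, rfl⟩
  have hA' : ∀ t, MeasurableSet (A t) := fun t => hA t (Set.mem_univ t)
  have hcyl : MeasurableSet ((I : Set E).pi A) :=
    MeasurableSet.pi I.countable_toSet fun t _ => hA' t
  rw [Measure.map_apply (measurable_shiftPath s) hcyl, pathLaw,
    Measure.map_apply hX' (measurable_shiftPath s hcyl), Measure.map_apply hX' hcyl]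
  have hk := h I.card (fun i => (I.equivFin.symm i : E)) s
    (fun i => A (I.equivFin.symm i : E)) fun i => hA' _
  have e : ∀ p : E → Prop, (∀ i : Fin I.card, p (I.equivFin.symm i : E)) ↔ ∀ t ∈ I, p t :=
    fun p => ⟨fun hp t ht => by simpa using hp (I.equivFin ⟨t, ht⟩), fun hp i => hp _ (Subtype.prop _)⟩
  convert hk using 2
  · ext ω
    exact (e fun t => X (t + s) ω ∈ A t).symm
  · ext ω
    exact (e fun t => X t ω ∈ A t).symm

/-- Shift-invariant functions of an ergodic field are constant. -/
theorem IsErgodicField.ae_eq_const (h : IsErgodicField X P) (hX : ∀ t, Measurable (X t))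
    {g : (E → S) → ℝ} (hg : Measurable g)
    (hinv : ∀ s, g ∘ shiftPath s =ᵐ[pathLaw X P] g) :
    ∃ c, g =ᵐ[pathLaw X P] Function.const _ c := by
  have hX' : Measurable fun ω t => X t ω := measurable_pi_lambda _ hX
  have := isProbabilityMeasure_pathLaw (P := P) hX
  -- All Borel preimages have probability 0 or 1, and countably many Borel sets separate the reals.
  refine exists_eventuallyEq_const_of_forall_separating MeasurableSet fun U hU => ?_
  have hΛ : MeasurableSet (g ⁻¹' U) := hg hU
  have hP : P {ω | (fun t => X t ω) ∈ g ⁻¹' U} = pathLaw X P (g ⁻¹' U) := by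
    rw [pathLaw, Measure.map_apply hX' hΛ]; rfl
  have h01 := h (g ⁻¹' U) hΛ fun s => by
    have h1 := ae_of_ae_map hX'.aemeasurable (hinv s)
    change ∀ᵐ ω ∂P, _
    filter_upwards [h1] with ω hω
    have hω : g (fun t => X (t + s) ω) = g (fun t => X t ω) := hω
    rw [Set.mem_preimage, Set.mem_preimage, hω]
  rw [hP] at h01
  rcases h01 with h0 | h1
  · exact Or.inr (measure_eq_zero_iff_ae_notMem.1 h0)
  · exact Or.inl ((mem_ae_iff_prob_eq_one hΛ).2 h1)

/-- A bounded function of an ergodic field is approximated by a constant and a linear combination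
of differences of its shifts. -/
theorem exists_shift_approx (hhom : IsHomogeneousField X P) (herg : IsErgodicField X P)
    (hX : ∀ t, Measurable (X t)) {φ : S → ℝ} (hφ : Measurable φ) (hφ1 : ∀ y, |φ y| ≤ 1) :
    ∃ c₀ : ℝ, ∀ ε : ℝ, 0 < ε → ∃ c : E →₀ ℝ,
      ∫⁻ x, ‖φ (x 0) - c₀ - c.sum fun s a => a * (φ (x s) - φ (x 0))‖ₑ ∂(pathLaw X P) ≤
        ENNReal.ofReal ε := by
  set Q := pathLaw X P
  have := isProbabilityMeasure_pathLaw (P := P) hX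
  have hθ := hhom.measurePreserving_shiftPath hX
  have hmem : ∀ s, MemLp (fun x : E → S => φ (x s)) 2 Q := fun s =>
    MemLp.of_bound (hφ.comp (measurable_pi_apply s)).aestronglyMeasurable 1
      (ae_of_all _ fun x => hφ1 _)
  set f : E → Lp ℝ 2 Q := fun s => (hmem s).toLp
  set U : E → Lp ℝ 2 Q →ₗᵢ[ℝ] Lp ℝ 2 Q := fun s => Lp.compMeasurePreservingₗᵢ ℝ _ (hθ s)
  have hUf : ∀ s t, U s (f t) = f (t + s) := fun s t => by
    change Lp.compMeasurePreserving _ (hθ s) ((hmem t).toLp) = _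
    rw [Lp.toLp_compMeasurePreserving]
    rfl
  -- Von Neumann's argument for an arbitrary group of shifts: project `f 0` off the closed span of
  -- the differences, which the shifts preserve.
  set N₀ := Submodule.span ℝ (Set.range fun s => f s - f 0)
  set N := N₀.topologicalClosure
  have : N.HasOrthogonalProjection := by
    have : CompleteSpace N := N₀.isClosed_topologicalClosure.completeSpace_coe
    infer_instance
  have hfN : ∀ s, f s - f 0 ∈ N := fun s =>
    N₀.le_topologicalClosure (Submodule.subset_span ⟨s, rfl⟩)
  have hUN : ∀ s, ∀ v ∈ N, U s v ∈ N := by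
    intro s
    have h0 : N₀ ≤ N.comap (U s).toLinearMap := by
      refine Submodule.span_le.2 ?_
      rintro _ ⟨t, rfl⟩
      change U s (f t - f 0) ∈ N
      rw [map_sub, hUf, hUf]
      have := N.sub_mem (hfN (t + s)) (hfN (0 + s))
      rwa [sub_sub_sub_cancel_right] at this
    have hcl : IsClosed ((N.comap (U s).toLinearMap : Submodule ℝ _) : Set (Lp ℝ 2 Q)) :=
      N₀.isClosed_topologicalClosure.preimage (U s).continuous
    exact fun v hv => N₀.topologicalClosure_minimal h0 hcl hv
  set a := N.starProjection (f 0)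
  have ha : a ∈ N := Submodule.starProjection_apply_mem _ _
  set g := f 0 - a
  have hg : g ∈ Nᗮ := Submodule.sub_starProjection_mem_orthogonal _
  -- The increment $U_sg-g$ lies in `N`, hence is orthogonal to `g`; as $U_s$ is an isometry,
  -- Pythagoras makes it vanish.
  have hinv : ∀ s, U s g = g := by
    intro s
    have hd : U s g - g ∈ N := by
      have : U s g - g = (f (0 + s) - f 0) - (U s a - a) := by
        simp only [g, map_sub, hUf]; abel
      rw [this]
      exact N.sub_mem (hfN _) (N.sub_mem (hUN s a ha) ha)
    have hin : inner ℝ g (U s g - g) = 0 := by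
      rw [real_inner_comm]; exact hg _ hd
    have := norm_add_sq_eq_norm_sq_add_norm_sq_real hin
    rw [add_sub_cancel, (U s).norm_map] at this
    have h0 : ‖U s g - g‖ * ‖U s g - g‖ = 0 := by linarith
    exact sub_eq_zero.1 (norm_eq_zero.1 (mul_self_eq_zero.1 h0))
  -- the invariant part is constant
  have hgm := Lp.aestronglyMeasurable g
  obtain ⟨c₀, hc₀⟩ : ∃ c₀ : ℝ, (g : (E → S) → ℝ) =ᵐ[Q] Function.const _ c₀ := by
    obtain ⟨c₀, hc₀⟩ := herg.ae_eq_const hX (g := hgm.mk g)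
      hgm.stronglyMeasurable_mk.measurable fun s => by
        have h1 : (g : (E → S) → ℝ) ∘ shiftPath s =ᵐ[Q] g := by
          have := Lp.coeFn_compMeasurePreserving g (hθ s)
          have h2 : Lp.compMeasurePreserving _ (hθ s) g = g := hinv s
          rw [h2] at this
          exact this.symm
        have h2 := (hθ s).quasiMeasurePreserving.ae_eq_comp hgm.ae_eq_mk
        exact h2.symm.trans (h1.trans hgm.ae_eq_mk)
    exact ⟨c₀, hgm.ae_eq_mk.trans hc₀⟩
  refine ⟨c₀, fun ε hε => ?_⟩
  obtain ⟨b, hb, hab⟩ := Metric.mem_closure_iff.1 (show a ∈ closure (N₀ : Set (Lp ℝ 2 Q)) from ha)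
    ε hε
  obtain ⟨c, rfl⟩ := Finsupp.mem_span_range_iff_exists_finsupp.1 hb
  refine ⟨c, ?_⟩
  set R : (E → S) → ℝ := fun x => φ (x 0) - c₀ - c.sum fun s a => a * (φ (x s) - φ (x 0))
  have hR : R =ᵐ[Q] (a - c.sum fun s r => r • (f s - f 0) : Lp ℝ 2 Q) := by
    have h1 : ∀ᵐ x ∂Q, ∀ s ∈ c.support, f s x = φ (x s) :=
      (ae_ball_iff c.support.countable_toSet).2 fun s _ => (hmem s).coeFn_toLp
    have h2 : ((c.sum fun s r => r • (f s - f 0) : Lp ℝ 2 Q) : (E → S) → ℝ) =ᵐ[Q]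
        fun x => ∑ s ∈ c.support, c s * (f s x - f 0 x) := by
      rw [Finsupp.sum]
      refine (Lp.coeFn_finsetSum _ _).trans ?_
      have : ∀ᵐ x ∂Q, ∀ s ∈ c.support, (c s • (f s - f 0) : Lp ℝ 2 Q) x =
          c s * (f s x - f 0 x) := by
        refine (ae_ball_iff c.support.countable_toSet).2 fun s _ => ?_
        filter_upwards [Lp.coeFn_smul (c s) (f s - f 0), Lp.coeFn_sub (f s) (f 0)] with x h3 h4
        rw [h3, Pi.smul_apply, h4]; rfl
      filter_upwards [this] with x hx
      rw [Finset.sum_apply]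
      exact Finset.sum_congr rfl hx
    have h3 : (g : (E → S) → ℝ) =ᵐ[Q] fun x => f 0 x - a x := Lp.coeFn_sub _ _
    filter_upwards [h1, (hmem 0).coeFn_toLp, h2, h3, hc₀, Lp.coeFn_sub a (c.sum fun s r => r • (f s - f 0))]
      with x h1 h0 h2 h3 h4 h5
    rw [h5, Pi.sub_apply, h2]
    rw [h4, Function.const_apply] at h3
    simp only [R, Finsupp.sum]
    rw [h3, show f 0 x = φ (x 0) from h0]
    rw [sub_sub_cancel]
    congr 1
    refine Finset.sum_congr rfl fun s hs => ?_
    rw [h1 s hs]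
  -- On a probability space the $L^1$ norm is bounded by the $L^2$ norm, in which the approximation
  -- was made.
  have h1 : ∫⁻ x, ‖R x‖ₑ ∂Q = eLpNorm R 1 Q := eLpNorm_one_eq_lintegral_enorm.symm
  rw [h1, eLpNorm_congr_ae hR]
  refine (eLpNorm_le_eLpNorm_of_exponent_le (q := 2) (by norm_num)
    (Lp.aestronglyMeasurable _)).trans ?_
  rw [dist_eq_norm, Lp.norm_def] at hab
  rw [← ENNReal.ofReal_toReal (Lp.eLpNorm_ne_top _)]
  exact ENNReal.ofReal_le_ofReal hab.le

end Field

/-! ### The mean ergodic theorem for averages over convex sets -/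

/-- Shift differences have mean zero, so integrating the approximation identifies the constant. -/
theorem exists_shift_approx_integral {E Ω S : Type*} [AddCommGroup E] [MeasurableSpace Ω]
    [MeasurableSpace S] {X : E → Ω → S} {P : Measure Ω} [IsProbabilityMeasure P]
    (hhom : IsHomogeneousField X P) (herg : IsErgodicField X P) (hX : ∀ t, Measurable (X t))
    {φ : S → ℝ} (hφ : Measurable φ) (hφ1 : ∀ y, |φ y| ≤ 1) {ε : ℝ} (hε : 0 < ε) :
    ∃ c : E →₀ ℝ, ∫⁻ x, ‖φ (x 0) - ∫ ω, φ (X 0 ω) ∂P -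
      c.sum fun s a => a * (φ (x s) - φ (x 0))‖ₑ ∂(pathLaw X P) ≤ ENNReal.ofReal ε := by
  have hX' : Measurable fun ω t => X t ω := measurable_pi_lambda _ hX
  have := isProbabilityMeasure_pathLaw (P := P) hX
  obtain ⟨c₀, hc₀⟩ := exists_shift_approx hhom herg hX hφ hφ1
  have hint : ∀ s, Integrable (fun x : E → S => φ (x s)) (pathLaw X P) := fun s =>
    Integrable.of_bound (hφ.comp (measurable_pi_apply s)).aestronglyMeasurable 1
      (ae_of_all _ fun x => hφ1 _)
  have hmean : ∀ s, ∫ x, φ (x s) ∂(pathLaw X P) = ∫ x, φ (x 0) ∂(pathLaw X P) := by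
    intro s
    have h1 := hhom.measurePreserving_shiftPath hX s
    conv_rhs => rw [← h1.map_eq]
    have h2 : AEStronglyMeasurable (fun x : E → S => φ (x 0))
        ((pathLaw X P).map (shiftPath s)) :=
      (hφ.comp (measurable_pi_apply 0)).aestronglyMeasurable
    rw [integral_map h1.measurable.aemeasurable h2]
    simp [shiftPath]
  have h0 : ∫ ω, φ (X 0 ω) ∂P = ∫ x, φ (x 0) ∂(pathLaw X P) := by
    have h2 : AEStronglyMeasurable (fun x : E → S => φ (x 0)) (P.map fun ω t => X t ω) :=
      (hφ.comp (measurable_pi_apply 0)).aestronglyMeasurable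
    rw [pathLaw, integral_map hX'.aemeasurable h2]
  have hc : c₀ = ∫ ω, φ (X 0 ω) ∂P := by
    rw [h0]
    refine eq_of_forall_dist_le fun η hη => ?_
    obtain ⟨c, hc⟩ := hc₀ η hη
    have h2 := (enorm_integral_le_lintegral_enorm _).trans hc
    have h3 : ∀ s ∈ c.support, Integrable (fun x : E → S => c s * (φ (x s) - φ (x 0)))
        (pathLaw X P) := fun s _ => ((hint s).sub (hint 0)).const_mul _
    have h4 : ∫ x, (φ (x 0) - c₀ - c.sum fun s a => a * (φ (x s) - φ (x 0))) ∂(pathLaw X P) =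
        ∫ x, φ (x 0) ∂(pathLaw X P) - c₀ := by
      simp only [Finsupp.sum]
      have h5 : Integrable (fun x : E → S => φ (x 0) - c₀) (pathLaw X P) :=
        (hint 0).sub (integrable_const _)
      rw [integral_sub h5 (integrable_finsetSum _ h3),
        integral_sub (hint 0) (integrable_const _), integral_finsetSum _ h3,
        Finset.sum_eq_zero fun s _ => ?_]
      · simp
      · rw [integral_const_mul, integral_sub (hint s) (hint 0), hmean, sub_self, mul_zero]
    rw [h4, ← ofReal_norm, ENNReal.ofReal_le_ofReal_iff hη.le] at h2
    rwa [dist_comm, dist_eq_norm]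
  subst hc
  exact hc₀ ε hε

section VanHove

variable {E : Type*} [NormedAddCommGroup E] [NormedSpace ℝ E] [FiniteDimensional ℝ E]
  [MeasurableSpace E] [BorelSpace E] {vol : Measure E} [vol.IsAddHaarMeasure] {T : Set E}

/-- Shrink `T` towards `c` by the factor $1-\theta$. Every shrunk point may still be moved by `v`
with $\|v\|<\theta r$, because $(1-\theta)y+\theta(c+\theta^{-1}v)$ is a convex combination of
points of `T`. -/
theorem ofReal_pow_mul_measure_le_of_convex (hT : Convex ℝ T) {c s : E} {r θ : ℝ}
    (hball : Metric.ball c r ⊆ T) (hθ0 : 0 < θ) (hθ1 : θ ≤ 1) (hs : ‖s‖ < θ * r) :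
    ENNReal.ofReal ((1 - θ) ^ Module.finrank ℝ E) * vol T ≤ vol (T ∩ (· + s) ⁻¹' T) := by
  have h1 := Measure.addHaar_image_homothety vol c (1 - θ) T
  rw [abs_of_nonneg (pow_nonneg (sub_nonneg.2 hθ1) _)] at h1
  rw [← h1]
  refine measure_mono ?_
  have hr : 0 < r := by
    by_contra hr
    have := mul_nonpos_of_nonneg_of_nonpos hθ0.le (not_lt.1 hr)
    linarith [norm_nonneg s]
  rintro _ ⟨y, hy, rfl⟩
  have key : ∀ v : E, ‖v‖ < θ * r → AffineMap.homothety c (1 - θ) y + v ∈ T := by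
    intro v hv
    have h2 : c + θ⁻¹ • v ∈ T := hball (by
      rw [Metric.mem_ball, dist_eq_norm, add_sub_cancel_left, norm_smul, norm_inv,
        Real.norm_of_nonneg hθ0.le, inv_mul_lt_iff₀ hθ0]
      exact hv)
    have h3 := hT hy h2 (sub_nonneg.2 hθ1) hθ0.le (by ring)
    convert h3 using 1
    rw [AffineMap.homothety_apply, smul_add, smul_smul, mul_inv_cancel₀ hθ0.ne', one_smul]
    simp only [vsub_eq_sub, vadd_eq_add]
    module
  refine ⟨?_, key s hs⟩
  have := key 0 (by rw [norm_zero]; positivity)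
  rwa [add_zero] at this

theorem tendsto_measure_cond_preimage_add {T : ℕ → Set E} (hTmeas : ∀ n, MeasurableSet (T n))
    (hTpos : ∀ n, vol (T n) ≠ 0) (hTfin : ∀ n, vol (T n) ≠ ⊤) (hTconv : ∀ n, Convex ℝ (T n))
    {c : ℕ → E} {r : ℕ → ℝ} (hr : Tendsto r atTop atTop)
    (hball : ∀ n, Metric.ball (c n) (r n) ⊆ T n) (s : E) :
    Tendsto (fun n => (cond vol (T n)).real ((· + s) ⁻¹' T n)) atTop (𝓝 1) := by
  -- The added 1 makes $\|s\|<\theta_n r_n$ strict and keeps $\theta_n$ positive when `s = 0`.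
  set θ : ℕ → ℝ := fun n => (‖s‖ + 1) / r n
  have hθ : Tendsto θ atTop (𝓝 0) := hr.const_div_atTop _
  have hlow : Tendsto (fun n => (1 - θ n) ^ Module.finrank ℝ E) atTop (𝓝 1) := by
    have := (hθ.const_sub 1).pow (Module.finrank ℝ E)
    simpa using this
  refine tendsto_of_tendsto_of_tendsto_of_le_of_le' hlow tendsto_const_nhds ?_ ?_
  · filter_upwards [hr.eventually_gt_atTop 0, hθ.eventually (ge_mem_nhds one_pos)] with n hr0 hθ1
    have hθ0 : 0 < θ n := by positivity
    have h1 := ofReal_pow_mul_measure_le_of_convex (vol := vol) (hTconv n) (s := s) (hball n) hθ0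
      hθ1 (by simp only [θ]; rw [div_mul_cancel₀ _ hr0.ne']; linarith)
    have : IsProbabilityMeasure (cond vol (T n)) :=
      cond_isProbabilityMeasure_of_finite (hTpos n) (hTfin n)
    rw [measureReal_def, ← ENNReal.ofReal_le_iff_le_toReal (measure_ne_top _ _),
      cond_apply (hTmeas n)]
    calc ENNReal.ofReal ((1 - θ n) ^ Module.finrank ℝ E) =
        (vol (T n))⁻¹ * (ENNReal.ofReal ((1 - θ n) ^ Module.finrank ℝ E) * vol (T n)) := by
          rw [mul_comm, mul_assoc, ENNReal.mul_inv_cancel (hTpos n) (hTfin n), mul_one]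
      _ ≤ _ := by gcongr
  · refine Eventually.of_forall fun n => ?_
    have : IsProbabilityMeasure (cond vol (T n)) :=
      cond_isProbabilityMeasure_of_finite (hTpos n) (hTfin n)
    exact measureReal_le_one

/-- The translate and the original integral agree on the overlap of `T` with its shift; the two
leftover pieces have equal volume and the integrand is bounded by 1. -/
theorem abs_integral_cond_add_sub_le (hT : MeasurableSet T) (hTpos : vol T ≠ 0)
    (hTfin : vol T ≠ ⊤) {g : E → ℝ} (hg : Measurable g) (hg1 : ∀ t, |g t| ≤ 1) (s : E) :
    |∫ t, (g (t + s) - g t) ∂(cond vol T)| ≤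
      2 * (1 - (cond vol T).real ((· + s) ⁻¹' T)) := by
  set A := (· + s) ⁻¹' T
  set B := (· + -s) ⁻¹' T
  have hA : MeasurableSet A := measurable_add_const s hT
  have hB : MeasurableSet B := measurable_add_const (-s) hT
  have hgs : Measurable fun t => g (t + s) := hg.comp (measurable_add_const s)
  have hAB : A ∩ T = (· + s) ⁻¹' (T ∩ B) := by
    ext t; simp [A, B]
  have hfin : ∀ C ⊆ T, vol C < ⊤ := fun C hC => (measure_mono hC).trans_lt hTfin.lt_top
  have hon : ∀ f : E → ℝ, Measurable f → (∀ t, |f t| ≤ 1) → IntegrableOn f T vol :=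
    fun f hf hf1 => Measure.integrableOn_of_bounded hTfin hf.aestronglyMeasurable (M := 1)
      (ae_of_all _ hf1)
  have e1 : ∫ t in T, g (t + s) ∂vol =
      ∫ t in T ∩ B, g t ∂vol + ∫ t in T \ A, g (t + s) ∂vol := by
    rw [← integral_inter_add_sdiff hA (hon _ hgs fun t => hg1 _), Set.inter_comm, hAB,
      (measurePreserving_add_right vol s).setIntegral_preimage_emb
        (measurableEmbedding_addRight s)]
  have e2 := integral_inter_add_sdiff hB (hon _ hg hg1)
  have e3 : vol.real (T ∩ B) = vol.real (T ∩ A) := by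
    rw [Set.inter_comm T A, hAB, measureReal_def, measureReal_def,
      (measurePreserving_add_right vol s).measure_preimage (hT.inter hB).nullMeasurableSet]
  have e4 : |∫ t in T \ A, g (t + s) ∂vol| ≤ 1 * vol.real (T \ A) :=
    norm_setIntegral_le_of_norm_le_const (f := fun t => g (t + s)) (hfin _ Set.sdiff_subset)
      fun t _ => hg1 _
  have e5 : |∫ t in T \ B, g t ∂vol| ≤ 1 * vol.real (T \ B) :=
    norm_setIntegral_le_of_norm_le_const (f := g) (hfin _ Set.sdiff_subset) fun t _ => hg1 _
  have e6 := measureReal_inter_add_sdiff (μ := vol) (s := T) hA hTfin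
  have e7 := measureReal_inter_add_sdiff (μ := vol) (s := T) hB hTfin
  have hpos : 0 < vol.real T := ENNReal.toReal_pos hTpos hTfin
  have e8 : (cond vol T).real A = (vol.real T)⁻¹ * vol.real (T ∩ A) := by
    rw [measureReal_def, cond_apply hT, ENNReal.toReal_mul, ENNReal.toReal_inv]; rfl
  have e9 : ∫ t, (g (t + s) - g t) ∂(cond vol T) =
      (vol.real T)⁻¹ * ∫ t in T, (g (t + s) - g t) ∂vol := by
    rw [ProbabilityTheory.cond, integral_smul_measure, ENNReal.toReal_inv]; rfl
  rw [e9, e8, integral_sub (hon _ hgs fun t => hg1 _) (hon _ hg hg1), e1, ← e2, abs_mul,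
    abs_of_pos (inv_pos.2 hpos), add_sub_add_left_eq_sub, inv_mul_le_iff₀ hpos]
  have : vol.real T * (2 * (1 - (vol.real T)⁻¹ * vol.real (T ∩ A))) =
      2 * (vol.real T - vol.real (T ∩ A)) := by
    field_simp
  rw [this]
  have := abs_sub (∫ t in T \ A, g (t + s) ∂vol) (∫ t in T \ B, g t ∂vol)
  linarith

end VanHove

section ErgodicTheorem

variable {E : Type*} [NormedAddCommGroup E] [NormedSpace ℝ E] [FiniteDimensional ℝ E]
  [MeasurableSpace E] [BorelSpace E] {vol : Measure E} [vol.IsAddHaarMeasure]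
  {Ω S : Type*} [MeasurableSpace Ω] [MeasurableSpace S] {X : E → Ω → S} {P : Measure Ω}
  [IsProbabilityMeasure P]

theorem lintegral_enorm_integral_le_of_lintegral_le {ρ : Measure E} [IsProbabilityMeasure ρ]
    {f : E → Ω → ℝ} (hf : Measurable (Function.uncurry f)) {ε : ENNReal}
    (h : ∀ t, ∫⁻ ω, ‖f t ω‖ₑ ∂P ≤ ε) : ∫⁻ ω, ‖∫ t, f t ω ∂ρ‖ₑ ∂P ≤ ε := by
  calc ∫⁻ ω, ‖∫ t, f t ω ∂ρ‖ₑ ∂P ≤ ∫⁻ ω, ∫⁻ t, ‖f t ω‖ₑ ∂ρ ∂P :=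
        lintegral_mono fun ω => enorm_integral_le_lintegral_enorm _
    _ = ∫⁻ t, ∫⁻ ω, ‖f t ω‖ₑ ∂P ∂ρ :=
        lintegral_lintegral_swap (hf.comp measurable_swap).enorm.aemeasurable
    _ ≤ ∫⁻ _, ε ∂ρ := lintegral_mono h
    _ = ε := by simp

/-- The mean ergodic theorem for averages of a homogeneous ergodic field over convex sets
containing large balls. -/
theorem tendsto_lintegral_enorm_average_sub
    (hmeas : Measurable (fun p : E × Ω => X p.1 p.2)) (hhom : IsHomogeneousField X P)
    (herg : IsErgodicField X P) {T : ℕ → Set E} (hTmeas : ∀ n, MeasurableSet (T n))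
    (hTpos : ∀ n, vol (T n) ≠ 0) (hTfin : ∀ n, vol (T n) ≠ ⊤) (hTconv : ∀ n, Convex ℝ (T n))
    {c : ℕ → E} {r : ℕ → ℝ} (hr : Tendsto r atTop atTop)
    (hball : ∀ n, Metric.ball (c n) (r n) ⊆ T n) {φ : S → ℝ} (hφ : Measurable φ)
    (hφ1 : ∀ y, |φ y| ≤ 1) :
    Tendsto (fun n => ∫⁻ ω, ‖∫ t, φ (X t ω) ∂(cond vol (T n)) - ∫ ω', φ (X 0 ω') ∂P‖ₑ ∂P) atTop
      (𝓝 0) := by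
  have hX : ∀ t, Measurable (X t) := fun t => hmeas.comp measurable_prodMk_left
  have hX' : Measurable fun ω t => X t ω := measurable_pi_lambda _ hX
  have hXω : ∀ ω, Measurable fun t => X t ω := fun ω => hmeas.comp measurable_prodMk_right
  have hprob : ∀ n, IsProbabilityMeasure (cond vol (T n)) := fun n =>
    cond_isProbabilityMeasure_of_finite (hTpos n) (hTfin n)
  set M := ∫ ω', φ (X 0 ω') ∂P
  rw [ENNReal.tendsto_nhds_zero]
  intro η hη
  obtain ⟨ε, hε0, hεη⟩ : ∃ ε : ℝ, 0 < ε ∧ ENNReal.ofReal (2 * ε) ≤ η := by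
    rcases eq_or_ne η ⊤ with rfl | hη'
    · exact ⟨1, one_pos, le_top⟩
    · refine ⟨η.toReal / 2, half_pos (ENNReal.toReal_pos hη.ne' hη'), ?_⟩
      rw [mul_div_cancel₀ _ two_ne_zero, ENNReal.ofReal_toReal hη']
  obtain ⟨a, ha⟩ := exists_shift_approx_integral hhom herg hX hφ hφ1 hε0
  -- the remainder of the approximation, along the shifts
  set R : E → Ω → ℝ := fun t ω =>
    φ (X t ω) - M - ∑ s ∈ a.support, a s * (φ (X (t + s) ω) - φ (X t ω))
  have hφX : ∀ s, Measurable fun p : E × Ω => φ (X (p.1 + s) p.2) := fun s =>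
    hφ.comp (hmeas.comp ((measurable_fst.add_const s).prodMk measurable_snd))
  have hRmeas : Measurable (Function.uncurry R) :=
    ((hφ.comp hmeas).sub_const M).sub (Finset.measurable_sum _ fun s _ =>
      ((hφX s).sub (hφ.comp hmeas)).const_mul _)
  -- By homogeneity the remainder has the same $L^1$ norm at every `t`, so one approximation serves
  -- all points of `T n`.
  have hRt : ∀ t, ∫⁻ ω, ‖R t ω‖ₑ ∂P ≤ ENNReal.ofReal ε := by
    intro t
    refine le_trans (le_of_eq ?_) ha
    have hθ := hhom.measurePreserving_shiftPath hX t
    have hm : Measurable fun x : E → S => ‖φ (x 0) - M -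
        a.sum fun s b => b * (φ (x s) - φ (x 0))‖ₑ := by
      have he : ∀ s, Measurable fun x : E → S => φ (x s) := fun s =>
        hφ.comp (measurable_pi_apply s)
      exact (((he 0).sub_const M).sub (Finset.measurable_sum _ fun s _ =>
        ((he s).sub (he 0)).const_mul _)).enorm
    have hmt : Measurable fun x : E → S => ‖φ (shiftPath t x 0) - M -
        a.sum fun s b => b * (φ (shiftPath t x s) - φ (shiftPath t x 0))‖ₑ :=
      hm.comp (measurable_shiftPath t)
    rw [← hθ.lintegral_comp hm, pathLaw, lintegral_map hmt hX']
    simp only [shiftPath, R, Finsupp.sum, zero_add]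
    simp_rw [add_comm]
  have hint : ∀ (n : ℕ) (ω : Ω) (s : E),
      Integrable (fun t => φ (X (t + s) ω)) (cond vol (T n)) := fun n ω s =>
    Integrable.of_bound (hφ.comp ((hXω ω).comp (measurable_add_const s))).aestronglyMeasurable 1
      (ae_of_all _ fun x => hφ1 _)
  have hint0 : ∀ (n : ℕ) (ω : Ω), Integrable (fun t => φ (X t ω)) (cond vol (T n)) :=
    fun n ω => by simpa using hint n ω 0
  set b : ℕ → ℝ := fun n => ∑ s ∈ a.support,
    |a s| * (2 * (1 - (cond vol (T n)).real ((· + s) ⁻¹' T n)))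
  have hb : Tendsto b atTop (𝓝 0) := by
    have h1 : ∀ s ∈ a.support, Tendsto (fun n => |a s| * (2 * (1 - (cond vol (T n)).real
        ((· + s) ⁻¹' T n)))) atTop (𝓝 (|a s| * (2 * (1 - 1)))) := fun s _ =>
      (((tendsto_measure_cond_preimage_add hTmeas hTpos hTfin hTconv hr hball s).const_sub
        1).const_mul 2).const_mul _
    have := tendsto_finsetSum a.support h1
    simpa using this
  filter_upwards [hb.eventually (ge_mem_nhds hε0)] with n hn
  -- The averaged remainder is small in $L^1$, and the averaged shift differences are small for
  -- every `ω` by near-invariance of `T n`.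
  have hdecomp : ∀ ω, ∫ t, φ (X t ω) ∂(cond vol (T n)) - M = ∫ t, R t ω ∂(cond vol (T n)) +
      ∑ s ∈ a.support, a s * ∫ t, (φ (X (t + s) ω) - φ (X t ω)) ∂(cond vol (T n)) := by
    intro ω
    have h1 : ∀ s ∈ a.support, Integrable (fun t => a s * (φ (X (t + s) ω) - φ (X t ω)))
        (cond vol (T n)) := fun s _ => ((hint n ω s).sub (hint0 n ω)).const_mul _
    have h2 : Integrable (fun t => φ (X t ω) - M) (cond vol (T n)) :=
      (hint0 n ω).sub (integrable_const _)
    simp only [R]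
    rw [integral_sub h2 (integrable_finsetSum _ h1), integral_sub (hint0 n ω)
      (integrable_const _), integral_finsetSum _ h1]
    simp only [integral_const_mul]
    simp
  have hbound : ∀ ω, ‖∫ t, φ (X t ω) ∂(cond vol (T n)) - M‖ₑ ≤
      ‖∫ t, R t ω ∂(cond vol (T n))‖ₑ + ENNReal.ofReal ε := by
    intro ω
    rw [hdecomp ω]
    refine (enorm_add_le _ _).trans (add_le_add le_rfl ?_)
    rw [← ofReal_norm]
    refine ENNReal.ofReal_le_ofReal (le_trans ?_ hn)
    refine (norm_sum_le _ _).trans (Finset.sum_le_sum fun s _ => ?_)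
    rw [norm_mul]
    exact mul_le_mul_of_nonneg_left (abs_integral_cond_add_sub_le (hTmeas n) (hTpos n) (hTfin n)
      (hφ.comp (hXω ω)) (fun t => hφ1 _) s) (norm_nonneg _)
  refine (lintegral_mono hbound).trans ?_
  rw [lintegral_add_right _ measurable_const, lintegral_const, measure_univ, mul_one]
  refine (add_le_add_left (lintegral_enorm_integral_le_of_lintegral_le hRmeas hRt) _).trans ?_
  rw [← ENNReal.ofReal_add hε0.le hε0.le, ← two_mul]
  exact hεη

end ErgodicTheorem

/-! ### Pointwise convergence of distribution functions along subsequences -/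

/-- The point of the cube obtained by truncating a rational vector. -/
noncomputable def Cube.ratPoint {l : ℕ} (v : Fin l → ℚ) : Cube l :=
  ⟨fun i => max 0 (min 1 (v i : ℝ)), fun _ => le_max_left _ _,
    fun _ => max_le zero_le_one (min_le_left _ _)⟩

theorem Cube.exists_ratPoint_le {l : ℕ} (x : Cube l) {δ : ℝ} (hδ : 0 < δ) :
    ∃ v, (Cube.ratPoint v : Fin l → ℝ) ≤ x ∧ dist (Cube.ratPoint v) x < δ := by
  choose v hv1 hv2 using fun i => exists_rat_btwn (show (x : Fin l → ℝ) i - δ / 2 < x.1 i by linarith)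
  have hle : ∀ i, max 0 (min 1 (v i : ℝ)) ≤ x.1 i := fun i =>
    max_le (x.2.1 i) ((min_le_right _ _).trans (hv2 i).le)
  refine ⟨v, hle, lt_of_le_of_lt ?_ (half_lt_self hδ)⟩
  rw [Subtype.dist_eq, dist_pi_le_iff (by positivity)]
  intro i
  change dist (max 0 (min 1 (v i : ℝ))) (x.1 i) ≤ δ / 2
  rw [dist_comm, Real.dist_eq, abs_of_nonneg (sub_nonneg.2 (hle i))]
  have h1 : x.1 i - δ / 2 ≤ min 1 (v i : ℝ) :=
    le_min (by have := x.2.2 i; simp only [Pi.one_apply] at this; linarith) (hv1 i).le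
  linarith [le_max_right 0 (min 1 (v i : ℝ))]

theorem Cube.exists_le_ratPoint {l : ℕ} (x : Cube l) {δ : ℝ} (hδ : 0 < δ) :
    ∃ v, (x : Fin l → ℝ) ≤ Cube.ratPoint v ∧ dist (Cube.ratPoint v) x < δ := by
  choose v hv1 hv2 using fun i => exists_rat_btwn (show (x : Fin l → ℝ) i < x.1 i + δ / 2 by linarith)
  have hle : ∀ i, x.1 i ≤ max 0 (min 1 (v i : ℝ)) := fun i =>
    (le_min (x.2.2 i) (hv1 i).le).trans (le_max_right _ _)
  refine ⟨v, hle, lt_of_le_of_lt ?_ (half_lt_self hδ)⟩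
  rw [Subtype.dist_eq, dist_pi_le_iff (by positivity)]
  intro i
  change dist (max 0 (min 1 (v i : ℝ))) (x.1 i) ≤ δ / 2
  rw [Real.dist_eq, abs_of_nonneg (sub_nonneg.2 (hle i))]
  have h0 : 0 ≤ x.1 i := x.2.1 i
  have h1 : max 0 (min 1 (v i : ℝ)) ≤ x.1 i + δ / 2 :=
    max_le (by linarith) ((min_le_right _ _).trans (hv2 i).le)
  linarith

/-- Monotone sandwich between truncated rational points on either side of `x`, closed by continuity
of the limit. -/
theorem tendsto_measureReal_Icc_of_ratPoint {l : ℕ} {μ : ℕ → Measure (Fin l → ℝ)}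
    [∀ n, IsProbabilityMeasure (μ n)] {G : Cube l → ℝ} (hG : Continuous G)
    (h : ∀ v : Fin l → ℚ, Tendsto (fun n => (μ n).real (Set.Icc 0 (Cube.ratPoint v : Fin l → ℝ)))
      atTop (𝓝 (G (Cube.ratPoint v)))) (x : Cube l) :
    Tendsto (fun n => (μ n).real (Set.Icc 0 (x : Fin l → ℝ))) atTop (𝓝 (G x)) := by
  rw [Metric.tendsto_nhds]
  intro ε hε
  obtain ⟨δ, hδ, hGδ⟩ := Metric.continuous_iff.1 hG x (ε / 2) (by positivity)
  obtain ⟨p, hpx, hp⟩ := x.exists_ratPoint_le hδ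
  obtain ⟨q, hxq, hq⟩ := x.exists_le_ratPoint hδ
  filter_upwards [Metric.tendsto_nhds.1 (h p) (ε / 2) (by positivity),
    Metric.tendsto_nhds.1 (h q) (ε / 2) (by positivity)] with n h1 h2
  have h3 := hGδ _ hp
  have h4 := hGδ _ hq
  have h5 : (μ n).real (Set.Icc 0 (Cube.ratPoint p : Fin l → ℝ)) ≤ (μ n).real (Set.Icc 0 x.1) :=
    measureReal_mono (Set.Icc_subset_Icc le_rfl hpx)
  have h6 : (μ n).real (Set.Icc 0 x.1) ≤ (μ n).real (Set.Icc 0 (Cube.ratPoint q : Fin l → ℝ)) :=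
    measureReal_mono (Set.Icc_subset_Icc le_rfl hxq)
  rw [Real.dist_eq, abs_lt] at *
  constructor <;> linarith

/-- Countably many sequences converging in `L¹` converge almost surely along a common
subsequence. -/
theorem exists_strictMono_ae_forall_tendsto {Ω α : Type*} [MeasurableSpace Ω] {P : Measure Ω}
    [Countable α] {f : ℕ → α → Ω → ℝ} {g : α → ℝ}
    (hf : ∀ n a, AEMeasurable (f n a) P)
    (h : ∀ a, Tendsto (fun n => ∫⁻ ω, ‖f n a ω - g a‖ₑ ∂P) atTop (𝓝 0)) :
    ∃ ms : ℕ → ℕ, StrictMono ms ∧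
      ∀ᵐ ω ∂P, ∀ a, Tendsto (fun j => f (ms j) a ω) atTop (𝓝 (g a)) := by
  rcases isEmpty_or_nonempty α with hα | hα
  · exact ⟨id, strictMono_id, ae_of_all _ fun ω a => (IsEmpty.false a).elim⟩
  obtain ⟨e, he⟩ := exists_surjective_nat α
  -- Diagonal choice: the `j`-th index makes the first `j + 1` errors at most $2^{-j}$. The `i`-th
  -- sequence is controlled from index `i` on, hence the shifts by `i` below.
  obtain ⟨ms, hms, hsmall⟩ := extraction_forall_of_eventually
    (P := fun j n => ∀ i ∈ Finset.range (j + 1),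
      ∫⁻ ω, ‖f n (e i) ω - g (e i)‖ₑ ∂P ≤ (2⁻¹ : ENNReal) ^ j) (fun j => by
    rw [Filter.eventually_all_finset]
    intro i _
    exact ENNReal.tendsto_nhds_zero.1 (h (e i)) _ (ENNReal.pow_pos (by norm_num) _))
  refine ⟨ms, hms, ?_⟩
  rw [ae_all_iff]
  intro a
  obtain ⟨i, rfl⟩ := he a
  have hm : ∀ j, AEMeasurable (fun ω => ‖f (ms (j + i)) (e i) ω - g (e i)‖ₑ) P := fun j =>
    ((hf _ _).sub_const _).enorm
  have hsum : ∫⁻ ω, ∑' j, ‖f (ms (j + i)) (e i) ω - g (e i)‖ₑ ∂P ≠ ⊤ := by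
    rw [lintegral_tsum hm]
    refine ne_top_of_le_ne_top (b := ∑' j : ℕ, (2⁻¹ : ENNReal) ^ j) ?_
      (ENNReal.tsum_le_tsum fun j => ?_)
    · rw [ENNReal.tsum_geometric]; simp
    · refine (hsmall (j + i) i (Finset.mem_range.2 (by omega))).trans ?_
      exact pow_le_pow_right_of_le_one' (by norm_num) (Nat.le_add_right _ _)
  filter_upwards [ae_lt_top' (AEMeasurable.tsum hm) hsum] with ω hω
  have h0 := ENNReal.tendsto_atTop_zero_of_tsum_ne_top hω.ne
  rw [← tendsto_add_atTop_iff_nat i, tendsto_iff_enorm_sub_tendsto_zero]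
  exact h0

/-! ### From conditional to unconditional convergence -/

namespace PathSpace

variable {l : ℕ} {D : Type*} [MetricSpace D] (S : PathSpace l D) [MeasurableSpace D]
  {Ω Ω' : Type*} [MeasurableSpace Ω] [MeasurableSpace Ω'] {P : Measure Ω} {P' : Measure Ω'}
  [IsProbabilityMeasure P] [IsProbabilityMeasure P']

/-- Sections of an almost everywhere measurable map are handled through a measurable modification
and Fubini. -/
theorem Represents.ae_represents_prodMk {S : PathSpace l D} {Y : Ω × Ω' → D}
    {V : Ω × Ω' → Cube l → ℝ} (h : S.Represents (P.prod P') Y V) :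
    ∀ᵐ ω ∂P, S.Represents P' (fun ω' => Y (ω, ω')) (fun ω' => V (ω, ω')) := by
  filter_upwards [Measure.ae_ae_of_ae_prod h.aemeasurable.ae_eq_mk,
    Measure.ae_ae_of_ae_prod h.toFun_eq] with ω h1 h2
  exact ⟨⟨_, h.aemeasurable.measurable_mk.comp measurable_prodMk_left, h1⟩, h2⟩

variable [BorelSpace D]

/-- Convergence in distribution conditionally on the first coordinate, along subsequences, implies
convergence in distribution. -/
theorem tendstoInDistribution_prod {V : ℕ → Ω × Ω' → Cube l → ℝ} {κ : Cube l → Cube l → ℝ}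
    {ν : ProbabilityMeasure C(Cube l, ℝ)}
    (hν : ∀ (ι : Type) [Fintype ι] [DecidableEq ι]
      (p : ι → Cube l), ν.map (continuous_evalVec p).aemeasurable = gaussVec κ p)
    (h : ∀ ns : ℕ → ℕ, Tendsto ns atTop atTop → ∃ ms : ℕ → ℕ, ∀ᵐ ω ∂P,
      IsAsympGaussian P' (fun j ω' => V (ns (ms j)) (ω, ω')) κ)
    {Y : ℕ → Ω × Ω' → D} (hY : ∀ n, S.Represents (P.prod P') (Y n) (V n)) :
    TendstoInDistribution Y atTop S.ofContinuous (fun _ => P.prod P')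
      (ν : Measure C(Cube l, ℝ)) := by
  refine ⟨fun n => (hY n).aemeasurable, S.continuous_ofContinuous.aemeasurable, ?_⟩
  refine tendsto_of_subseq_tendsto fun ns hns => ?_
  obtain ⟨ms, hms⟩ := h ns hns
  refine ⟨ms, ?_⟩
  refine ProbabilityMeasure.tendsto_iff_forall_integral_tendsto.2 fun f => ?_
  have hf : Measurable f := f.continuous.measurable
  have e1 : ∀ n, ∫ y, f y ∂((P.prod P').map (Y n)) = ∫ ω, ∫ ω', f (Y n (ω, ω')) ∂P' ∂P := by
    intro n
    rw [integral_map (hY n).aemeasurable hf.aestronglyMeasurable, integral_prod]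
    exact Integrable.of_bound
      (hf.comp_aemeasurable (hY n).aemeasurable).aestronglyMeasurable ‖f‖
      (ae_of_all _ fun _ => f.norm_coe_le_norm _)
  have hmeas : ∀ n, AEStronglyMeasurable (fun ω => ∫ ω', f (Y n (ω, ω')) ∂P') P := fun n =>
    (hf.comp_aemeasurable (hY n).aemeasurable).aestronglyMeasurable.integral_prod_right'
  simp only [ProbabilityMeasure.coe_mk, e1]
  have e2 : ∫ y, f y ∂((ν : Measure C(Cube l, ℝ)).map S.ofContinuous) =
      ∫ _, ∫ y, f y ∂((ν : Measure C(Cube l, ℝ)).map S.ofContinuous) ∂P := by simp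
  rw [e2]
  -- The conditional expectations converge for almost every `ω` to a constant independent of `ω`,
  -- with the common bound $\|f\|$.
  refine tendsto_integral_of_dominated_convergence (fun _ => ‖f‖) (fun j => hmeas _)
    (integrable_const _) (fun j => ae_of_all _ fun ω => ?_) ?_
  · refine (norm_integral_le_of_norm_le_const (C := ‖f‖)
      (ae_of_all _ fun _ => f.norm_coe_le_norm _)).trans (le_of_eq ?_)
    simp
  · filter_upwards [hms, ae_all_iff.2 fun n => (hY n).ae_represents_prodMk] with ω h1 h2
    have h3 := (S.tendstoInDistribution h1 hν fun j => h2 (ns (ms j))).tendsto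
    refine (ProbabilityMeasure.tendsto_iff_forall_integral_tendsto.1 h3 f).congr fun j => ?_
    simp only [ProbabilityMeasure.coe_mk]
    rw [integral_map (h2 _).aemeasurable hf.aestronglyMeasurable]

end PathSpace

theorem IsSampleArray.comp {Ω : Type*} [MeasurableSpace Ω] {l : ℕ} {P : Measure Ω}
    {k : ℕ → ℕ} {ξ : (n : ℕ) → Fin (k n) → Ω → Fin l → ℝ} {μ : ℕ → Measure (Fin l → ℝ)}
    {μ₀ : Measure (Fin l → ℝ)} (h : IsSampleArray P k ξ μ μ₀) {φ : ℕ → ℕ}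
    (hφ : Tendsto φ atTop atTop) :
    IsSampleArray P (fun n => k (φ n)) (fun n => ξ (φ n)) (fun n => μ (φ n)) μ₀ where
  tendsto_card := h.tendsto_card.comp hφ
  prob _ := h.prob _
  prob_limit := h.prob_limit
  measurable _ := h.measurable _
  indep _ := h.indep _
  law _ := h.law _
  cube _ := h.cube _
  cube_limit := h.cube_limit
  tendsto x := (h.tendsto x).comp hφ
  continuous := h.continuous

/-! ### Randomly sampled fields -/

section Sampling

variable {m l : ℕ} {ΩX : Type*} [MeasurableSpace ΩX] {PX : Measure ΩX} [IsProbabilityMeasure PX]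
  {X : EuclideanSpace ℝ (Fin m) → ΩX → Fin l → ℝ}

/-- The occupation law of a field over the set `A`. -/
noncomputable def occupationLaw (X : EuclideanSpace ℝ (Fin m) → ΩX → Fin l → ℝ)
    (A : Set (EuclideanSpace ℝ (Fin m))) (ω : ΩX) : Measure (Fin l → ℝ) :=
  (cond volume A).map fun t => X t ω

theorem measurable_section (hX : Measurable fun p : EuclideanSpace ℝ (Fin m) × ΩX => X p.1 p.2)
    (ω : ΩX) : Measurable fun t => X t ω :=
  hX.comp measurable_prodMk_right

theorem integral_boxInd_cond (hX : Measurable fun p : EuclideanSpace ℝ (Fin m) × ΩX => X p.1 p.2)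
    (A : Set (EuclideanSpace ℝ (Fin m))) (ω : ΩX) (x : Cube l) :
    ∫ t, boxInd x (X t ω) ∂(cond volume A) =
      (occupationLaw X A ω).real (Set.Icc 0 (x : Fin l → ℝ)) := by
  have h := integral_map (μ := cond volume A) (measurable_section hX ω).aemeasurable
    (f := boxInd x) (measurable_boxInd x).aestronglyMeasurable
  rw [← h, boxInd, integral_indicator_one measurableSet_Icc]
  rfl

theorem meanDF_eq_measureReal (hX : Measurable fun p : EuclideanSpace ℝ (Fin m) × ΩX => X p.1 p.2)
    (A : Set (EuclideanSpace ℝ (Fin m))) (ω : ΩX) (x : Cube l) :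
    meanDF A (fun s => X s ω) x = (occupationLaw X A ω).real (Set.Icc 0 (x : Fin l → ℝ)) := by
  rw [← integral_boxInd_cond hX, meanDF, ProbabilityTheory.cond, integral_smul_measure,
    ENNReal.toReal_inv]
  rfl

theorem measureReal_map_Icc_eq_distFun (hX : Measurable (X 0))
    (hcube : ∀ᵐ ω ∂PX, ∀ i, X 0 ω i ∈ Set.Ioo (0 : ℝ) 1) {x : Fin l → ℝ} :
    (PX.map (X 0)).real (Set.Icc 0 x) = distFun PX (X 0) x := by
  rw [map_measureReal_apply hX measurableSet_Icc, distFun]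
  refine measureReal_congr ?_
  filter_upwards [hcube] with ω hω
  exact propext ⟨fun h => h.2, fun h => ⟨fun i => (hω i).1.le, h⟩⟩

theorem map_compl_Icc_eq_zero (hX : Measurable (X 0))
    (hcube : ∀ᵐ ω ∂PX, ∀ i, X 0 ω i ∈ Set.Ioo (0 : ℝ) 1) :
    PX.map (X 0) (Set.Icc 0 1)ᶜ = 0 := by
  rw [Measure.map_apply hX measurableSet_Icc.compl]
  change ∀ᵐ ω ∂PX, X 0 ω ∈ Set.Icc 0 1
  filter_upwards [hcube] with ω hω
  exact ⟨fun i => (hω i).1.le, fun i => (hω i).2.le⟩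

/-- By Fubini almost every realization stays in the cube at almost every time, so a single null set
works for all `A`. -/
theorem ae_occupationLaw_compl_Icc_eq_zero
    (hX : Measurable fun p : EuclideanSpace ℝ (Fin m) × ΩX => X p.1 p.2)
    (hcube : ∀ t, ∀ᵐ ω ∂PX, ∀ i, X t ω i ∈ Set.Ioo (0 : ℝ) 1) :
    ∀ᵐ ω ∂PX, ∀ A, occupationLaw X A ω (Set.Icc 0 1)ᶜ = 0 := by
  have hm : MeasurableSet {p : EuclideanSpace ℝ (Fin m) × ΩX |
      X p.1 p.2 ∈ Set.Icc (0 : Fin l → ℝ) 1} := hX measurableSet_Icc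
  have h1 : ∀ᵐ t ∂(volume : Measure (EuclideanSpace ℝ (Fin m))), ∀ᵐ ω ∂PX,
      X t ω ∈ Set.Icc (0 : Fin l → ℝ) 1 := by
    refine ae_of_all _ fun t => ?_
    filter_upwards [hcube t] with ω hω
    exact ⟨fun i => (hω i).1.le, fun i => (hω i).2.le⟩
  filter_upwards [(Measure.ae_ae_comm hm).1 h1] with ω hω A
  rw [occupationLaw, Measure.map_apply (measurable_section hX ω) measurableSet_Icc.compl]
  exact cond_absolutelyContinuous hω

variable {T : ℕ → Set (EuclideanSpace ℝ (Fin m))} {k : ℕ → ℕ} {Ωτ : Type*} [MeasurableSpace Ωτ]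
  {Pτ : Measure Ωτ} [IsProbabilityMeasure Pτ] {τ : (n : ℕ) → Fin (k n) → Ωτ → EuclideanSpace ℝ (Fin m)}

/-- Along a subsequence, almost every realization of a randomly sampled homogeneous ergodic field
gives an array of samples. -/
theorem exists_strictMono_ae_isSampleArray
    (hXmeas : Measurable (fun p : EuclideanSpace ℝ (Fin m) × ΩX => X p.1 p.2))
    (hXhom : IsHomogeneousField X PX) (hXerg : IsErgodicField X PX)
    (hXcube : ∀ t, ∀ᵐ ω ∂PX, ∀ i, X t ω i ∈ Set.Ioo (0 : ℝ) 1)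
    (hF : Continuous (distFun PX (X 0))) (hTmeas : ∀ n, MeasurableSet (T n))
    (hTbdd : ∀ n, Bornology.IsBounded (T n)) (hTpos : ∀ n, 0 < volume (T n))
    (hTconv : ∀ n, Convex ℝ (T n))
    (hTball : ∃ (c : ℕ → EuclideanSpace ℝ (Fin m)) (r : ℕ → ℝ),
      Tendsto r atTop atTop ∧ ∀ n, Metric.ball (c n) (r n) ⊆ T n)
    (hk : Tendsto k atTop atTop) (hτmeas : ∀ n i, Measurable (τ n i))
    (hτindep : ∀ n, iIndepFun (τ n) Pτ)
    (hτunif : ∀ n i, pdf.IsUniform (τ n i) (T n) Pτ volume) {ns : ℕ → ℕ}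
    (hns : Tendsto ns atTop atTop) :
    ∃ ms : ℕ → ℕ, StrictMono ms ∧ ∀ᵐ ω ∂PX,
      IsSampleArray Pτ (fun j => k (ns (ms j))) (fun j i ω' => X (τ (ns (ms j)) i ω') ω)
        (fun j => occupationLaw X (T (ns (ms j))) ω) (PX.map (X 0)) := by
  obtain ⟨c, r, hr, hball⟩ := hTball
  have hX : ∀ t, Measurable (X t) := fun t => hXmeas.comp measurable_prodMk_left
  have hprob : ∀ n, IsProbabilityMeasure
      (cond (volume : Measure (EuclideanSpace ℝ (Fin m))) (T n)) := fun n =>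
    cond_isProbabilityMeasure_of_finite (hTpos n).ne' (hTbdd n).measure_lt_top.ne
  have hprob' : ∀ n ω, IsProbabilityMeasure (occupationLaw X (T n) ω) := fun n ω =>
    Measure.isProbabilityMeasure_map (measurable_section hXmeas ω).aemeasurable
  have hlim : ∀ v : Fin l → ℚ, Tendsto (fun n => ∫⁻ ω, ‖(occupationLaw X (T (ns n)) ω).real
      (Set.Icc 0 (Cube.ratPoint v : Fin l → ℝ)) - distFun PX (X 0) (Cube.ratPoint v)‖ₑ ∂PX) atTop
      (𝓝 0) := by
    intro v
    have h1 := (tendsto_lintegral_enorm_average_sub (vol := volume) hXmeas hXhom hXerg hTmeas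
      (fun n => (hTpos n).ne') (fun n => (hTbdd n).measure_lt_top.ne) hTconv hr hball
      (measurable_boxInd (Cube.ratPoint v)) fun y =>
        abs_le.2 ⟨by linarith [boxInd_nonneg (Cube.ratPoint v) y], boxInd_le_one _ y⟩).comp hns
    have h2 : ∫ ω, boxInd (Cube.ratPoint v) (X 0 ω) ∂PX =
        distFun PX (X 0) (Cube.ratPoint v) := by
      have := Measure.isProbabilityMeasure_map (μ := PX) (hX 0).aemeasurable
      rw [← measureReal_map_Icc_eq_distFun (hX 0) (hXcube 0), ← integral_boxInd,
        integral_map (hX 0).aemeasurable (measurable_boxInd _).aestronglyMeasurable]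
    simp only [h2, integral_boxInd_cond hXmeas] at h1
    exact h1
  have hmeasM : ∀ n (v : Fin l → ℚ), AEMeasurable (fun ω => (occupationLaw X (T (ns n)) ω).real
      (Set.Icc 0 (Cube.ratPoint v : Fin l → ℝ))) PX := by
    intro n v
    simp only [← integral_boxInd_cond hXmeas]
    exact (StronglyMeasurable.integral_prod_right'
      (f := fun p : ΩX × EuclideanSpace ℝ (Fin m) => boxInd (Cube.ratPoint v) (X p.2 p.1))
      ((measurable_boxInd _).comp
        (hXmeas.comp measurable_swap)).stronglyMeasurable).measurable.aemeasurable
  -- Only countably many points can share one exceptional null set; all others are recovered by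
  -- monotonicity.
  obtain ⟨ms, hms, hae⟩ := exists_strictMono_ae_forall_tendsto hmeasM hlim
  refine ⟨ms, hms, ?_⟩
  filter_upwards [hae, ae_occupationLaw_compl_Icc_eq_zero hXmeas hXcube] with ω h1 h2
  have hmeasω := measurable_section hXmeas ω
  have hFc : Continuous fun x : Cube l => distFun PX (X 0) x := hF.comp continuous_subtype_val
  exact
    { tendsto_card := hk.comp (hns.comp hms.tendsto_atTop)
      prob := fun n => hprob' _ ω
      prob_limit := Measure.isProbabilityMeasure_map (hX 0).aemeasurable
      measurable := fun n i => hmeasω.comp (hτmeas _ i)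
      indep := fun n => (hτindep _).comp (fun _ t => X t ω) fun _ => hmeasω
      law := fun n i => by
        have h3 : Pτ.map (τ (ns (ms n)) i) = cond volume (T (ns (ms n))) := hτunif _ i
        rw [occupationLaw, ← h3, Measure.map_map hmeasω (hτmeas _ i)]
        rfl
      cube := fun n => h2 _
      cube_limit := map_compl_Icc_eq_zero (hX 0) (hXcube 0)
      tendsto := fun x => by
        rw [measureReal_map_Icc_eq_distFun (hX 0) (hXcube 0)]
        have := fun n => hprob' (ns (ms n)) ω
        exact tendsto_measureReal_Icc_of_ratPoint hFc h1 x
      continuous := by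
        simp_rw [measureReal_map_Icc_eq_distFun (hX 0) (hXcube 0)]
        exact hFc }

end Sampling

/-! ### The main theorem -/

theorem mainTheorem7
    {m l : ℕ} (hm : 1 ≤ m) (hl : 1 ≤ l)
    -- the random field, over the probability space `(ΩX, PX)`
    {ΩX : Type*} [MeasurableSpace ΩX] (PX : Measure ΩX) [IsProbabilityMeasure PX]
    (X : EuclideanSpace ℝ (Fin m) → ΩX → Fin l → ℝ)
    (hXmeas : Measurable (fun p : EuclideanSpace ℝ (Fin m) × ΩX => X p.1 p.2))
    (hXhom : IsHomogeneousField X PX)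
    (hXerg : IsErgodicField X PX)
    (hXcube : ∀ t, ∀ᵐ ω ∂PX, ∀ i, X t ω i ∈ Set.Ioo (0 : ℝ) 1)
    (hF : Continuous (distFun PX (X 0)))
    -- the averaging sets
    (T : ℕ → Set (EuclideanSpace ℝ (Fin m)))
    (hTmeas : ∀ n, MeasurableSet (T n))
    (hTbdd : ∀ n, Bornology.IsBounded (T n))
    (hTpos : ∀ n, 0 < volume (T n))
    (hTconv : ∀ n, Convex ℝ (T n))
    (hTmono : Monotone T)
    (hTball : ∃ (c : ℕ → EuclideanSpace ℝ (Fin m)) (r : ℕ → ℝ),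
      Tendsto r atTop atTop ∧ ∀ n, Metric.ball (c n) (r n) ⊆ T n)
    -- the randomizing array, over the probability space `(Ωτ, Pτ)`
    (k : ℕ → ℕ) (hk : Tendsto k atTop atTop)
    {Ωτ : Type*} [MeasurableSpace Ωτ] (Pτ : Measure Ωτ) [IsProbabilityMeasure Pτ]
    (τ : (n : ℕ) → Fin (k n) → Ωτ → EuclideanSpace ℝ (Fin m))
    (hτmeas : ∀ n i, Measurable (τ n i))
    (hτindep : ∀ n, iIndepFun (τ n) Pτ)
    (hτunif : ∀ n i, pdf.IsUniform (τ n i) (T n) Pτ volume)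
    -- the path space
    {D : Type*} [MetricSpace D] [MeasurableSpace D] [BorelSpace D] (S : PathSpace l D) :
    ∃ ν : ProbabilityMeasure C(Cube l, ℝ),
      IsBrownianBridgeLaw (distFun PX (X 0)) (ν : Measure C(Cube l, ℝ)) ∧
      (∀ L : ℕ → ΩX × Ωτ → D,
        (∀ n, S.Represents (PX.prod Pτ) (L n) (fun ω x => √(k n : ℝ) *
          (empiricalDF (fun i => X (τ n i ω.2) ω.1) x - meanDF (T n) (fun s => X s ω.1) x))) →
        TendstoInDistribution L atTop S.ofContinuous (fun _ => PX.prod Pτ)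
          (ν : Measure C(Cube l, ℝ))) ∧
      (TendstoInMeasure PX (fun n ω => √(k n : ℝ) *
          ⨆ x : Cube l, |meanDF (T n) (fun s => X s ω) x - distFun PX (X 0) x|)
          atTop (fun _ => (0 : ℝ)) →
        ∀ G : ℕ → ΩX × Ωτ → D,
          (∀ n, S.Represents (PX.prod Pτ) (G n) (fun ω x => √(k n : ℝ) *
            (empiricalDF (fun i => X (τ n i ω.2) ω.1) x - distFun PX (X 0) x))) →
          TendstoInDistribution G atTop S.ofContinuous (fun _ => PX.prod Pτ)
            (ν : Measure C(Cube l, ℝ))) := by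
  have hX : ∀ t, Measurable (X t) := fun t => hXmeas.comp measurable_prodMk_left
  have hsub := fun (ns : ℕ → ℕ) (hns : Tendsto ns atTop atTop) =>
    exists_strictMono_ae_isSampleArray hXmeas hXhom hXerg hXcube hF hTmeas hTbdd hTpos hTconv
      hTball hk hτmeas hτindep hτunif hns
  set κ := bridgeCov (l := l) (PX.map (X 0))
  have hdist : ∀ x : Fin l → ℝ, (PX.map (X 0)).real (Set.Icc 0 x) = distFun PX (X 0) x :=
    fun x => measureReal_map_Icc_eq_distFun (hX 0) (hXcube 0)
  obtain ⟨ν, hν, hpos⟩ : ∃ ν : ProbabilityMeasure C(Cube l, ℝ),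
      (∀ (ι : Type) [Fintype ι] [DecidableEq ι] (p : ι → Cube l),
        ν.map (continuous_evalVec p).aemeasurable = gaussVec κ p) ∧
      ∀ (ι : Type) [Fintype ι] (p : ι → Cube l),
        (Matrix.of fun i j => κ (p i) (p j)).PosSemidef := by
    -- A single good realization suffices to construct the bridge, since the limiting covariance
    -- depends only on the law of `X 0`.
    obtain ⟨ms, -, hms⟩ := hsub id tendsto_id
    obtain ⟨ω, hω⟩ := hms.exists
    have h := hω.isAsympGaussian (b := fun _ _ => 0) fun ε hε =>
      Eventually.of_forall fun n x => by simpa using hε.le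
    obtain ⟨ν, hν⟩ := h.exists_limit
    exact ⟨ν, hν, fun ι _ p => h.posSemidef p⟩
  -- both assertions are about the first process with a negligible drift
  have main : ∀ (β : ℕ → ΩX → Cube l → ℝ) (B : ℕ → ΩX → ℝ), (∀ n ω x, |β n ω x| ≤ B n ω) →
      TendstoInMeasure PX B atTop (fun _ => (0 : ℝ)) → ∀ Y : ℕ → ΩX × Ωτ → D,
      (∀ n, S.Represents (PX.prod Pτ) (Y n) (fun ω x => √(k n : ℝ) *
        (empiricalDF (fun i => X (τ n i ω.2) ω.1) x - meanDF (T n) (fun s => X s ω.1) x) +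
        β n ω.1 x)) →
      TendstoInDistribution Y atTop S.ofContinuous (fun _ => PX.prod Pτ)
        (ν : Measure C(Cube l, ℝ)) := by
    intro β B hβ hB Y hY
    refine S.tendstoInDistribution_prod hν (fun ns hns => ?_) hY
    obtain ⟨ms, hms, hae⟩ := hsub ns hns
    have hB' : TendstoInMeasure PX (fun j => B (ns (ms j))) atTop (fun _ => (0 : ℝ)) :=
      fun ε hε => (hB ε hε).comp (hns.comp hms.tendsto_atTop)
    -- A further subsequence turns convergence in probability into almost sure convergence, so for a
    -- fixed realization the drift is deterministic and uniformly small.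
    obtain ⟨qs, hqs, hae'⟩ := hB'.exists_seq_tendsto_ae
    refine ⟨fun j => ms (qs j), ?_⟩
    filter_upwards [hae, hae'] with ω h1 h2
    have h3 := (h1.comp hqs.tendsto_atTop).isAsympGaussian
      (b := fun j => β (ns (ms (qs j))) ω) fun ε hε => by
        filter_upwards [h2.eventually (ge_mem_nhds hε)] with j hj x
        exact (hβ _ ω x).trans hj
    convert h3 using 5 with j ω' x
    rw [normalizedDF, meanDF_eq_measureReal hXmeas]
  refine ⟨ν, ?_, fun L hL => ?_, fun hdrift G hG => ?_⟩
  · refine isBrownianBridgeLaw_of_map_eq_gaussVec (κ := κ) (fun x y => ?_) hpos hν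
    rw [← hdist, ← hdist, ← hdist]
    rfl
  · refine main (fun _ _ _ => 0) (fun _ _ => 0) (by simp) ?_ L fun n => ?_
    · exact tendstoInMeasure_of_tendsto_ae (fun _ => aestronglyMeasurable_const)
        (ae_of_all _ fun _ => tendsto_const_nhds)
    · simpa only [add_zero] using hL n
  · refine main (fun n ω x => √(k n : ℝ) *
      (meanDF (T n) (fun s => X s ω) x - distFun PX (X 0) x)) _ (fun n ω x => ?_) hdrift G
      fun n => ?_
    · rw [abs_mul, abs_of_nonneg (Real.sqrt_nonneg _)]
      refine mul_le_mul_of_nonneg_left ?_ (Real.sqrt_nonneg _)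
      have hprob : IsProbabilityMeasure (occupationLaw X (T n) ω) :=
        have := cond_isProbabilityMeasure_of_finite (hTpos n).ne' (hTbdd n).measure_lt_top.ne
        Measure.isProbabilityMeasure_map (measurable_section hXmeas ω).aemeasurable
      -- The supremum is a genuine one because both functions take values in $[0,1]$.
      refine le_ciSup (f := fun x : Cube l =>
        |meanDF (T n) (fun s => X s ω) x - distFun PX (X 0) x|) ⟨1, ?_⟩ x
      rintro _ ⟨y, rfl⟩
      have h1 : meanDF (T n) (fun s => X s ω) y ∈ Set.Icc (0 : ℝ) 1 := by
        rw [meanDF_eq_measureReal hXmeas]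
        exact ⟨measureReal_nonneg, measureReal_le_one⟩
      have h2 : distFun PX (X 0) y ∈ Set.Icc (0 : ℝ) 1 :=
        ⟨measureReal_nonneg, measureReal_le_one⟩
      exact abs_sub_le_iff.2 ⟨by linarith [h1.2, h2.1], by linarith [h1.1, h2.2]⟩
    · convert hG n using 3
      ring
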